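/- Let $\alpha\in(1/2,1)$, $\gamma,b>0$, $\zeta^{\mathtt m}_*,\lambda^{\mathtt m}_*,\zeta^{\mathtt l}_*,c\ge 0$, and let $$f^{\alpha,\gamma}(t)=\gamma t^{\alpha-1}\sum_{n\ge 0}\frac{(-\gamma t^\alpha)^n}{\Gamma(\alpha n+\alpha)},\quad t>0,$$ be the Mittag-Leffler density, $L_K(t)=\frac{t^{-\alpha}}{\gamma\,\Gamma(1-\alpha)}$, and $\nu_*(dy)=c\,y^{-\alpha-2}\,dy$ on $(0,\infty)$. Assume that $\frac{\zeta^{\mathtt l}_*}{b}\,\nu_*([t,\infty))\le -L_K'(t)$ for $t>0$, i.e. $\frac{\zeta^{\mathtt l}_*}{b}\cdot\frac{c}{\alpha+1}\le\frac{\alpha}{\gamma\,\Gamma(1-\alpha)}$. For a locally integrable function $\psi$ on $[0,\infty)$ put $$\mathcal V\circ\psi(t)=\int_0^\infty\Big(\exp\Big\{-\int_{(t-y)^+}^t\frac{\zeta^{\mathtt l}_*}{b}\psi(s)\,ds\Big\}-1+\int_{(t-y)^+}^t\frac{\zeta^{\mathtt l}_*}{b}\psi(s)\,ds\Big)\nu_*(dy),$$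 and write $(h*k)(t)=\int_0^t h(s)k(t-s)\,ds$. For $\lambda\ge 0$ and $g\in L^\infty(\mathbb R_+;\mathbb R_+)$ consider the generalized Volterra-Riccati equation $$\psi=\lambda f^{\alpha,\gamma}+g*f^{\alpha,\gamma}-\frac12\Big(\frac{\zeta^{\mathtt m}_*\sqrt{\lambda^{\mathtt m}_*}}{b}\Big)^2|\psi|^2*f^{\alpha,\gamma}-(\mathcal V\circ\psi)*f^{\alpha,\gamma}.\qquad(1)$$ A global solution of (1) is a function $\psi:(0,\infty)\to\mathbb R$ satisfying (1) at every $t>0$ such that, for every $T>0$, $\psi$ is integrable on $(0,T]$ and $\sup_{0<t\le T}t^{1-\alpha}|\psi(t)|<\infty$ if $\lambda>0$, respectively $\sup_{0<t\le T}|\psi(t)|<\infty$ if $\lambda=0$. Then, for every $\lambda\ge0$ and every $g\in L^\infty(\mathbb R_+;\mathbb R_+)$, equation (1) has a unique global solution $\psi^\lambda_g$. It is continuous on $(0,\infty)$, and for every $T>0$ there is a constant $C>0$ such that $$0\le\psi^\lambda_g(t)\le C\,(1+t^{\alpha-1})\quad\text{for all }t\in(0,T].$$ -/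

import Mathlib

open MeasureTheory Set

noncomputable section

/-- The two-parameter Mittag-Leffler function `E_{α,β}(z) = ∑ zⁿ / Γ(α n + β)`. -/
def mittagLeffler (α β z : ℝ) : ℝ :=
  ∑' n : ℕ, z ^ n / Real.Gamma (α * n + β)

/-- The Mittag-Leffler density `f^{α,γ}(t) = γ t^{α-1} E_{α,α}(-γ t^α)`, used for `t > 0`. -/
def mittagLefflerDensity (α γ t : ℝ) : ℝ :=
  γ * t ^ (α - 1) * mittagLeffler α α (-(γ * t ^ α))

/-- The measure `ν_*(dy) = c y^{-α-2} dy` on `(0, ∞)`. -/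
def nuStar (α c : ℝ) : Measure ℝ :=
  (volume.restrict (Ioi 0)).withDensity fun y => ENNReal.ofReal (c * y ^ (-α - 2))

/-- Convolution on the half line, `(h * k)(t) = ∫₀ᵗ h(s) k(t - s) ds`. -/
def halfLineConv (h k : ℝ → ℝ) (t : ℝ) : ℝ :=
  ∫ s in (0 : ℝ)..t, h s * k (t - s)

/-- The nonlinear operator
`𝒱 ∘ f(t) = ∫ (exp(-∫_{(t-y)⁺}^t (ζl/b) f(s) ds) - 1 + ∫_{(t-y)⁺}^t (ζl/b) f(s) ds) ν_*(dy)`. -/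
def operatorV (α c b ζl : ℝ) (f : ℝ → ℝ) (t : ℝ) : ℝ :=
  ∫ y, (Real.exp (-∫ s in (max (t - y) 0)..t, ζl / b * f s) - 1
    + ∫ s in (max (t - y) 0)..t, ζl / b * f s) ∂(nuStar α c)

/-- The right-hand side of the generalized Volterra-Riccati equation,
`λ f^{α,γ} + g * f^{α,γ} - ½ (ζm √λm / b)² |ψ|² * f^{α,γ} - (𝒱 ∘ ψ) * f^{α,γ}`. -/
def riccatiRHS (α γ b ζm lamm ζl c lam : ℝ) (g ψ : ℝ → ℝ) (t : ℝ) : ℝ :=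
  lam * mittagLefflerDensity α γ t
    + halfLineConv g (mittagLefflerDensity α γ) t
    - 1 / 2 * (ζm * √lamm / b) ^ 2
        * halfLineConv (fun s => |ψ s| ^ 2) (mittagLefflerDensity α γ) t
    - halfLineConv (operatorV α c b ζl ψ) (mittagLefflerDensity α γ) t

/-- The space `𝒜_T^λ` of integrable functions `f` on `(0, T]` with
`sup_{0 < t ≤ T} t^{1-α} |f(t)| < ∞` if `λ > 0`, and `sup_{0 < t ≤ T} |f(t)| < ∞` if `λ = 0`. -/
def MemSolutionSpace (α lam T : ℝ) (f : ℝ → ℝ) : Prop :=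
  IntegrableOn f (Ioc 0 T) ∧
    (0 < lam → BddAbove ((fun t => t ^ (1 - α) * |f t|) '' Ioc 0 T)) ∧
    (lam = 0 → BddAbove ((fun t => |f t|) '' Ioc 0 T))

/-- `ψ` solves the generalized Volterra-Riccati equation on `(0, T]`. -/
def IsLocalSolution (α γ b ζm lamm ζl c lam : ℝ) (g : ℝ → ℝ) (T : ℝ) (ψ : ℝ → ℝ) : Prop :=
  MemSolutionSpace α lam T ψ ∧
    ∀ t ∈ Ioc 0 T, ψ t = riccatiRHS α γ b ζm lamm ζl c lam g ψ t

/-- `ψ` is a global solution; only its values on `(0, ∞)` matter. -/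
def IsGlobalSolution (α γ b ζm lamm ζl c lam : ℝ) (g ψ : ℝ → ℝ) : Prop :=
  ∀ T : ℝ, 0 < T → IsLocalSolution α γ b ζm lamm ζl c lam g T ψ

end

/-! Write f for the Mittag-Leffler density, K(t) = t^{α-1}/Γ(α), and N(ψ) = ½σ²|ψ|² + 𝒱∘ψ with σ the
coefficient of the square. The equation is ψ = h - N(ψ) * f with forcing h = λf + g * f. If |ψ| ≤ M
s^{α-1}, then N(ψ) is of order s^{2α-2}, which is integrable because α > 1/2, and N is Lipschitz on
such balls (`singularLipschitz_riccatiNonlinearity`). In the norm sup e^{-Λt} t^{1-α}|·| with Λ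
large, ψ ↦ N(ψ) * f contracts by the factor 1/2 (`SingularLipschitz.exists_contraction`). Uniqueness
and stability follow from this.

N is quadratic, so global existence needs a priori bounds. The argument of N is truncated to [0, U]
with U(t) = A t^{α-1} + B t^α. Picard iteration then converges at every time
(`SingularLipschitz.exists_solution`). Since N ≥ 0 and f > 0, any solution of the truncated equation
lies below h ≤ U. Only ψ ≥ 0 is left to prove before the truncation can be removed.

Positivity is a first-zero argument. Because f is the resolvent of γK, that is f + γ f * K = γK
(`mittagLefflerDensity_add_conv_fracKernel`), the truncated equation also reads ψ = λγK + γ(g - W) *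
K with W = N(v) + ψ, where v is the truncation of ψ (`resolvent_form`). When λ > 0 the term λf
dominates near 0, so ψ starts positive. At a first zero t, a fractional derivative cut off near 0
gives ∫ ψ(t-y)(-L_K'(y)) dy ≤ W(t) (`halfLineConv_cutLevyDensity_le`). There the square and ψ
vanish, so W(t) = 𝒱∘v(t). On the other hand e^{-x} - 1 + x ≤ x, Tonelli and the compatibility of ν_*
with -L_K' bound 𝒱∘v(t) by the same integral, and the inequality is strict (`exists_operatorV_lt`).
This is a contradiction. The case λ = 0 follows by approximating with λ + 1/(k+1) and stability. The
positivity of f comes from the same maximum principle with W = f. -/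

section PowerBounds
open Filter Topology
open scoped Convolution

/-! ### Power bounds and convolutions on the half line -/

lemma integral_rpow_mul_sub_rpow {a b t : ℝ} (ha : 0 < a) (hb : 0 < b) (ht : 0 < t) :
    ∫ s in (0 : ℝ)..t, s ^ (a - 1) * (t - s) ^ (b - 1)
      = t ^ (a + b - 1) * ProbabilityTheory.beta a b := by
  have h := Complex.betaIntegral_scaled a b ht
  rw [Complex.betaIntegral_eq_Gamma_mul_div _ _ (by simpa) (by simpa)] at h
  have h1 : ((∫ s in (0 : ℝ)..t, s ^ (a - 1) * (t - s) ^ (b - 1) : ℝ) : ℂ)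
      = ∫ x in (0 : ℝ)..t, (x : ℂ) ^ ((a : ℂ) - 1) * (t - x) ^ ((b : ℂ) - 1) := by
    rw [← intervalIntegral.integral_ofReal]
    apply intervalIntegral.integral_congr
    intro x hx
    rw [uIcc_of_le ht.le] at hx
    simp only
    rw [Complex.ofReal_mul, Complex.ofReal_cpow hx.1, Complex.ofReal_cpow (by linarith [hx.2])]
    push_cast
    rfl
  have h2 : (t : ℂ) ^ ((a : ℂ) + b - 1) = ((t ^ (a + b - 1) : ℝ) : ℂ) := by
    rw [Complex.ofReal_cpow ht.le]; push_cast; rfl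
  rw [← h1, h2, ← Complex.ofReal_add, Complex.Gamma_ofReal, Complex.Gamma_ofReal,
    Complex.Gamma_ofReal] at h
  rw [ProbabilityTheory.beta]
  exact_mod_cast h

lemma intervalIntegrable_rpow_mul_sub_rpow {a b t : ℝ} (ha : 0 < a) (hb : 0 < b) (ht : 0 < t) :
    IntervalIntegrable (fun s => s ^ (a - 1) * (t - s) ^ (b - 1)) volume 0 t := by
  rw [intervalIntegrable_iff_integrableOn_Ioc_of_le ht.le]
  -- A non-integrable function has Bochner integral 0, so the positive value of the beta integral
  -- already forces integrability.
  apply Integrable.of_integral_ne_zero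
  rw [← intervalIntegral.integral_of_le ht.le, integral_rpow_mul_sub_rpow ha hb ht]
  exact (mul_pos (Real.rpow_pos_of_pos ht _) (ProbabilityTheory.beta_pos ha hb)).ne'

lemma integrableOn_rpow_sub_one {x T : ℝ} (hx : 0 < x) (hT : 0 ≤ T) :
    IntegrableOn (fun s : ℝ => s ^ (x - 1)) (Ioc 0 T) := by
  rw [← intervalIntegrable_iff_integrableOn_Ioc_of_le hT]
  exact intervalIntegral.intervalIntegrable_rpow' (by linarith)

/-- `G` is measurable on `(0, T]` and `|G s| ≤ C s^{x-1}` there for some constant `C`. -/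
def PowBound (x T : ℝ) (G : ℝ → ℝ) : Prop :=
  AEStronglyMeasurable G (volume.restrict (Ioc 0 T)) ∧
    ∃ C : ℝ, ∀ᵐ s ∂(volume.restrict (Ioc 0 T)), |G s| ≤ C * s ^ (x - 1)

namespace PowBound

variable {x y z T : ℝ} {F G H : ℝ → ℝ}

lemma of_forall (hG : AEStronglyMeasurable G (volume.restrict (Ioc 0 T))) {C : ℝ}
    (h : ∀ s ∈ Ioc 0 T, |G s| ≤ C * s ^ (x - 1)) : PowBound x T G :=
  ⟨hG, C, (ae_restrict_iff' measurableSet_Ioc).2 (.of_forall h)⟩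

lemma congr (hG : PowBound x T G) (h : ∀ s ∈ Ioc 0 T, G s = H s) : PowBound x T H := by
  have h' : G =ᵐ[volume.restrict (Ioc 0 T)] H :=
    (ae_restrict_iff' measurableSet_Ioc).2 (.of_forall h)
  obtain ⟨hm, C, hC⟩ := hG
  refine ⟨hm.congr h', C, ?_⟩
  filter_upwards [h', hC] with s h1 h2
  rwa [← h1]

lemma add (hG : PowBound x T G) (hH : PowBound x T H) : PowBound x T (fun s => G s + H s) := by
  obtain ⟨hm, C, hC⟩ := hG
  obtain ⟨hm', C', hC'⟩ := hH
  refine ⟨hm.add hm', C + C', ?_⟩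
  filter_upwards [hC, hC'] with s h1 h2
  rw [add_mul]
  exact (abs_add_le _ _).trans (add_le_add h1 h2)

lemma const_mul (hG : PowBound x T G) (a : ℝ) : PowBound x T (fun s => a * G s) := by
  obtain ⟨hm, C, hC⟩ := hG
  refine ⟨hm.const_mul a, |a| * C, ?_⟩
  filter_upwards [hC] with s h1
  rw [abs_mul, mul_assoc]
  exact mul_le_mul_of_nonneg_left h1 (abs_nonneg _)

lemma sub (hG : PowBound x T G) (hH : PowBound x T H) : PowBound x T (fun s => G s - H s) := by
  simpa [sub_eq_add_neg] using hG.add (hH.const_mul (-1))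

lemma abs (hG : PowBound x T G) : PowBound x T (fun s => |G s|) := by
  obtain ⟨hm, C, hC⟩ := hG
  exact ⟨hm.norm, C, by simpa using hC⟩

lemma exists_nonneg (hG : PowBound x T G) :
    ∃ C : ℝ, 0 ≤ C ∧ ∀ᵐ s ∂(volume.restrict (Ioc 0 T)), |G s| ≤ C * s ^ (x - 1) := by
  obtain ⟨hm, C, hC⟩ := hG
  refine ⟨|C|, abs_nonneg C, ?_⟩
  filter_upwards [hC, ae_restrict_mem measurableSet_Ioc] with s h1 h2
  exact h1.trans (mul_le_mul_of_nonneg_right (le_abs_self C) (Real.rpow_nonneg h2.1.le _))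

lemma mono_exponent (hG : PowBound x T G) (h : y ≤ x) : PowBound y T G := by
  obtain ⟨C, hC0, hC⟩ := hG.exists_nonneg
  refine ⟨hG.1, C * T ^ (x - y), ?_⟩
  filter_upwards [hC, ae_restrict_mem measurableSet_Ioc] with s h1 h2
  refine h1.trans ?_
  rw [mul_assoc]
  refine mul_le_mul_of_nonneg_left ?_ hC0
  rw [show x - 1 = (x - y) + (y - 1) by ring, Real.rpow_add h2.1]
  exact mul_le_mul_of_nonneg_right (Real.rpow_le_rpow h2.1.le h2.2 (by linarith))
    (Real.rpow_nonneg h2.1.le _)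

lemma mono_time (hG : PowBound x T G) {S : ℝ} (h : S ≤ T) : PowBound x S G := by
  have hr : volume.restrict (Ioc 0 S) ≤ volume.restrict (Ioc 0 T) :=
    Measure.restrict_mono (Ioc_subset_Ioc_right h) le_rfl
  obtain ⟨hm, C, hC⟩ := hG
  exact ⟨hm.mono_measure hr, C, ae_mono hr hC⟩

lemma integrableOn (hG : PowBound x T G) (hx : 0 < x) : IntegrableOn G (Ioc 0 T) := by
  rcases le_or_gt T 0 with hT | hT
  · simp [Ioc_eq_empty (not_lt.2 hT)]
  obtain ⟨hm, C, hC⟩ := hG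
  exact ((integrableOn_rpow_sub_one hx hT.le).const_mul C).mono' hm hC

lemma rpow (x T : ℝ) : PowBound x T (fun s => s ^ (x - 1)) := by
  refine of_forall (C := 1) (by fun_prop) fun s hs => ?_
  rw [one_mul, abs_of_nonneg (Real.rpow_nonneg hs.1.le _)]

lemma aestronglyMeasurable_conv (hG : PowBound x T G) (hH : PowBound y T H) {t : ℝ} (ht : t ≤ T) :
    AEStronglyMeasurable (fun s => G s * H (t - s)) (volume.restrict (Ioo 0 t)) := by
  refine AEStronglyMeasurable.mul (hG.1.mono_measure
    (Measure.restrict_mono (Ioo_subset_Ioc_self.trans (Ioc_subset_Ioc_right ht)) le_rfl)) ?_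
  have h1 : AEStronglyMeasurable (indicator (Ioc 0 T) H) volume :=
    (aestronglyMeasurable_indicator_iff measurableSet_Ioc).2 hH.1
  have h2 := (h1.comp_measurePreserving (Measure.measurePreserving_sub_left volume t)).restrict
    (s := Ioo 0 t)
  refine h2.congr ((ae_restrict_iff' measurableSet_Ioo).2 (.of_forall fun s hs => ?_))
  exact indicator_of_mem (show t - s ∈ Ioc 0 T from ⟨by linarith [hs.2], by linarith [hs.1]⟩) H

lemma ae_bound_conv {C C' : ℝ} (hC0 : 0 ≤ C)
    (hC : ∀ᵐ s ∂(volume.restrict (Ioc 0 T)), |G s| ≤ C * s ^ (x - 1))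
    (hC' : ∀ᵐ s ∂(volume.restrict (Ioc 0 T)), |H s| ≤ C' * s ^ (y - 1)) {t : ℝ} (ht : t ≤ T) :
    ∀ᵐ s ∂(volume.restrict (Ioo 0 t)),
      |G s * H (t - s)| ≤ C * C' * (s ^ (x - 1) * (t - s) ^ (y - 1)) := by
  have h2 := (Measure.measurePreserving_sub_left volume t).quasiMeasurePreserving.ae
    ((ae_restrict_iff' measurableSet_Ioc).1 hC')
  rw [ae_restrict_iff' measurableSet_Ioc] at hC
  rw [ae_restrict_iff' measurableSet_Ioo]
  filter_upwards [hC, h2] with s h1 h2 hs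
  have h1 := h1 ⟨hs.1, hs.2.le.trans ht⟩
  have h2 := h2 ⟨by linarith [hs.2], by linarith [hs.1]⟩
  rw [abs_mul, show C * C' * (s ^ (x - 1) * (t - s) ^ (y - 1))
    = (C * s ^ (x - 1)) * (C' * (t - s) ^ (y - 1)) by ring]
  exact mul_le_mul h1 h2 (abs_nonneg _) (mul_nonneg hC0 (Real.rpow_nonneg hs.1.le _))

lemma intervalIntegrable_conv (hG : PowBound x T G) (hH : PowBound y T H) (hx : 0 < x)
    (hy : 0 < y) {t : ℝ} (ht : t ∈ Ioc 0 T) :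
    IntervalIntegrable (fun s => G s * H (t - s)) volume 0 t := by
  obtain ⟨C, hC0, hC⟩ := hG.exists_nonneg
  obtain ⟨C', -, hC'⟩ := hH.exists_nonneg
  have h := intervalIntegrable_rpow_mul_sub_rpow hx hy ht.1
  rw [intervalIntegrable_iff_integrableOn_Ioo_of_le ht.1.le] at h ⊢
  exact (h.const_mul (C * C')).mono' (hG.aestronglyMeasurable_conv hH ht.2)
    (ae_bound_conv hC0 hC hC' ht.2)

end PowBound

/-! ### Half-line convolution: size, linearity, associativity. -/

lemma abs_halfLineConv_le {x y T C C' : ℝ} {G H : ℝ → ℝ} (hx : 0 < x) (hy : 0 < y)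
    (hC0 : 0 ≤ C)
    (hC : ∀ᵐ s ∂(volume.restrict (Ioc 0 T)), |G s| ≤ C * s ^ (x - 1))
    (hC' : ∀ᵐ s ∂(volume.restrict (Ioc 0 T)), |H s| ≤ C' * s ^ (y - 1))
    {t : ℝ} (ht : t ∈ Ioc 0 T) :
    |halfLineConv G H t| ≤ C * C' * ProbabilityTheory.beta x y * t ^ (x + y - 1) := by
  have h := intervalIntegrable_rpow_mul_sub_rpow hx hy ht.1
  have h3 : ‖halfLineConv G H t‖ ≤
      ∫ s in (0 : ℝ)..t, C * C' * (s ^ (x - 1) * (t - s) ^ (y - 1)) := by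
    refine intervalIntegral.norm_integral_le_of_norm_le ht.1.le ?_ (h.const_mul _)
    rw [← ae_restrict_iff' measurableSet_Ioc, ← restrict_Ioo_eq_restrict_Ioc]
    exact PowBound.ae_bound_conv hC0 hC hC' ht.2
  rw [intervalIntegral.integral_const_mul, integral_rpow_mul_sub_rpow hx hy ht.1,
    Real.norm_eq_abs] at h3
  linarith

lemma halfLineConv_comm (G H : ℝ → ℝ) (t : ℝ) : halfLineConv G H t = halfLineConv H G t := by
  have h := intervalIntegral.integral_comp_sub_left (a := 0) (b := t)
    (fun s => H s * G (t - s)) t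
  simp only [sub_self, sub_zero, sub_sub_cancel] at h
  rw [halfLineConv, halfLineConv, ← h]
  simp only [mul_comm]

lemma halfLineConv_congr {G G' H H' : ℝ → ℝ} {t : ℝ} (ht : 0 ≤ t) (hG : ∀ s ∈ Ioo 0 t, G s = G' s)
    (hH : ∀ s ∈ Ioo 0 t, H s = H' s) : halfLineConv G H t = halfLineConv G' H' t := by
  rw [halfLineConv, halfLineConv, intervalIntegral.integral_of_le ht,
    intervalIntegral.integral_of_le ht, integral_Ioc_eq_integral_Ioo,
    integral_Ioc_eq_integral_Ioo]
  refine setIntegral_congr_fun measurableSet_Ioo fun s hs => ?_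
  rw [hG s hs, hH (t - s) ⟨by linarith [hs.2], by linarith [hs.1]⟩]

lemma halfLineConv_const_mul_left (a : ℝ) (G H : ℝ → ℝ) (t : ℝ) :
    halfLineConv (fun s => a * G s) H t = a * halfLineConv G H t := by
  simp only [halfLineConv, mul_assoc, intervalIntegral.integral_const_mul]

lemma halfLineConv_const_mul_right (a : ℝ) (G H : ℝ → ℝ) (t : ℝ) :
    halfLineConv G (fun s => a * H s) t = a * halfLineConv G H t := by
  rw [halfLineConv_comm, halfLineConv_const_mul_left, halfLineConv_comm]

section
variable {x y z T : ℝ} {F G H : ℝ → ℝ}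

lemma halfLineConv_add_left (hF : PowBound x T F) (hG : PowBound x T G) (hH : PowBound y T H)
    (hx : 0 < x) (hy : 0 < y) {t : ℝ} (ht : t ∈ Ioc 0 T) :
    halfLineConv (fun s => F s + G s) H t = halfLineConv F H t + halfLineConv G H t := by
  simp only [halfLineConv, add_mul]
  exact intervalIntegral.integral_add (hF.intervalIntegrable_conv hH hx hy ht)
    (hG.intervalIntegrable_conv hH hx hy ht)

lemma halfLineConv_sub_left (hF : PowBound x T F) (hG : PowBound x T G) (hH : PowBound y T H)
    (hx : 0 < x) (hy : 0 < y) {t : ℝ} (ht : t ∈ Ioc 0 T) :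
    halfLineConv (fun s => F s - G s) H t = halfLineConv F H t - halfLineConv G H t := by
  simp only [halfLineConv, sub_mul]
  exact intervalIntegral.integral_sub (hF.intervalIntegrable_conv hH hx hy ht)
    (hG.intervalIntegrable_conv hH hx hy ht)

lemma halfLineConv_add_right (hF : PowBound x T F) (hG : PowBound x T G) (hH : PowBound y T H)
    (hx : 0 < x) (hy : 0 < y) {t : ℝ} (ht : t ∈ Ioc 0 T) :
    halfLineConv H (fun s => F s + G s) t = halfLineConv H F t + halfLineConv H G t := by
  rw [halfLineConv_comm, halfLineConv_add_left hF hG hH hx hy ht, halfLineConv_comm F,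
    halfLineConv_comm G]

lemma halfLineConv_sub_right (hF : PowBound x T F) (hG : PowBound x T G) (hH : PowBound y T H)
    (hx : 0 < x) (hy : 0 < y) {t : ℝ} (ht : t ∈ Ioc 0 T) :
    halfLineConv H (fun s => F s - G s) t = halfLineConv H F t - halfLineConv H G t := by
  rw [halfLineConv_comm, halfLineConv_sub_left hF hG hH hx hy ht, halfLineConv_comm F,
    halfLineConv_comm G]

lemma indicator_mul_indicator_sub (t s : ℝ) (ht : t ≤ T) :
    indicator (Ioc 0 T) F s * indicator (Ioc 0 T) G (t - s)
      = indicator (Ioo 0 t) (fun s => F s * G (t - s)) s := by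
  by_cases hs : s ∈ Ioo 0 t
  · rw [indicator_of_mem hs, indicator_of_mem (show s ∈ Ioc 0 T from ⟨hs.1, hs.2.le.trans ht⟩),
      indicator_of_mem (show t - s ∈ Ioc 0 T from ⟨by linarith [hs.2], by linarith [hs.1]⟩)]
  · rw [indicator_of_notMem hs]
    by_cases h1 : s ∈ Ioc 0 T
    · rw [indicator_of_notMem (s := Ioc 0 T) (a := t - s), mul_zero]
      intro h2
      exact hs ⟨h1.1, by linarith [h2.1]⟩
    · rw [indicator_of_notMem h1, zero_mul]

/-- On (0, T] the half-line convolution is the convolution over ℝ of the truncations to (0, T], so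
the general theory of `convolution` supplies measurability and associativity. -/
lemma convolution_indicator (F G : ℝ → ℝ) {t : ℝ} (ht : t ∈ Ioc 0 T) :
    (indicator (Ioc 0 T) F ⋆[ContinuousLinearMap.mul ℝ ℝ, volume] indicator (Ioc 0 T) G) t
      = halfLineConv F G t := by
  rw [convolution, halfLineConv, intervalIntegral.integral_of_le ht.1.le,
    integral_Ioc_eq_integral_Ioo, ← integral_indicator measurableSet_Ioo]
  simp only [ContinuousLinearMap.mul_apply', indicator_mul_indicator_sub _ _ ht.2]

lemma convolution_indicator_of_nonpos (F G : ℝ → ℝ) {t : ℝ} (ht : t ≤ 0) (hT : 0 ≤ T) :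
    (indicator (Ioc 0 T) F ⋆[ContinuousLinearMap.mul ℝ ℝ, volume] indicator (Ioc 0 T) G) t
      = 0 := by
  simp only [convolution, ContinuousLinearMap.mul_apply',
    indicator_mul_indicator_sub _ _ (ht.trans hT), Ioo_eq_empty (not_lt.2 ht)]
  simp

lemma PowBound.integrable_indicator (hG : PowBound x T G) (hx : 0 < x) :
    Integrable (indicator (Ioc 0 T) G) :=
  (integrable_indicator_iff measurableSet_Ioc).2 (hG.integrableOn hx)

lemma PowBound.conv (hG : PowBound x T G) (hH : PowBound y T H) (hx : 0 < x) (hy : 0 < y) :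
    PowBound (x + y) T (halfLineConv G H) := by
  obtain ⟨C, hC0, hC⟩ := hG.exists_nonneg
  obtain ⟨C', -, hC'⟩ := hH.exists_nonneg
  refine PowBound.of_forall ?_ fun t ht => abs_halfLineConv_le hx hy hC0 hC hC' ht
  have h := ((hG.integrable_indicator hx).integrable_convolution (ContinuousLinearMap.mul ℝ ℝ)
    (hH.integrable_indicator hy)).aestronglyMeasurable.restrict (s := Ioc 0 T)
  exact h.congr ((ae_restrict_iff' measurableSet_Ioc).2
    (.of_forall fun t ht => convolution_indicator G H ht))

lemma halfLineConv_assoc (hF : PowBound x T F) (hG : PowBound y T G) (hH : PowBound z T H)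
    (hx : 0 < x) (hy : 0 < y) (hz : 0 < z) {t : ℝ} (ht : t ∈ Ioc 0 T) :
    halfLineConv (halfLineConv F G) H t = halfLineConv F (halfLineConv G H) t := by
  have iF := hF.integrable_indicator hx
  have iG := hG.integrable_indicator hy
  have iH := hH.integrable_indicator hz
  have key := convolution_assoc (ContinuousLinearMap.mul ℝ ℝ) (ContinuousLinearMap.mul ℝ ℝ)
    (ContinuousLinearMap.mul ℝ ℝ) (ContinuousLinearMap.mul ℝ ℝ) (μ := volume) (ν := volume)
    (f := indicator (Ioc 0 T) F) (g := indicator (Ioc 0 T) G) (k := indicator (Ioc 0 T) H)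
    (fun a b c => by simp [mul_assoc]) (x₀ := t) iF.aestronglyMeasurable iG.aestronglyMeasurable
    iH.aestronglyMeasurable (iF.ae_convolution_exists _ iG)
    (iG.norm.ae_convolution_exists _ iH.norm) ?_
  -- The convolution of two truncations is not the truncated half-line convolution beyond T. At time
  -- t ≤ T the outer convolution only sees the inner one at times below t, where the two agree.
  · have conv_restrict : ∀ A B C : ℝ → ℝ, (∀ s < t, A s = B s) → (∀ s ≤ 0, C s = 0) →
        (A ⋆[ContinuousLinearMap.mul ℝ ℝ, volume] C) t
          = (B ⋆[ContinuousLinearMap.mul ℝ ℝ, volume] C) t := by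
      intro A B C hAB hC
      simp only [convolution, ContinuousLinearMap.mul_apply']
      congr 1; ext s
      rcases lt_or_ge s t with h | h
      · rw [hAB s h]
      · rw [hC (t - s) (by linarith), mul_zero, mul_zero]
    have hT : 0 ≤ T := ht.1.le.trans ht.2
    have hind : ∀ A B : ℝ → ℝ, ∀ s < t,
        (indicator (Ioc 0 T) A ⋆[ContinuousLinearMap.mul ℝ ℝ, volume] indicator (Ioc 0 T) B) s
          = indicator (Ioc 0 T) (halfLineConv A B) s := by
      intro A B s hs
      rcases le_or_gt s 0 with h | h
      · rw [convolution_indicator_of_nonpos _ _ h hT,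
          indicator_of_notMem (fun h' => absurd h'.1 (not_lt.2 h))]
      · have hs' : s ∈ Ioc 0 T := ⟨h, hs.le.trans ht.2⟩
        rw [convolution_indicator _ _ hs', indicator_of_mem hs']
    have hzero : ∀ A : ℝ → ℝ, ∀ s ≤ 0, indicator (Ioc 0 T) A s = 0 := fun A s hs =>
      indicator_of_notMem (fun h' => absurd h'.1 (not_lt.2 hs)) A
    rw [conv_restrict _ _ _ (hind F G) (hzero H), convolution_indicator _ _ ht] at key
    rw [key, ← convolution_indicator _ _ ht, ← convolution_flip,
      ← convolution_flip (f := indicator (Ioc 0 T) F)]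
    have hflip : (ContinuousLinearMap.mul ℝ ℝ).flip = ContinuousLinearMap.mul ℝ ℝ := by
      ext; simp
    rw [hflip, conv_restrict _ _ _ (hind G H) (hzero F)]
  -- Associativity at this particular t, rather than almost everywhere, requires |F| * (|G| * |H|)
  -- to be finite at t; the beta bounds give this.
  · have hE := hG.abs.conv hH.abs hy hz
    have hi := hF.abs.intervalIntegrable_conv hE hx (by linarith) ht
    rw [intervalIntegrable_iff_integrableOn_Ioo_of_le ht.1.le,
      ← integrable_indicator_iff measurableSet_Ioo] at hi
    unfold ConvolutionExistsAt
    refine hi.congr (.of_forall fun s => ?_)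
    have habs : ∀ A : ℝ → ℝ, (fun s => ‖indicator (Ioc 0 T) A s‖)
        = indicator (Ioc 0 T) (fun s => |A s|) := by
      intro A; ext s; rw [norm_indicator_eq_indicator_norm]; rfl
    simp only [ContinuousLinearMap.mul_apply', habs]
    by_cases hs : s ∈ Ioo 0 t
    · have h1 : t - s ∈ Ioc 0 T := ⟨by linarith [hs.2], by linarith [hs.1, ht.2]⟩
      rw [indicator_of_mem hs, convolution_indicator _ _ h1,
        congrFun (habs F) s, indicator_of_mem (show s ∈ Ioc 0 T from ⟨hs.1, hs.2.le.trans ht.2⟩)]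
    · rw [indicator_of_notMem hs]
      rcases le_or_gt s 0 with h | h
      · rw [congrFun (habs F) s, indicator_of_notMem (fun h' => absurd h'.1 (not_lt.2 h)), zero_mul]
      · have h1 : t - s ≤ 0 := by
          by_contra h2
          exact hs ⟨h, by linarith⟩
        rw [convolution_indicator_of_nonpos _ _ h1 (ht.1.le.trans ht.2), mul_zero]

end
end PowerBounds

section ContinuityOfConvolution
open Filter Topology
open scoped Convolution

/-! ### Continuity of convolutions -/

/-- A bounded continuous function on `ℝ` vanishing on `(-∞, 0]` and equal to `k` on `[δ, T]`. -/
noncomputable def truncatedKernel (k : ℝ → ℝ) (δ T r : ℝ) : ℝ :=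
  k (max δ (min r T)) * min 1 (max 0 r / δ)

lemma truncatedKernel_of_nonpos (k : ℝ → ℝ) {δ T r : ℝ} (hr : r ≤ 0) :
    truncatedKernel k δ T r = 0 := by
  simp [truncatedKernel, max_eq_left hr]

lemma truncatedKernel_of_le (k : ℝ → ℝ) {δ T r : ℝ} (hδ : 0 < δ) (hr : δ ≤ r) (hr' : r ≤ T) :
    truncatedKernel k δ T r = k r := by
  rw [truncatedKernel, min_eq_left hr', max_eq_right hr, max_eq_right (hδ.le.trans hr),
    min_eq_left ((one_le_div hδ).2 hr), mul_one]

lemma continuous_truncatedKernel {k : ℝ → ℝ} {δ T : ℝ} (hδ : 0 < δ) (hδT : δ ≤ T)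
    (hk : ContinuousOn k (Ioc 0 T)) : Continuous (truncatedKernel k δ T) := by
  have h : Continuous fun r : ℝ => k (max δ (min r T)) :=
    hk.comp_continuous (by fun_prop) fun r =>
      ⟨lt_max_of_lt_left hδ, max_le hδT (min_le_right _ _)⟩
  exact h.mul (by fun_prop)

lemma abs_truncatedKernel_le {k : ℝ → ℝ} {δ T y C : ℝ} (hδ : 0 < δ) (hδT : δ ≤ T)
    (hy1 : y ≤ 1) (hC0 : 0 ≤ C) (hk : ∀ r ∈ Ioc 0 T, |k r| ≤ C * r ^ (y - 1)) (r : ℝ) :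
    |truncatedKernel k δ T r| ≤ C * δ ^ (y - 1) := by
  rw [truncatedKernel, abs_mul]
  have h1 : |min 1 (max 0 r / δ)| ≤ 1 := by
    rw [abs_of_nonneg (le_min zero_le_one (div_nonneg (le_max_left _ _) hδ.le))]
    exact min_le_left _ _
  have h2 : δ ≤ max δ (min r T) := le_max_left _ _
  calc |k (max δ (min r T))| * |min 1 (max 0 r / δ)| ≤ |k (max δ (min r T))| * 1 :=
        mul_le_mul_of_nonneg_left h1 (abs_nonneg _)
    _ ≤ C * (max δ (min r T)) ^ (y - 1) := by
        rw [mul_one]; exact hk _ ⟨hδ.trans_le h2, max_le hδT (min_le_right _ _)⟩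
    _ ≤ C * δ ^ (y - 1) := mul_le_mul_of_nonneg_left
        (Real.rpow_le_rpow_of_nonpos hδ h2 (by linarith)) hC0

lemma abs_truncatedKernel_sub_le {k : ℝ → ℝ} {δ T y C : ℝ} (hδ : 0 < δ) (hδT : δ ≤ T)
    (hy1 : y ≤ 1) (hC0 : 0 ≤ C) (hk : ∀ r ∈ Ioc 0 T, |k r| ≤ C * r ^ (y - 1)) {r : ℝ}
    (hr : r ∈ Ioc 0 T) :
    |k r - truncatedKernel k δ T r| ≤ indicator (Iio δ) (fun r => 2 * C * r ^ (y - 1)) r := by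
  rcases lt_or_ge r δ with h | h
  · rw [indicator_of_mem (show r ∈ Iio δ from h)]
    have h1 := abs_truncatedKernel_le hδ hδT hy1 hC0 hk r
    have h2 : C * δ ^ (y - 1) ≤ C * r ^ (y - 1) := mul_le_mul_of_nonneg_left
      (Real.rpow_le_rpow_of_nonpos hr.1 h.le (by linarith)) hC0
    have h3 := abs_sub (k r) (truncatedKernel k δ T r)
    have h4 := hk r hr
    linarith
  · rw [truncatedKernel_of_le k hδ h hr.2, sub_self, abs_zero,
      indicator_of_notMem (show r ∉ Iio δ from not_lt.2 h)]

variable {x y T : ℝ} {G k : ℝ → ℝ}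

lemma continuousOn_halfLineConv_truncatedKernel {δ C : ℝ} (hG : PowBound x T G) (hx : 0 < x)
    (hδ : 0 < δ) (hδT : δ ≤ T) (hy1 : y ≤ 1) (hC0 : 0 ≤ C)
    (hkc : ContinuousOn k (Ioc 0 T)) (hk : ∀ r ∈ Ioc 0 T, |k r| ≤ C * r ^ (y - 1)) :
    ContinuousOn (halfLineConv G (truncatedKernel k δ T)) (Ioc 0 T) := by
  have hb : BddAbove (range fun r => ‖truncatedKernel k δ T r‖) := by
    refine ⟨C * δ ^ (y - 1), ?_⟩
    rintro _ ⟨r, rfl⟩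
    exact abs_truncatedKernel_le hδ hδT hy1 hC0 hk r
  have h := hb.continuous_convolution_right_of_integrable (ContinuousLinearMap.mul ℝ ℝ)
    (hG.integrable_indicator hx) (continuous_truncatedKernel hδ hδT hkc)
  refine h.continuousOn.congr fun t ht => ?_
  rw [convolution, halfLineConv, intervalIntegral.integral_of_le ht.1.le,
    ← integral_indicator measurableSet_Ioc]
  congr 1; ext s
  simp only [ContinuousLinearMap.mul_apply']
  by_cases hs : s ∈ Ioc 0 t
  · rw [indicator_of_mem hs, indicator_of_mem (show s ∈ Ioc 0 T from ⟨hs.1, hs.2.trans ht.2⟩)]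
  · rw [indicator_of_notMem hs]
    rcases le_or_gt s 0 with h | h
    · rw [indicator_of_notMem (fun h' => absurd h'.1 (not_lt.2 h)), zero_mul]
    · have : t - s ≤ 0 := by
        by_contra h'
        exact hs ⟨h, by linarith⟩
      rw [truncatedKernel_of_nonpos k this, mul_zero]

/-- The two kernels differ only where t - s < δ. As t ≥ a ≥ 2δ, such s lie in (a/2, T], where G is
bounded by B, so the error is at most B times the integral of 2C r^{y-1} over (0, δ). -/
lemma abs_halfLineConv_sub_truncatedKernel_le {δ a B C : ℝ} (hG : PowBound x T G) (hx : 0 < x)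
    (hy : 0 < y) (hy1 : y ≤ 1) (hB0 : 0 ≤ B) (hC0 : 0 ≤ C) (hδ : 0 < δ) (hδa : 2 * δ ≤ a)
    (hB : ∀ᵐ s ∂(volume.restrict (Ioc (a / 2) T)), |G s| ≤ B)
    (hkc : ContinuousOn k (Ioc 0 T)) (hk : ∀ r ∈ Ioc 0 T, |k r| ≤ C * r ^ (y - 1))
    {t : ℝ} (ht : t ∈ Icc a T) :
    |halfLineConv G k t - halfLineConv G (truncatedKernel k δ T) t|
      ≤ B * (2 * C) * (δ ^ y / y) := by
  have ht0 : 0 < t := by linarith [ht.1]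
  have hδT : δ ≤ T := by linarith [ht.1, ht.2]
  have hkm : AEStronglyMeasurable k (volume.restrict (Ioc 0 T)) :=
    hkc.aestronglyMeasurable measurableSet_Ioc
  have hkP : PowBound y T k := .of_forall hkm hk
  have hτP : PowBound 1 T (truncatedKernel k δ T) :=
    .of_forall (C := C * δ ^ (y - 1)) (continuous_truncatedKernel hδ hδT hkc).aestronglyMeasurable
      fun r _ => by simpa using abs_truncatedKernel_le hδ hδT hy1 hC0 hk r
  rw [← halfLineConv_sub_right hkP (hτP.mono_exponent hy1) hG hy hx ⟨ht0, ht.2⟩]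
  have hint : IntervalIntegrable (fun s => B * (2 * C) * (t - s) ^ (y - 1)) volume (t - δ) t := by
    have := (intervalIntegral.intervalIntegrable_rpow' (a := 0) (b := δ)
      (r := y - 1) (by linarith)).comp_sub_left t
    simp only [sub_zero] at this
    exact this.symm.const_mul _
  have hI : ∫ s in (t - δ)..t, B * (2 * C) * (t - s) ^ (y - 1) = B * (2 * C) * (δ ^ y / y) := by
    rw [intervalIntegral.integral_const_mul, intervalIntegral.integral_comp_sub_left
      (fun r => r ^ (y - 1)) t, integral_rpow (Or.inl (by linarith))]
    simp [hy.ne']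
  rw [← hI, halfLineConv]
  have hbd : ∀ᵐ s ∂(volume.restrict (Ioc 0 t)),
      ‖G s * (k (t - s) - truncatedKernel k δ T (t - s))‖ ≤
        indicator (Ioc (t - δ) t) (fun s => B * (2 * C) * (t - s) ^ (y - 1)) s := by
    rw [← restrict_Ioo_eq_restrict_Ioc, ae_restrict_iff' measurableSet_Ioo]
    rw [ae_restrict_iff' measurableSet_Ioc] at hB
    filter_upwards [hB] with s hs hst
    have h1 := abs_truncatedKernel_sub_le hδ hδT hy1 hC0 hk (r := t - s)
      ⟨by linarith [hst.2], by linarith [hst.1, ht.2]⟩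
    rw [norm_mul, Real.norm_eq_abs, Real.norm_eq_abs]
    by_cases h2 : t - s < δ
    · rw [indicator_of_mem (show t - s ∈ Iio δ from h2)] at h1
      rw [indicator_of_mem (show s ∈ Ioc (t - δ) t from ⟨by linarith, hst.2.le⟩), mul_assoc]
      exact mul_le_mul (hs ⟨by linarith [ht.1], hst.2.le.trans ht.2⟩) h1 (abs_nonneg _) hB0
    · rw [indicator_of_notMem (show t - s ∉ Iio δ from h2)] at h1
      rw [le_antisymm h1 (abs_nonneg _), mul_zero]
      refine indicator_nonneg (fun s hs => ?_) _
      have : 0 ≤ t - s := by linarith [hs.2]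
      positivity
  rw [intervalIntegrable_iff_integrableOn_Ioc_of_le (by linarith)] at hint
  rw [intervalIntegral.integral_of_le ht0.le, intervalIntegral.integral_of_le (by linarith),
    ← Real.norm_eq_abs]
  have hsub : Ioc (t - δ) t ⊆ Ioc 0 t := Ioc_subset_Ioc_left (by linarith [ht.1])
  refine (norm_integral_le_of_norm_le ?_ hbd).trans ?_
  · exact ((integrable_indicator_iff measurableSet_Ioc).2 hint).restrict
  · rw [setIntegral_indicator measurableSet_Ioc, inter_eq_self_of_subset_right hsub]

/-- The singularities of G and k sit at opposite ends of [0, t]. On [a, T] they are separated, and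
convolutions with bounded continuous truncations of k converge uniformly as δ → 0. -/
theorem continuousOn_halfLineConv {C : ℝ} (hG : PowBound x T G) (hx : 0 < x)
    (hy : 0 < y) (hy1 : y ≤ 1) (hkc : ContinuousOn k (Ioc 0 T))
    (hk : ∀ r ∈ Ioc 0 T, |k r| ≤ C * r ^ (y - 1)) :
    ContinuousOn (halfLineConv G k) (Ioc 0 T) := by
  wlog hC0 : 0 ≤ C
  · exact this hG hx hy hy1 hkc (C := |C|) (fun r hr => (hk r hr).trans
      (mul_le_mul_of_nonneg_right (le_abs_self _) (Real.rpow_nonneg hr.1.le _))) (abs_nonneg _)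
  have main : ∀ a ∈ Ioc 0 T, ContinuousOn (halfLineConv G k) (Icc a T) := by
    intro a ha
    obtain ⟨A, hA0, hA⟩ := hG.exists_nonneg
    obtain ⟨B, hB0, hB⟩ : ∃ B, 0 ≤ B ∧ ∀ᵐ s ∂(volume.restrict (Ioc (a / 2) T)), |G s| ≤ B := by
      refine ⟨A * ((a / 2) ^ (x - 1) + T ^ (x - 1)),
        mul_nonneg hA0 (add_nonneg (Real.rpow_nonneg (by linarith [ha.1]) _)
          (Real.rpow_nonneg (ha.1.le.trans ha.2) _)), ?_⟩
      rw [ae_restrict_iff' measurableSet_Ioc] at hA ⊢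
      filter_upwards [hA] with s hs hsa
      have ha2 : 0 < a / 2 := by linarith [ha.1]
      have hs0 : 0 < s := ha2.trans hsa.1
      refine (hs ⟨hs0, hsa.2⟩).trans (mul_le_mul_of_nonneg_left ?_ hA0)
      rcases le_total x 1 with h | h
      · exact (Real.rpow_le_rpow_of_nonpos ha2 hsa.1.le (by linarith)).trans
          (le_add_of_nonneg_right (Real.rpow_nonneg (ha.1.le.trans ha.2) _))
      · exact (Real.rpow_le_rpow hs0.le hsa.2 (by linarith)).trans
          (le_add_of_nonneg_left (Real.rpow_nonneg ha2.le _))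
    refine continuousOn_of_uniform_approx_of_continuousOn fun u hu => ?_
    obtain ⟨ε, hε, hεu⟩ := Metric.mem_uniformity_dist.1 hu
    have hlim : Tendsto (fun δ : ℝ => B * (2 * C) * (δ ^ y / y)) (𝓝[>] 0) (𝓝 0) := by
      have h1 : Tendsto (fun δ : ℝ => δ ^ y) (𝓝[>] 0) (𝓝 ((0 : ℝ) ^ y)) :=
        ((Real.continuousAt_rpow_const 0 y (Or.inr hy.le)).tendsto).mono_left nhdsWithin_le_nhds
      have h2 := (h1.div_const y).const_mul (B * (2 * C))
      rwa [Real.zero_rpow hy.ne', zero_div, mul_zero] at h2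
    obtain ⟨δ, ⟨hδ1, hδ2⟩, hδ0⟩ := ((hlim.eventually (gt_mem_nhds hε)).and
      ((eventually_lt_nhds (show 0 < a / 2 by linarith [ha.1])).filter_mono
        nhdsWithin_le_nhds) |>.and self_mem_nhdsWithin).exists
    have hδ0 : 0 < δ := hδ0
    refine ⟨halfLineConv G (truncatedKernel k δ T),
      (continuousOn_halfLineConv_truncatedKernel hG hx hδ0 (by linarith [ha.1, ha.2]) hy1 hC0 hkc
        hk).mono (Icc_subset_Ioc ha.1 le_rfl), fun t ht => hεu ?_⟩
    rw [Real.dist_eq]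
    exact (abs_halfLineConv_sub_truncatedKernel_le hG hx hy hy1 hB0 hC0 hδ0 (by linarith) hB hkc hk
      ht).trans_lt hδ1
  intro t ht
  refine (main (t / 2) ⟨by linarith [ht.1], by linarith [ht.1, ht.2]⟩ t
    ⟨by linarith [ht.1], ht.2⟩).mono_of_mem_nhdsWithin ?_
  filter_upwards [self_mem_nhdsWithin, mem_nhdsWithin_of_mem_nhds
    (lt_mem_nhds (show t / 2 < t by linarith [ht.1]))] with s hs hs2
  exact ⟨hs2.le, hs.2⟩

end ContinuityOfConvolution

section MittagLeffler
open Filter Topology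

/-! ### The Mittag-Leffler density -/

/-- The fractional integration kernel `t^{α-1} / Γ(α)`. -/
noncomputable def fracKernel (α t : ℝ) : ℝ := t ^ (α - 1) / Real.Gamma α

/-- Log-convexity of Γ at s + 1 = α(s+α) + (1-α)(s+α+1). It controls Γ(s)/Γ(s+α), the ratio of
consecutive coefficients of the Mittag-Leffler series. -/
lemma mul_gamma_le_gamma_add_mul_rpow {α s : ℝ} (hα : 0 < α) (hα1 : α < 1) (hs : 0 < s) :
    s * Real.Gamma s ≤ Real.Gamma (s + α) * (s + α) ^ (1 - α) := by
  have h := Real.Gamma_mul_add_mul_le_rpow_Gamma_mul_rpow_Gamma (s := s + α) (t := s + α + 1)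
    (a := α) (b := 1 - α) (by linarith) (by linarith) hα (by linarith) (by ring)
  have hpos : 0 < Real.Gamma (s + α) := Real.Gamma_pos_of_pos (by linarith)
  rw [show α * (s + α) + (1 - α) * (s + α + 1) = s + 1 by ring, Real.Gamma_add_one hs.ne',
    Real.Gamma_add_one (by linarith : s + α ≠ 0), Real.mul_rpow (by linarith) hpos.le,
    mul_comm (_ ^ (1 - α)), ← mul_assoc, ← Real.rpow_add hpos, add_sub_cancel,
    Real.rpow_one] at h
  exact h

lemma summable_mittagLeffler {α : ℝ} (hα : 0 < α) (hα1 : α < 1) (z : ℝ) :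
    Summable fun n : ℕ => z ^ n / Real.Gamma (α * n + α) := by
  have hlim : Tendsto (fun n : ℕ => |z| * (2 * (α * n + α + α) ^ (-α))) atTop (𝓝 0) := by
    have h1 : Tendsto (fun n : ℕ => α * (n : ℝ) + α + α) atTop atTop := by
      refine tendsto_atTop_add_const_right _ _ (tendsto_atTop_add_const_right _ _ ?_)
      exact tendsto_natCast_atTop_atTop.const_mul_atTop hα
    have h2 := (tendsto_rpow_neg_atTop hα).comp h1
    simpa using (h2.const_mul 2).const_mul |z|
  refine summable_of_ratio_norm_eventually_le (r := 1 / 2) (by norm_num) ?_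
  filter_upwards [hlim.eventually (gt_mem_nhds (show (0 : ℝ) < 1 / 2 by norm_num))] with n hn
  set s := α * n + α with hs
  have hsα : α ≤ s := by rw [hs]; nlinarith [(Nat.cast_nonneg n : (0 : ℝ) ≤ n)]
  have hs0 : 0 < s := by linarith
  have hΓ : 0 < Real.Gamma s := Real.Gamma_pos_of_pos hs0
  have hΓ' : 0 < Real.Gamma (s + α) := Real.Gamma_pos_of_pos (by linarith)
  -- The factor 2 comes from s + α ≤ 2s, valid because s = αn + α ≥ α.
  have h3 : 1 / Real.Gamma (s + α) ≤ 2 * (s + α) ^ (-α) * (1 / Real.Gamma s) := by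
    have h4 := mul_gamma_le_gamma_add_mul_rpow hα hα1 hs0
    rw [sub_eq_add_neg, Real.rpow_add (by linarith), Real.rpow_one] at h4
    have h5 : 0 < (s + α) ^ (-α) := Real.rpow_pos_of_pos (by linarith) _
    rw [mul_one_div, div_le_div_iff₀ hΓ' hΓ, one_mul]
    have h6 : s * Real.Gamma s ≤ s * (2 * (s + α) ^ (-α) * Real.Gamma (s + α)) := by
      refine h4.trans ?_
      rw [show Real.Gamma (s + α) * ((s + α) * (s + α) ^ (-α))
        = (s + α) * ((s + α) ^ (-α) * Real.Gamma (s + α)) by ring,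
        show s * (2 * (s + α) ^ (-α) * Real.Gamma (s + α))
        = (2 * s) * ((s + α) ^ (-α) * Real.Gamma (s + α)) by ring]
      exact mul_le_mul_of_nonneg_right (by linarith) (by positivity)
    exact le_of_mul_le_mul_left h6 hs0
  have hs1 : α * ((n + 1 : ℕ) : ℝ) + α = s + α := by push_cast; ring
  rw [norm_div, norm_div, norm_pow, norm_pow, hs1, Real.norm_eq_abs, Real.norm_eq_abs,
    Real.norm_eq_abs, abs_of_pos hΓ, abs_of_pos hΓ']
  calc |z| ^ (n + 1) / Real.Gamma (s + α)
      = (|z| ^ n * |z|) * (1 / Real.Gamma (s + α)) := by rw [pow_succ, mul_one_div]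
    _ ≤ (|z| ^ n * |z|) * (2 * (s + α) ^ (-α) * (1 / Real.Gamma s)) :=
        mul_le_mul_of_nonneg_left h3 (by positivity)
    _ = (|z| * (2 * (s + α) ^ (-α))) * (|z| ^ n / Real.Gamma s) := by ring
    _ ≤ 1 / 2 * (|z| ^ n / Real.Gamma s) := mul_le_mul_of_nonneg_right hn.le (by positivity)

lemma gamma_mul_add_pos {α : ℝ} (hα : 0 < α) (n : ℕ) : 0 < Real.Gamma (α * n + α) :=
  Real.Gamma_pos_of_pos (by positivity)

lemma norm_mittagLeffler_term_le {α z R : ℝ} (hα : 0 < α) (hz : |z| ≤ R) (n : ℕ) :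
    ‖z ^ n / Real.Gamma (α * n + α)‖ ≤ R ^ n / Real.Gamma (α * n + α) := by
  rw [norm_div, norm_pow, Real.norm_eq_abs, Real.norm_eq_abs, abs_of_pos (gamma_mul_add_pos hα n)]
  exact div_le_div_of_nonneg_right (pow_le_pow_left₀ (abs_nonneg _) hz n)
    (gamma_mul_add_pos hα n).le

lemma abs_mittagLeffler_le {α z R : ℝ} (hα : 0 < α) (hα1 : α < 1) (hz : |z| ≤ R) :
    |mittagLeffler α α z| ≤ mittagLeffler α α R :=
  tsum_of_norm_bounded (summable_mittagLeffler hα hα1 R).hasSum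
    (norm_mittagLeffler_term_le hα hz)

lemma continuous_mittagLeffler {α : ℝ} (hα : 0 < α) (hα1 : α < 1) :
    Continuous (mittagLeffler α α) := by
  refine continuous_iff_continuousAt.2 fun z => ?_
  have h : ContinuousOn (mittagLeffler α α) (Metric.closedBall 0 (|z| + 1)) := by
    refine continuousOn_tsum (fun n => by fun_prop) (summable_mittagLeffler hα hα1 (|z| + 1))
      fun n w hw => norm_mittagLeffler_term_le hα ?_ n
    simpa using hw
  refine h.continuousAt (Metric.closedBall_mem_nhds_of_mem ?_)
  simp

variable {α γ : ℝ}

lemma continuousOn_mittagLefflerDensity (hα : 0 < α) (hα1 : α < 1) :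
    ContinuousOn (mittagLefflerDensity α γ) (Ioi 0) := by
  unfold mittagLefflerDensity
  have h1 : ∀ p : ℝ, ContinuousOn (fun t : ℝ => t ^ p) (Ioi 0) := fun p =>
    continuousOn_id.rpow_const fun t ht => Or.inl (ne_of_gt ht)
  exact ((h1 _).const_mul γ |>.mul ((continuous_mittagLeffler hα hα1).comp_continuousOn
    (((h1 α).const_mul γ).neg)))

lemma abs_mittagLefflerDensity_le (hα : 0 < α) (hα1 : α < 1) (hγ : 0 < γ) {t T : ℝ}
    (ht : t ∈ Ioc 0 T) :
    |mittagLefflerDensity α γ t| ≤ γ * mittagLeffler α α (γ * T ^ α) * t ^ (α - 1) := by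
  rw [mittagLefflerDensity, abs_mul, abs_mul, abs_of_pos hγ,
    abs_of_pos (Real.rpow_pos_of_pos ht.1 _), mul_right_comm]
  refine mul_le_mul_of_nonneg_right (mul_le_mul_of_nonneg_left ?_ hγ.le)
    (Real.rpow_nonneg ht.1.le _)
  refine abs_mittagLeffler_le hα hα1 ?_
  rw [abs_neg, abs_of_nonneg (mul_nonneg hγ.le (Real.rpow_nonneg ht.1.le _))]
  exact mul_le_mul_of_nonneg_left (Real.rpow_le_rpow ht.1.le ht.2 hα.le) hγ.le

lemma powBound_mittagLefflerDensity (hα : 0 < α) (hα1 : α < 1) (hγ : 0 < γ) (T : ℝ) :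
    PowBound α T (mittagLefflerDensity α γ) :=
  .of_forall (((continuousOn_mittagLefflerDensity hα hα1).mono Ioc_subset_Ioi_self
    ).aestronglyMeasurable measurableSet_Ioc) fun _ ht =>
      abs_mittagLefflerDensity_le hα hα1 hγ ht

lemma powBound_fracKernel (α T : ℝ) : PowBound α T (fracKernel α) := by
  refine ((PowBound.rpow α T).const_mul (Real.Gamma α)⁻¹).congr fun s _ => ?_
  rw [fracKernel, div_eq_inv_mul]

lemma halfLineConv_rpow_fracKernel {a : ℝ} (hα : 0 < α) (ha : 0 < a) {t : ℝ} (ht : 0 < t) :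
    halfLineConv (fun s => s ^ (a - 1)) (fracKernel α) t
      = t ^ (a + α - 1) * (Real.Gamma a / Real.Gamma (a + α)) := by
  have h := integral_rpow_mul_sub_rpow ha hα ht
  have hΓ := (Real.Gamma_pos_of_pos hα).ne'
  simp only [halfLineConv, fracKernel, mul_div_assoc', intervalIntegral.integral_div, h,
    ProbabilityTheory.beta]
  field_simp

lemma hasSum_mittagLefflerDensity (hα : 0 < α) (hα1 : α < 1) {t : ℝ} (ht : 0 < t) :
    HasSum (fun n : ℕ => γ * (-γ) ^ n / Real.Gamma (α * n + α) * t ^ (α * n + α - 1))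
      (mittagLefflerDensity α γ t) := by
  have h := (summable_mittagLeffler hα hα1 (-(γ * t ^ α))).hasSum.mul_left (γ * t ^ (α - 1))
  refine h.congr_fun fun n => ?_
  rw [show α * n + α - 1 = (α - 1) + α * n by ring, Real.rpow_add ht, Real.rpow_mul ht.le,
    Real.rpow_natCast, ← neg_mul, mul_pow]
  ring

/-- Convolving the nth term of the series with K and multiplying by -γ gives the (n+1)st term, so -γ
f * K is the series of f without its zeroth term, which is γK. -/
theorem mittagLefflerDensity_add_conv_fracKernel (hα : 0 < α) (hα1 : α < 1) (hγ : 0 < γ) {t : ℝ}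
    (ht : 0 < t) :
    mittagLefflerDensity α γ t + γ * halfLineConv (mittagLefflerDensity α γ) (fracKernel α) t
      = γ * fracKernel α t := by
  have hs : HasSum (fun n : ℕ => ∫ s in (0 : ℝ)..t,
      γ * (-γ) ^ n / Real.Gamma (α * n + α) * s ^ (α * n + α - 1) * fracKernel α (t - s))
      (halfLineConv (mittagLefflerDensity α γ) (fracKernel α) t) := by
    refine intervalIntegral.hasSum_integral_of_dominated_convergence
      -- The dominating terms replace s^α by t^α inside the series and keep the singular factor
      -- s^{α-1} outside, so their sum is a constant times an integrable function.
      (fun n s => (γ * t ^ α) ^ n / Real.Gamma (α * n + α)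
        * (γ * (s ^ (α - 1) * |fracKernel α (t - s)|))) ?_ ?_ ?_ ?_ ?_
    · intro n
      simp only [fracKernel]
      fun_prop
    · intro n
      refine .of_forall fun s hs => ?_
      rw [uIoc_of_le ht.le] at hs
      rw [norm_mul, Real.norm_eq_abs, Real.norm_eq_abs, ← mul_assoc γ,
        ← mul_assoc (_ / _)]
      refine mul_le_mul_of_nonneg_right ?_ (abs_nonneg _)
      rw [abs_mul, abs_div, abs_mul, abs_pow, abs_neg, abs_of_pos hγ,
        abs_of_pos (gamma_mul_add_pos hα n), abs_of_nonneg (Real.rpow_nonneg hs.1.le _),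
        show α * n + α - 1 = (α - 1) + α * n by ring, Real.rpow_add hs.1, Real.rpow_mul hs.1.le,
        Real.rpow_natCast, mul_pow]
      have hp : (s ^ α) ^ n ≤ (t ^ α) ^ n :=
        pow_le_pow_left₀ (Real.rpow_nonneg hs.1.le _) (Real.rpow_le_rpow hs.1.le hs.2 hα.le) n
      have h0 : 0 ≤ γ * γ ^ n / Real.Gamma (α * n + α) * s ^ (α - 1) :=
        mul_nonneg (div_nonneg (by positivity) (gamma_mul_add_pos hα n).le)
          (Real.rpow_nonneg hs.1.le _)
      calc _ = γ * γ ^ n / Real.Gamma (α * n + α) * s ^ (α - 1) * (s ^ α) ^ n := by ring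
        _ ≤ γ * γ ^ n / Real.Gamma (α * n + α) * s ^ (α - 1) * (t ^ α) ^ n :=
          mul_le_mul_of_nonneg_left hp h0
        _ = _ := by ring
    · exact .of_forall fun s _ => (summable_mittagLeffler hα hα1 _).mul_right _
    · simp only [tsum_mul_right]
      exact (((PowBound.rpow α t).intervalIntegrable_conv (powBound_fracKernel α t).abs hα hα
        ⟨ht, le_rfl⟩).const_mul γ).const_mul _
    · refine .of_forall fun s hs => ?_
      rw [uIoc_of_le ht.le] at hs
      exact (hasSum_mittagLefflerDensity hα hα1 hs.1).mul_right _
  have hterm : ∀ n : ℕ, ∫ s in (0 : ℝ)..t,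
      γ * (-γ) ^ n / Real.Gamma (α * n + α) * s ^ (α * n + α - 1) * fracKernel α (t - s)
      = γ * (-γ) ^ n / Real.Gamma (α * (n + 1 : ℕ) + α) * t ^ (α * (n + 1 : ℕ) + α - 1) := by
    intro n
    have h := halfLineConv_rpow_fracKernel (a := α * n + α) hα (by positivity) ht
    rw [halfLineConv] at h
    simp only [mul_assoc, intervalIntegral.integral_const_mul] at h ⊢
    rw [h]
    have := (gamma_mul_add_pos hα n).ne'
    push_cast
    rw [show α * (n + 1 : ℝ) + α = α * n + α + α by ring]
    field_simp
  simp only [hterm] at hs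
  have h1 := hasSum_mittagLefflerDensity (γ := γ) hα hα1 ht
  have h2 := (hasSum_nat_add_iff' 1).2 h1
  have h3 := h2.unique ((hs.mul_left (-γ)).congr_fun fun n => by ring)
  simp only [Finset.range_one, Finset.sum_singleton, pow_zero, Nat.cast_zero, mul_zero, zero_add,
    mul_one] at h3
  rw [fracKernel]
  have h4 : γ * (t ^ (α - 1) / Real.Gamma α) = γ / Real.Gamma α * t ^ (α - 1) := by ring
  linarith

end MittagLeffler

section MaximumPrinciple
open Filter Topology

/-! ### A maximum principle for fractional integral equations -/

/-- The density `-L_K'(y) = α y^{-α-1} / (γ Γ(1-α))`. -/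
noncomputable def levyDensity (α γ y : ℝ) : ℝ :=
  α * y ^ (-α - 1) / (γ * Real.Gamma (1 - α))

/-- The function `L_K(y) = y^{-α} / (γ Γ(1-α))`. -/
noncomputable def levyTail (α γ y : ℝ) : ℝ := y ^ (-α) / (γ * Real.Gamma (1 - α))

/-- The density `-L_K'` cut off below `ε`. -/
noncomputable def cutLevyDensity (α γ ε : ℝ) : ℝ → ℝ := indicator (Ici ε) (levyDensity α γ)

/-- The kernel `γ (L_K(ε) K - K * q)` with `q` the density `-L_K'` cut off below `ε`. -/
noncomputable def approxIdentity (α γ ε t : ℝ) : ℝ :=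
  γ * (levyTail α γ ε * fracKernel α t
    - halfLineConv (fracKernel α) (cutLevyDensity α γ ε) t)

variable {α γ ε : ℝ}

lemma levyDensity_nonneg (hα : 0 < α) (hα1 : α < 1) (hγ : 0 < γ) {y : ℝ} (hy : 0 ≤ y) :
    0 ≤ levyDensity α γ y :=
  div_nonneg (mul_nonneg hα.le (Real.rpow_nonneg hy _))
    (mul_pos hγ (Real.Gamma_pos_of_pos (by linarith))).le

lemma cutLevyDensity_nonneg (hα : 0 < α) (hα1 : α < 1) (hγ : 0 < γ) (hε : 0 < ε) (y : ℝ) :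
    0 ≤ cutLevyDensity α γ ε y :=
  indicator_nonneg (fun _ hy => levyDensity_nonneg hα hα1 hγ (hε.le.trans hy)) _

lemma fracKernel_nonneg (hα : 0 < α) {t : ℝ} (ht : 0 ≤ t) : 0 ≤ fracKernel α t :=
  div_nonneg (Real.rpow_nonneg ht _) (Real.Gamma_pos_of_pos hα).le

lemma powBound_cutLevyDensity (hα : 0 < α) (hα1 : α < 1) (hγ : 0 < γ) (hε : 0 < ε) (T : ℝ) :
    PowBound 1 T (cutLevyDensity α γ ε) := by
  refine .of_forall (C := levyDensity α γ ε) ?_ fun s hs => ?_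
  · have : Measurable (levyDensity α γ) := by unfold levyDensity; fun_prop
    exact (this.indicator measurableSet_Ici).aestronglyMeasurable
  · rw [sub_self, Real.rpow_zero, mul_one, abs_of_nonneg (cutLevyDensity_nonneg hα hα1 hγ hε s)]
    refine indicator_le' (fun y hy => ?_) (fun _ _ => levyDensity_nonneg hα hα1 hγ hε.le) s
    have h1 := Real.rpow_le_rpow_of_nonpos hε hy (show -α - 1 ≤ 0 by linarith)
    exact div_le_div_of_nonneg_right (mul_le_mul_of_nonneg_left h1 hα.le)
      (mul_pos hγ (Real.Gamma_pos_of_pos (by linarith))).le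

lemma halfLineConv_cutLevyDensity_of_le (F : ℝ → ℝ) {t : ℝ} (ht : 0 ≤ t) (htε : t ≤ ε) :
    halfLineConv F (cutLevyDensity α γ ε) t = 0 := by
  rw [halfLineConv_congr (G' := F) (H' := fun _ => 0) ht (fun _ _ => rfl)]
  · simp [halfLineConv]
  · intro s hs
    exact indicator_of_notMem (fun h => absurd (mem_Ici.1 h) (by linarith [hs.2])) _

lemma halfLineConv_cutLevyDensity_of_gt (F : ℝ → ℝ) {t : ℝ} (hε : 0 < ε) (htε : ε < t) :
    halfLineConv F (cutLevyDensity α γ ε) t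
      = ∫ y in ε..t, levyDensity α γ y * F (t - y) := by
  rw [halfLineConv_comm, halfLineConv, intervalIntegral.integral_of_le (hε.trans htε).le,
    intervalIntegral.integral_of_le htε.le, ← integral_Icc_eq_integral_Ioc,
    ← integral_Icc_eq_integral_Ioc (x := ε),
    ← integral_indicator measurableSet_Icc, ← integral_indicator measurableSet_Icc]
  congr 1; ext y
  simp only [indicator_apply, cutLevyDensity, mem_Icc, mem_Ici]
  by_cases h1 : ε ≤ y
  · simp [h1, hε.le.trans h1]
  · simp [h1]

/-- The integrand has the explicit antiderivative -((t-y)/y)^α / (αt). -/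
lemma integral_rpow_mul_sub_rpow_of_pos (hα : 0 < α) {t : ℝ} (hε : 0 < ε) (htε : ε < t) :
    ∫ y in ε..t, y ^ (-α - 1) * (t - y) ^ (α - 1) = (t - ε) ^ α * ε ^ (-α) / (α * t) := by
  have ht : 0 < t := hε.trans htε
  have h := intervalIntegral.integral_eq_sub_of_hasDerivAt_of_le htε.le
    (f := fun y => -((t - y) ^ α * y ^ (-α) / (α * t)))
    (f' := fun y => y ^ (-α - 1) * (t - y) ^ (α - 1)) ?_ ?_ ?_
  · rw [h]; simp [Real.zero_rpow hα.ne']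
  · refine ContinuousOn.neg (ContinuousOn.div_const (ContinuousOn.mul ?_ ?_) _)
    · exact (continuousOn_const.sub continuousOn_id).rpow_const fun _ _ => Or.inr hα.le
    · exact continuousOn_id.rpow_const fun y hy => Or.inl (hε.trans_le hy.1).ne'
  · intro y hy
    have hy0 : 0 < y := hε.trans hy.1
    have hty : 0 < t - y := by linarith [hy.2]
    have h1 := ((hasDerivAt_id y).const_sub t).rpow_const (p := α) (Or.inl hty.ne')
    have h2 := (hasDerivAt_id y).rpow_const (p := -α) (Or.inl hy0.ne')
    refine ((h1.mul h2).div_const (α * t)).neg.congr_deriv ?_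
    simp only [id]
    rw [show (t - y) ^ α = (t - y) ^ (α - 1) * (t - y) by
        rw [← Real.rpow_add_one hty.ne']; ring_nf,
      show y ^ (-α) = y ^ (-α - 1) * y by rw [← Real.rpow_add_one hy0.ne']; ring_nf]
    field_simp
    ring
  · have h1 : ContinuousOn (fun y : ℝ => y ^ (-α - 1)) (uIcc ε t) := by
      rw [uIcc_of_le htε.le]
      exact continuousOn_id.rpow_const fun y hy => Or.inl (hε.trans_le hy.1).ne'
    refine IntervalIntegrable.continuousOn_mul ?_ h1
    have h3 := (intervalIntegral.intervalIntegrable_rpow' (a := 0) (b := t - ε)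
      (r := α - 1) (by linarith)).comp_sub_left t
    simpa using h3.symm

/-- The constant `1 / (Γ(α) Γ(1-α))`. -/
noncomputable def reflectionConst (α : ℝ) : ℝ := (Real.Gamma α * Real.Gamma (1 - α))⁻¹

lemma reflectionConst_pos (hα : 0 < α) (hα1 : α < 1) : 0 < reflectionConst α :=
  inv_pos.2 (mul_pos (Real.Gamma_pos_of_pos hα) (Real.Gamma_pos_of_pos (by linarith)))

/-- This closed form makes the sign of the kernel and its concentration at 0 as ε → 0 visible. -/
lemma approxIdentity_eq (hα : 0 < α) (hα1 : α < 1) (hγ : 0 < γ) (hε : 0 < ε) {t : ℝ}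
    (ht : 0 < t) :
    approxIdentity α γ ε t
      = reflectionConst α * ε ^ (-α) * (t ^ (α - 1) - (max (t - ε) 0) ^ α / t) := by
  have hΓ := Real.Gamma_pos_of_pos hα
  have hΓ' : 0 < Real.Gamma (1 - α) := Real.Gamma_pos_of_pos (by linarith)
  rcases le_or_gt t ε with h | h
  · rw [approxIdentity, halfLineConv_cutLevyDensity_of_le _ ht.le h,
      max_eq_right (by linarith), Real.zero_rpow hα.ne', levyTail, fracKernel, reflectionConst]
    field_simp
    ring
  · have hI : ∫ y in ε..t, levyDensity α γ y * fracKernel α (t - y)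
        = α / (γ * Real.Gamma (1 - α) * Real.Gamma α)
          * ((t - ε) ^ α * ε ^ (-α) / (α * t)) := by
      rw [← integral_rpow_mul_sub_rpow_of_pos hα hε h, ← intervalIntegral.integral_const_mul]
      congr 1; ext y
      rw [levyDensity, fracKernel]
      field_simp
    rw [approxIdentity, halfLineConv_cutLevyDensity_of_gt _ hε h, hI, max_eq_left (by linarith),
      levyTail, fracKernel, reflectionConst]
    field_simp

lemma approxIdentity_nonneg (hα : 0 < α) (hα1 : α < 1) (hγ : 0 < γ) (hε : 0 < ε) {t : ℝ}
    (ht : 0 < t) : 0 ≤ approxIdentity α γ ε t := by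
  rw [approxIdentity_eq hα hα1 hγ hε ht]
  refine mul_nonneg (mul_nonneg (reflectionConst_pos hα hα1).le (Real.rpow_nonneg hε.le _)) ?_
  rw [sub_nonneg, div_le_iff₀ ht, ← Real.rpow_add_one ht.ne', sub_add_cancel]
  exact Real.rpow_le_rpow (le_max_right _ _) (max_le (by linarith) ht.le) hα.le

/-- Concavity estimate `t^α - ((t - y)⁺)^α ≤ y t^{α-1}`. -/
lemma rpow_sub_max_rpow_le (hα : 0 < α) (hα1 : α < 1) {t y : ℝ} (ht : 0 < t) (hy : 0 ≤ y) :
    t ^ α - (max (t - y) 0) ^ α ≤ min y t * t ^ (α - 1) := by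
  have htα : t ^ α = t * t ^ (α - 1) := by
    rw [mul_comm, ← Real.rpow_add_one ht.ne', sub_add_cancel]
  rcases le_or_gt t y with h | h
  · rw [max_eq_right (by linarith), Real.zero_rpow hα.ne', sub_zero, min_eq_right h, htα]
  · have h0 : 0 < t - y := by linarith
    rw [max_eq_left h0.le, min_eq_left h.le, htα]
    have h1 : (t - y) ^ α = (t - y) * (t - y) ^ (α - 1) := by
      rw [mul_comm, ← Real.rpow_add_one h0.ne', sub_add_cancel]
    have h2 := mul_le_mul_of_nonneg_left (Real.rpow_le_rpow_of_nonpos h0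
      (show t - y ≤ t by linarith) (show α - 1 ≤ 0 by linarith)) h0.le
    rw [h1]
    linarith

lemma approxIdentity_le (hα : 0 < α) (hα1 : α < 1) (hγ : 0 < γ) (hε : 0 < ε) {t : ℝ}
    (ht : 0 < t) :
    approxIdentity α γ ε t ≤ reflectionConst α * ε ^ (1 - α) * t ^ (α - 2) := by
  rw [approxIdentity_eq hα hα1 hγ hε ht, show (1 - α) = -α + 1 by ring,
    Real.rpow_add_one hε.ne', show α - 2 = (α - 1) - 1 by ring,
    Real.rpow_sub_one ht.ne' (α - 1)]
  have h := rpow_sub_max_rpow_le hα hα1 ht hε.le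
  have h2 : min ε t * t ^ (α - 1) ≤ ε * t ^ (α - 1) :=
    mul_le_mul_of_nonneg_right (min_le_left _ _) (Real.rpow_nonneg ht.le _)
  have h3 : t ^ (α - 1) - (max (t - ε) 0) ^ α / t ≤ ε * (t ^ (α - 1) / t) := by
    rw [Real.rpow_sub_one ht.ne', ← sub_div, ← mul_div_assoc]
    rw [Real.rpow_sub_one ht.ne'] at h h2
    exact div_le_div_of_nonneg_right (h.trans h2) ht.le
  calc _ ≤ reflectionConst α * ε ^ (-α) * (ε * (t ^ (α - 1) / t)) :=
        mul_le_mul_of_nonneg_left h3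
          (mul_nonneg (reflectionConst_pos hα hα1).le (Real.rpow_nonneg hε.le _))
    _ = _ := by ring

lemma powBound_approxIdentity (hα : 0 < α) (hα1 : α < 1) (hγ : 0 < γ) (hε : 0 < ε) (T : ℝ) :
    PowBound α T (approxIdentity α γ ε) :=
  ((powBound_fracKernel α T).const_mul _ |>.sub
    (((powBound_fracKernel α T).conv (powBound_cutLevyDensity hα hα1 hγ hε T) hα
      one_pos).mono_exponent (by linarith))).const_mul _

/-- By associativity, convolving G with this kernel amounts to applying the cut-off fractional
derivative u ↦ L_K(ε)u - u * q to γ G * K, so that derivative nearly inverts convolution with γK. -/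
lemma halfLineConv_approxIdentity {x T : ℝ} {G : ℝ → ℝ} (hα : 0 < α) (hα1 : α < 1) (hγ : 0 < γ)
    (hε : 0 < ε) (hx : 0 < x) (hG : PowBound x T G) {t : ℝ} (ht : t ∈ Ioc 0 T) :
    halfLineConv G (approxIdentity α γ ε) t
      = γ * (levyTail α γ ε * halfLineConv G (fracKernel α) t
        - halfLineConv (halfLineConv G (fracKernel α)) (cutLevyDensity α γ ε) t) := by
  have hK := powBound_fracKernel α T
  have hq := powBound_cutLevyDensity hα hα1 hγ hε T
  unfold approxIdentity
  rw [halfLineConv_const_mul_right, halfLineConv_sub_right (hK.const_mul _)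
    ((hK.conv hq hα one_pos).mono_exponent (by linarith)) hG hα hx ht,
    halfLineConv_const_mul_right, halfLineConv_assoc hG hK hq hx hα one_pos ht]

/-- For t > ε there is equality, since -L_K' integrates over (ε, t) to L_K(ε) - L_K(t). For t ≤ ε it
is the monotonicity of L_K. -/
lemma levyTail_sub_conv_one_le (hα : 0 < α) (hα1 : α < 1) (hγ : 0 < γ) (hε : 0 < ε) {t : ℝ}
    (ht : 0 < t) :
    levyTail α γ ε - halfLineConv (fun _ => 1) (cutLevyDensity α γ ε) t ≤ levyTail α γ t := by
  have hΓ' : 0 < Real.Gamma (1 - α) := Real.Gamma_pos_of_pos (by linarith)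
  rcases le_or_gt t ε with h | h
  · rw [halfLineConv_cutLevyDensity_of_le _ ht.le h, sub_zero]
    exact div_le_div_of_nonneg_right (Real.rpow_le_rpow_of_nonpos ht h (by linarith))
      (mul_pos hγ hΓ').le
  · rw [halfLineConv_cutLevyDensity_of_gt _ hε h]
    have hI : ∫ y in ε..t, levyDensity α γ y * 1 = levyTail α γ ε - levyTail α γ t := by
      simp only [levyDensity, levyTail, mul_one, intervalIntegral.integral_div,
        intervalIntegral.integral_const_mul]
      rw [integral_rpow (Or.inr ⟨by linarith, fun h0 => ?_⟩)]
      · rw [sub_add_cancel]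
        field_simp
        ring
      · rw [uIcc_of_le h.le] at h0
        exact absurd h0.1 (not_le.2 hε)
    rw [hI]
    linarith

/-- K and L_K are complementary: the exponents -α and α - 1 convolve to a constant. -/
lemma halfLineConv_levyTail_fracKernel (hα : 0 < α) (hα1 : α < 1) (hγ : 0 < γ) {t : ℝ}
    (ht : 0 < t) : halfLineConv (levyTail α γ) (fracKernel α) t = γ⁻¹ := by
  have hΓ' : 0 < Real.Gamma (1 - α) := Real.Gamma_pos_of_pos (by linarith)
  have h := halfLineConv_rpow_fracKernel (a := 1 - α) hα (by linarith) ht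
  have h2 : levyTail α γ = fun s => (γ * Real.Gamma (1 - α))⁻¹ * s ^ (1 - α - 1) := by
    ext s
    rw [levyTail, div_eq_inv_mul]
    ring_nf
  rw [h2, halfLineConv_const_mul_left, h]
  simp only [sub_add_cancel, sub_self, Real.rpow_zero, Real.Gamma_one]
  field_simp

/-- The mass on (0, t) is γ times the convolution of K with L_K(ε) - 1 * q. The latter is at most
L_K, and γ L_K * K = 1. -/
lemma halfLineConv_one_approxIdentity_le (hα : 0 < α) (hα1 : α < 1) (hγ : 0 < γ) (hε : 0 < ε)
    {t : ℝ} (ht : 0 < t) : halfLineConv (fun _ => 1) (approxIdentity α γ ε) t ≤ 1 := by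
  have htT : t ∈ Ioc 0 t := ⟨ht, le_rfl⟩
  have hK := powBound_fracKernel α t
  have hq := powBound_cutLevyDensity hα hα1 hγ hε t
  have h1 : PowBound 1 t (fun _ => (1 : ℝ)) :=
    .of_forall (C := 1) aestronglyMeasurable_const fun s _ => by simp
  have hcomm : halfLineConv (fun _ => (1 : ℝ)) (fracKernel α)
      = halfLineConv (fracKernel α) (fun _ => 1) := funext (halfLineConv_comm _ _)
  have hL : PowBound (1 - α) t (levyTail α γ) := by
    refine ((PowBound.rpow (1 - α) t).const_mul (γ * Real.Gamma (1 - α))⁻¹).congr fun s _ => ?_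
    rw [levyTail, div_eq_inv_mul]
    ring_nf
  have h1q := ((h1.conv hq one_pos one_pos).mono_exponent (y := 1) (by norm_num))
  have hd : PowBound (1 - α) t
      (fun s => levyTail α γ ε * 1 - halfLineConv (fun _ => 1) (cutLevyDensity α γ ε) s) :=
    ((h1.const_mul _).sub h1q).mono_exponent (by linarith)
  have hle : halfLineConv
      (fun s => levyTail α γ ε * 1 - halfLineConv (fun _ => 1) (cutLevyDensity α γ ε) s)
      (fracKernel α) t ≤ halfLineConv (levyTail α γ) (fracKernel α) t := by
    refine intervalIntegral.integral_mono_on_of_le_Ioo ht.le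
      (hd.intervalIntegrable_conv hK (by linarith) hα htT)
      (hL.intervalIntegrable_conv hK (by linarith) hα htT) fun s hs => ?_
    refine mul_le_mul_of_nonneg_right ?_ (fracKernel_nonneg hα (by linarith [hs.2]))
    rw [mul_one]
    exact levyTail_sub_conv_one_le hα hα1 hγ hε hs.1
  rw [halfLineConv_levyTail_fracKernel hα hα1 hγ ht,
    halfLineConv_sub_left (h1.const_mul _) h1q hK one_pos hα htT,
    halfLineConv_const_mul_left, halfLineConv_comm (halfLineConv _ _),
    ← halfLineConv_assoc hK h1 hq hα one_pos one_pos htT, ← hcomm] at hle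
  rw [halfLineConv_approxIdentity hα hα1 hγ hε one_pos h1 htT]
  calc _ ≤ γ * γ⁻¹ := mul_le_mul_of_nonneg_left hle hγ.le
    _ = 1 := mul_inv_cancel₀ hγ.ne'

/-- On (t-δ, t) the bound W ≤ η is used with mass at most 1; before t - δ the kernel is at most a
constant times ε^{1-α} δ^{α-2}. The second part vanishes as ε → 0, so only the behaviour of W just
before t matters. -/
lemma halfLineConv_approxIdentity_le {x t η δ : ℝ} {W : ℝ → ℝ} (hα : 0 < α) (hα1 : α < 1)
    (hγ : 0 < γ) (hε : 0 < ε) (hx : 0 < x) (ht : 0 < t) (hW : PowBound x t W) (hη : 0 ≤ η)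
    (hδ : 0 < δ) (hδW : ∀ s ∈ Ioo (t - δ) t, W s ≤ η) :
    halfLineConv W (approxIdentity α γ ε) t
      ≤ η + reflectionConst α * ε ^ (1 - α) * δ ^ (α - 2) * ∫ s in (0 : ℝ)..t, |W s| := by
  have htT : t ∈ Ioc 0 t := ⟨ht, le_rfl⟩
  have hp := powBound_approxIdentity hα hα1 hγ hε t
  have h1 : PowBound 1 t (fun _ => (1 : ℝ)) :=
    .of_forall (C := 1) aestronglyMeasurable_const fun s _ => by simp
  have i1 := (h1.intervalIntegrable_conv hp one_pos hα htT).const_mul η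
  have i2 : IntervalIntegrable (fun s => |W s|) volume 0 t :=
    (intervalIntegrable_iff_integrableOn_Ioc_of_le ht.le).2 (hW.abs.integrableOn hx)
  have i2' := i2.const_mul (reflectionConst α * ε ^ (1 - α) * δ ^ (α - 2))
  have hc : 0 ≤ reflectionConst α * ε ^ (1 - α) :=
    mul_nonneg (reflectionConst_pos hα hα1).le (Real.rpow_nonneg hε.le _)
  calc halfLineConv W (approxIdentity α γ ε) t
      ≤ ∫ s in (0 : ℝ)..t, (η * (1 * approxIdentity α γ ε (t - s))
          + reflectionConst α * ε ^ (1 - α) * δ ^ (α - 2) * |W s|) := by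
        refine intervalIntegral.integral_mono_on_of_le_Ioo ht.le
          (hW.intervalIntegrable_conv hp hx hα htT) (i1.add i2') fun s hs => ?_
        have hts : 0 < t - s := by linarith [hs.2]
        have hp0 := approxIdentity_nonneg hα hα1 hγ hε hts
        rw [one_mul]
        rcases lt_or_ge (t - δ) s with h | h
        · have := mul_le_mul_of_nonneg_right (hδW s ⟨h, hs.2⟩) hp0
          have h2 : 0 ≤ reflectionConst α * ε ^ (1 - α) * δ ^ (α - 2) * |W s| :=
            mul_nonneg (mul_nonneg hc (Real.rpow_nonneg hδ.le _)) (abs_nonneg _)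
          linarith
        · have h3 := approxIdentity_le hα hα1 hγ hε hts
          have h4 : (t - s) ^ (α - 2) ≤ δ ^ (α - 2) :=
            Real.rpow_le_rpow_of_nonpos hδ (by linarith) (by linarith)
          have h5 := h3.trans (mul_le_mul_of_nonneg_left h4 hc)
          have h6 : W s * approxIdentity α γ ε (t - s) ≤ |W s| * approxIdentity α γ ε (t - s) :=
            mul_le_mul_of_nonneg_right (le_abs_self _) hp0
          have h7 := mul_le_mul_of_nonneg_left h5 (abs_nonneg (W s))
          have h8 := mul_nonneg hη hp0
          linarith
    _ = η * halfLineConv (fun _ => 1) (approxIdentity α γ ε) t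
        + reflectionConst α * ε ^ (1 - α) * δ ^ (α - 2) * ∫ s in (0 : ℝ)..t, |W s| := by
        rw [intervalIntegral.integral_add i1 i2', intervalIntegral.integral_const_mul η,
          intervalIntegral.integral_const_mul (_ * _), halfLineConv]
    _ ≤ _ := by
        have := mul_le_mul_of_nonneg_left
          (halfLineConv_one_approxIdentity_le hα hα1 hγ hε ht) hη
        linarith

lemma halfLineConv_cutLevyDensity_eq {x lam t : ℝ} {u G : ℝ → ℝ} (hα : 0 < α) (hα1 : α < 1)
    (hγ : 0 < γ) (hε : 0 < ε) (hx : 0 < x) (ht : 0 < t) (hG : PowBound x t G)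
    (hu : ∀ s ∈ Ioc 0 t,
      u s = lam * (γ * fracKernel α s) + γ * halfLineConv G (fracKernel α) s) :
    levyTail α γ ε * u t - halfLineConv u (cutLevyDensity α γ ε) t
      = lam * approxIdentity α γ ε t + halfLineConv G (approxIdentity α γ ε) t := by
  have htT : t ∈ Ioc 0 t := ⟨ht, le_rfl⟩
  have hK := powBound_fracKernel α t
  have hq := powBound_cutLevyDensity hα hα1 hγ hε t
  rw [halfLineConv_congr ht.le (fun s hs => hu s ⟨hs.1, hs.2.le⟩) (fun _ _ => rfl),
    halfLineConv_add_left ((hK.const_mul γ).const_mul lam)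
      (((hG.conv hK hx hα).mono_exponent (by linarith)).const_mul γ) hq hα one_pos htT,
    halfLineConv_const_mul_left, halfLineConv_const_mul_left, halfLineConv_const_mul_left,
    halfLineConv_approxIdentity hα hα1 hγ hε hx hG htT, hu t htT, approxIdentity]
  ring

/-- If `u = λ γ K + γ (g - W) * K` with `λ, g ≥ 0` is nonnegative on `(0, t)` and vanishes at `t`,
then `∫ u(t - y) (-L_K'(y)) dy ≤ W(t)`. -/
theorem halfLineConv_cutLevyDensity_le {x lam t : ℝ} {u g W : ℝ → ℝ} (hα : 0 < α)
    (hα1 : α < 1) (hγ : 0 < γ) (hε : 0 < ε) (hx : 0 < x) (ht : 0 < t) (hlam : 0 ≤ lam)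
    (hg : PowBound x t g) (hW : PowBound x t W) (hum : PowBound x t u)
    (hg0 : ∀ᵐ s ∂(volume.restrict (Ioc 0 t)), 0 ≤ g s) (hW0 : 0 ≤ W t)
    (hWc : ContinuousWithinAt W (Iio t) t) (hu0 : ∀ s ∈ Ioo 0 t, 0 ≤ u s) (hut : u t = 0)
    (hu : ∀ s ∈ Ioc 0 t, u s = lam * (γ * fracKernel α s)
      + γ * halfLineConv (fun r => g r - W r) (fracKernel α) s) :
    halfLineConv u (cutLevyDensity α γ ε) t ≤ W t := by
  have htT : t ∈ Ioc 0 t := ⟨ht, le_rfl⟩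
  -- As u(t) = 0, the identity for the cut-off derivative reads u * q = W * p - λp - g * p at t,
  -- with p ≥ 0. Since u ≥ 0, lowering the cut-off to ε' only increases u * q, so ε can stay fixed
  -- while ε' → 0.
  have step : ∀ ε' : ℝ, 0 < ε' → ε' ≤ ε → halfLineConv u (cutLevyDensity α γ ε) t
      ≤ halfLineConv W (approxIdentity α γ ε') t := by
    intro ε' hε' hle
    have hp := powBound_approxIdentity hα hα1 hγ hε' t
    have h1 := halfLineConv_cutLevyDensity_eq hα hα1 hγ hε' hx ht (hg.sub hW) hu
    rw [hut, mul_zero, halfLineConv_sub_left hg hW hp hx hα htT] at h1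
    have h2 : 0 ≤ lam * approxIdentity α γ ε' t :=
      mul_nonneg hlam (approxIdentity_nonneg hα hα1 hγ hε' ht)
    have h3 : 0 ≤ halfLineConv g (approxIdentity α γ ε') t := by
      rw [halfLineConv, intervalIntegral.integral_of_le ht.le, integral_Ioc_eq_integral_Ioo]
      refine integral_nonneg_of_ae ?_
      rw [← restrict_Ioo_eq_restrict_Ioc] at hg0
      filter_upwards [hg0, ae_restrict_mem measurableSet_Ioo] with s hs1 hs2
      exact mul_nonneg hs1 (approxIdentity_nonneg hα hα1 hγ hε' (by linarith [hs2.2]))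
    have h4 : halfLineConv u (cutLevyDensity α γ ε) t
        ≤ halfLineConv u (cutLevyDensity α γ ε') t := by
      refine intervalIntegral.integral_mono_on_of_le_Ioo ht.le
        (hum.intervalIntegrable_conv (powBound_cutLevyDensity hα hα1 hγ hε t) hx one_pos htT)
        (hum.intervalIntegrable_conv (powBound_cutLevyDensity hα hα1 hγ hε' t) hx one_pos htT)
        fun s hs => mul_le_mul_of_nonneg_left ?_ (hu0 s hs)
      by_cases h : t - s ∈ Ici ε
      · rw [cutLevyDensity, cutLevyDensity, indicator_of_mem h,
          indicator_of_mem (Ici_subset_Ici.2 hle h)]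
      · rw [cutLevyDensity, indicator_of_notMem h]
        exact cutLevyDensity_nonneg hα hα1 hγ hε' _
    linarith
  refine le_of_forall_pos_le_add fun η hη => ?_
  obtain ⟨δ, hδ, hδW⟩ : ∃ δ > 0, ∀ s ∈ Ioo (t - δ) t, W s ≤ W t + η := by
    have h := hWc.eventually (gt_mem_nhds (show W t < W t + η by linarith))
    obtain ⟨l, hl, hl'⟩ := (mem_nhdsLT_iff_exists_Ioo_subset).1 h
    refine ⟨t - l, by linarith [mem_Iio.1 hl], fun s hs => ?_⟩
    rw [sub_sub_cancel] at hs
    exact (hl' hs).le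
  have hlim : Tendsto (fun ε' : ℝ => W t + η
      + reflectionConst α * ε' ^ (1 - α) * δ ^ (α - 2) * ∫ s in (0 : ℝ)..t, |W s|)
      (𝓝[>] 0) (𝓝 (W t + η)) := by
    have h1 : Tendsto (fun ε' : ℝ => ε' ^ (1 - α)) (𝓝[>] 0) (𝓝 ((0 : ℝ) ^ (1 - α))) :=
      ((Real.continuousAt_rpow_const 0 _ (Or.inr (by linarith))).tendsto).mono_left
        nhdsWithin_le_nhds
    rw [Real.zero_rpow (by linarith)] at h1
    have h2 := (((h1.const_mul (reflectionConst α)).mul_const (δ ^ (α - 2))).mul_const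
      (∫ s in (0 : ℝ)..t, |W s|)).const_add (W t + η)
    simpa using h2
  refine ge_of_tendsto hlim ?_
  filter_upwards [self_mem_nhdsWithin, (eventually_le_nhds hε).filter_mono nhdsWithin_le_nhds]
    with ε' h1 h2
  exact (step ε' h1 h2).trans
    (halfLineConv_approxIdentity_le hα hα1 hγ h1 hx ht hW (by linarith) hδ hδW)

end MaximumPrinciple

section Positivity
open Filter Topology

/-! ### Positivity of the Mittag-Leffler density -/

/-- It suffices to exclude a first zero: at the infimum of {u ≤ 0} the left limit of positive values
gives u ≥ 0, hence u = 0. -/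
lemma pos_of_forall_ne_zero {u : ℝ → ℝ} {τ : ℝ} (hu : ContinuousOn u (Ioi 0)) (hτ : 0 < τ)
    (h0 : ∀ t ∈ Ioo 0 τ, 0 < u t) (hz : ∀ t, 0 < t → (∀ s ∈ Ioo 0 t, 0 < u s) → u t ≠ 0)
    {t : ℝ} (ht : 0 < t) : 0 < u t := by
  by_contra hneg
  set S : Set ℝ := {s | τ ≤ s ∧ u s ≤ 0} with hS
  have hmem : ∀ s, 0 < s → u s ≤ 0 → s ∈ S := fun s hs hus =>
    ⟨not_lt.1 fun h => absurd (h0 s ⟨hs, h⟩) (not_lt.2 hus), hus⟩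
  have hSne : S.Nonempty := ⟨t, hmem t ht (not_lt.1 hneg)⟩
  have hSb : BddBelow S := ⟨τ, fun s hs => hs.1⟩
  -- The constraint τ ≤ s keeps S inside (0, ∞), where u is continuous; without it closedness could
  -- fail at 0.
  have hSc : IsClosed S := by
    have := (hu.mono fun s (hs : s ∈ Ici τ) => hτ.trans_le hs).preimage_isClosed_of_isClosed
      isClosed_Ici (isClosed_Iic (a := (0 : ℝ)))
    exact this
  have hmin := hSc.csInf_mem hSne hSb
  set t₀ := sInf S
  have ht₀ : 0 < t₀ := hτ.trans_le hmin.1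
  have hlt : ∀ s ∈ Ioo 0 t₀, 0 < u s := fun s hs =>
    not_le.1 fun h => absurd (csInf_le hSb (hmem s hs.1 h)) (not_le.2 hs.2)
  refine hz t₀ ht₀ hlt (le_antisymm hmin.2 ?_)
  have hc : Tendsto u (𝓝[<] t₀) (𝓝 (u t₀)) :=
    ((hu.continuousAt (Ioi_mem_nhds ht₀)).tendsto).mono_left nhdsWithin_le_nhds
  refine ge_of_tendsto hc ?_
  filter_upwards [Ioo_mem_nhdsLT ht₀] with s hs
  exact (hlt s hs).le

lemma exists_pos_near_zero {u : ℝ → ℝ} {α β a C T : ℝ} (hαβ : α < β) (ha : 0 < a) (hT : 0 < T)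
    (hu : ∀ t ∈ Ioc 0 T, a * t ^ (α - 1) - C * t ^ (β - 1) ≤ u t) :
    ∃ τ > 0, ∀ t ∈ Ioo 0 τ, 0 < u t := by
  have hlim : Tendsto (fun t : ℝ => C * t ^ (β - α)) (𝓝[>] 0) (𝓝 0) := by
    have h1 : Tendsto (fun t : ℝ => t ^ (β - α)) (𝓝[>] 0) (𝓝 ((0 : ℝ) ^ (β - α))) :=
      ((Real.continuousAt_rpow_const 0 _ (Or.inr (by linarith))).tendsto).mono_left
        nhdsWithin_le_nhds
    rw [Real.zero_rpow (by linarith)] at h1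
    simpa using h1.const_mul C
  have hev : ∀ᶠ t in 𝓝[>] (0 : ℝ), 0 < u t := by
    filter_upwards [hlim.eventually (gt_mem_nhds ha), Ioc_mem_nhdsGT hT] with t h1 h2
    refine lt_of_lt_of_le ?_ (hu t h2)
    rw [show β - 1 = (β - α) + (α - 1) by ring, Real.rpow_add h2.1, ← mul_assoc, ← sub_mul]
    exact mul_pos (by linarith) (Real.rpow_pos_of_pos h2.1 _)
  obtain ⟨τ, hτ, h⟩ := mem_nhdsGT_iff_exists_Ioo_subset.1 hev
  exact ⟨τ, hτ, fun t ht => h ht⟩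

variable {α γ : ℝ}

lemma levyDensity_pos (hα : 0 < α) (hα1 : α < 1) (hγ : 0 < γ) {y : ℝ} (hy : 0 < y) :
    0 < levyDensity α γ y :=
  div_pos (mul_pos hα (Real.rpow_pos_of_pos hy _))
    (mul_pos hγ (Real.Gamma_pos_of_pos (by linarith)))

lemma halfLineConv_cutLevyDensity_pos {ε x t : ℝ} {u : ℝ → ℝ} (hα : 0 < α) (hα1 : α < 1)
    (hγ : 0 < γ) (hε : 0 < ε) (hεt : ε < t) (hx : 0 < x) (hum : PowBound x t u)
    (hu : ∀ s ∈ Ioo 0 t, 0 < u s) : 0 < halfLineConv u (cutLevyDensity α γ ε) t := by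
  have ht : 0 < t := hε.trans hεt
  rw [halfLineConv_cutLevyDensity_of_gt _ hε hεt]
  refine intervalIntegral.intervalIntegral_pos_of_pos_on ?_ (fun y hy => ?_) hεt
  · have h1 : ContinuousOn (levyDensity α γ) (uIcc ε t) := by
      rw [uIcc_of_le hεt.le]
      exact ((continuousOn_id.rpow_const fun y hy => Or.inl (hε.trans_le hy.1).ne').const_mul
        α).div_const _
    refine IntervalIntegrable.continuousOn_mul ?_ h1
    have h2 := ((intervalIntegrable_iff_integrableOn_Ioc_of_le (sub_pos.2 hεt).le).2
      ((hum.mono_time (by linarith)).integrableOn hx)).comp_sub_left t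
    simpa using h2.symm
  · exact mul_pos (levyDensity_pos hα hα1 hγ (hε.trans hy.1))
      (hu _ ⟨by linarith [hy.2], by linarith [hy.1]⟩)

/-- In f = γK - γ f * K the last term is only O(t^{2α-1}) by the crude bound on f, so f behaves like
γK near 0. -/
lemma exists_le_mittagLefflerDensity (hα : 0 < α) (hα1 : α < 1) (hγ : 0 < γ) :
    ∃ C : ℝ, 0 ≤ C ∧ ∀ t ∈ Ioc (0 : ℝ) 1,
      γ / Real.Gamma α * t ^ (α - 1) - C * t ^ (α + α - 1) ≤ mittagLefflerDensity α γ t := by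
  obtain ⟨C, hC0, hC⟩ := (powBound_mittagLefflerDensity hα hα1 hγ 1).exists_nonneg
  obtain ⟨C', hC0', hC'⟩ := (powBound_fracKernel α 1).exists_nonneg
  refine ⟨γ * (C * C' * ProbabilityTheory.beta α α), ?_, fun s hs => ?_⟩
  · have := ProbabilityTheory.beta_pos hα hα
    positivity
  have h := abs_halfLineConv_le hα hα hC0 hC hC' hs
  have h1 := mittagLefflerDensity_add_conv_fracKernel hα hα1 hγ hs.1
  rw [fracKernel] at h1
  have h2 := mul_le_mul_of_nonneg_left ((le_abs_self _).trans h) hγ.le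
  have h3 : γ * (s ^ (α - 1) / Real.Gamma α) = γ / Real.Gamma α * s ^ (α - 1) := by ring
  linarith

/-- The resolvent identity is the equation of the maximum principle with λ = 1, g = 0 and W = f. At
a first zero r it would give f * q(r) ≤ f(r) = 0, although f > 0 before r. -/
theorem mittagLefflerDensity_pos (hα : 0 < α) (hα1 : α < 1) (hγ : 0 < γ) {t : ℝ} (ht : 0 < t) :
    0 < mittagLefflerDensity α γ t := by
  have hcont := continuousOn_mittagLefflerDensity (γ := γ) hα hα1
  have heq : ∀ s, 0 < s → mittagLefflerDensity α γ s = γ * fracKernel α s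
      - γ * halfLineConv (mittagLefflerDensity α γ) (fracKernel α) s := fun s hs => by
    have := mittagLefflerDensity_add_conv_fracKernel hα hα1 hγ hs
    linarith
  obtain ⟨τ, hτ, hτpos⟩ : ∃ τ > 0, ∀ t ∈ Ioo 0 τ, 0 < mittagLefflerDensity α γ t := by
    obtain ⟨C, -, hC⟩ := exists_le_mittagLefflerDensity (γ := γ) hα hα1 hγ
    exact exists_pos_near_zero (show α < α + α by linarith)
      (div_pos hγ (Real.Gamma_pos_of_pos hα)) one_pos hC
  refine pos_of_forall_ne_zero hcont hτ hτpos (fun r hr hpos hzero => ?_) ht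
  have hP := powBound_mittagLefflerDensity hα hα1 hγ r
  have h1 := halfLineConv_cutLevyDensity_le (lam := 1) (g := fun _ => 0)
    (W := mittagLefflerDensity α γ) (ε := r / 2) hα hα1 hγ (by linarith) hα hr zero_le_one
    (.of_forall (C := 0) aestronglyMeasurable_const fun s _ => by simp) hP hP
    (.of_forall fun _ => le_rfl) hzero.ge
    (hcont.continuousAt (Ioi_mem_nhds hr)).continuousWithinAt
    (fun s hs => (hpos s hs).le) hzero fun s hs => by
      have : halfLineConv (fun r => 0 - mittagLefflerDensity α γ r) (fracKernel α) s
          = (-1) * halfLineConv (mittagLefflerDensity α γ) (fracKernel α) s := by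
        rw [← halfLineConv_const_mul_left]; simp
      rw [heq s hs.1, this]; ring
  have h2 := halfLineConv_cutLevyDensity_pos hα hα1 hγ (by linarith) (by linarith : r / 2 < r) hα hP
    hpos
  rw [hzero] at h1
  linarith

lemma mittagLefflerDensity_le (hα : 0 < α) (hα1 : α < 1) (hγ : 0 < γ) {t : ℝ} (ht : 0 < t) :
    mittagLefflerDensity α γ t ≤ γ / Real.Gamma α * t ^ (α - 1) := by
  have h := mittagLefflerDensity_add_conv_fracKernel hα hα1 hγ ht
  have h2 : 0 ≤ halfLineConv (mittagLefflerDensity α γ) (fracKernel α) t := by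
    rw [halfLineConv, intervalIntegral.integral_of_le ht.le, integral_Ioc_eq_integral_Ioo]
    exact setIntegral_nonneg measurableSet_Ioo fun s hs =>
      mul_nonneg (mittagLefflerDensity_pos hα hα1 hγ hs.1).le
        (fracKernel_nonneg hα (by linarith [hs.2]))
  have h3 := mul_nonneg hγ.le h2
  rw [fracKernel] at h
  have h4 : γ * (t ^ (α - 1) / Real.Gamma α) = γ / Real.Gamma α * t ^ (α - 1) := by ring
  linarith

end Positivity

section JumpOperator
open Filter Topology

/-! ### The nonlinear operator `𝒱` -/

/-- The function `x ↦ e^{-x} - 1 + x`. -/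
noncomputable def expRemainder (x : ℝ) : ℝ := Real.exp (-x) - 1 + x

/-- The integral `∫_{(t-y)⁺}^t a f(s) ds`. -/
noncomputable def windowIntegral (a : ℝ) (f : ℝ → ℝ) (t y : ℝ) : ℝ :=
  ∫ s in (max (t - y) 0)..t, a * f s

lemma operatorV_eq (α c b ζl : ℝ) (f : ℝ → ℝ) (t : ℝ) :
    operatorV α c b ζl f t
      = ∫ y, expRemainder (windowIntegral (ζl / b) f t y) ∂(nuStar α c) := rfl

lemma expRemainder_nonneg (x : ℝ) : 0 ≤ expRemainder x := by
  have := Real.add_one_le_exp (-x)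
  rw [expRemainder]; linarith

lemma continuous_expRemainder : Continuous expRemainder := by
  unfold expRemainder; fun_prop

lemma expRemainder_zero : expRemainder 0 = 0 := by simp [expRemainder]

lemma abs_exp_sub_one_le_mul_exp_abs (w : ℝ) : |Real.exp w - 1| ≤ |w| * Real.exp |w| := by
  have h1 := Real.add_one_le_exp w
  have h2 := Real.add_one_le_exp (-w)
  have h3 : Real.exp w * Real.exp (-w) = 1 := by rw [← Real.exp_add]; simp
  have h4 : 1 ≤ Real.exp |w| := Real.one_le_exp (abs_nonneg w)
  have h5 : Real.exp w ≤ Real.exp |w| := Real.exp_le_exp.2 (le_abs_self w)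
  have h6 := Real.exp_pos w
  have h7 : Real.exp w - 1 ≤ w * Real.exp w := by nlinarith
  rw [abs_le]
  constructor
  · have : -(|w| * Real.exp |w|) ≤ -|w| := by nlinarith [abs_nonneg w]
    linarith [neg_abs_le w]
  · have : w * Real.exp w ≤ |w| * Real.exp |w| :=
      mul_le_mul (le_abs_self w) h5 h6.le (abs_nonneg w)
    linarith

/-- Mean value inequality: the derivative 1 - e^{-z} vanishes at 0 and is at most m e^m on [-m, m].
The small factor m yields the quadratic gain needed against ν_*. -/
lemma abs_expRemainder_sub_le {m x y : ℝ} (hx : |x| ≤ m) (hy : |y| ≤ m) :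
    |expRemainder x - expRemainder y| ≤ m * Real.exp m * |x - y| := by
  have hd : ∀ z ∈ Icc (-m) m,
      HasDerivWithinAt expRemainder (-Real.exp (-z) + 1) (Icc (-m) m) z := by
    intro z _
    have h := (((hasDerivAt_id z).neg.exp.sub_const 1).add (hasDerivAt_id z))
    refine (h.congr_deriv ?_).hasDerivWithinAt
    simp
  have hb : ∀ z ∈ Icc (-m) m, ‖-Real.exp (-z) + 1‖ ≤ m * Real.exp m := by
    intro z hz
    have h1 := abs_exp_sub_one_le_mul_exp_abs (-z)
    have h2 : |-z| ≤ m := by rw [abs_neg]; exact abs_le.2 hz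
    rw [Real.norm_eq_abs, ← abs_neg, neg_add, neg_neg, ← sub_eq_add_neg]
    exact h1.trans (mul_le_mul h2 (Real.exp_le_exp.2 h2) (Real.exp_pos _).le
      ((abs_nonneg _).trans h2))
  exact (convex_Icc (-m) m).norm_image_sub_le_of_norm_hasDerivWithin_le hd hb
    (abs_le.1 hy) (abs_le.1 hx)

variable {α c : ℝ}

/-! ### Integrals against ν_*. -/

lemma ae_nuStar_pos (α c : ℝ) : ∀ᵐ y ∂(nuStar α c), 0 < y :=
  (withDensity_absolutelyContinuous _ _).ae_le (ae_restrict_mem measurableSet_Ioi)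

lemma integrable_nuStar_iff (hc : 0 ≤ c) (F : ℝ → ℝ) :
    Integrable F (nuStar α c) ↔ IntegrableOn (fun y => F y * (c * y ^ (-α - 2))) (Ioi 0) := by
  rw [nuStar, integrable_withDensity_iff (by fun_prop) (.of_forall fun _ => ENNReal.ofReal_lt_top)]
  refine integrable_congr ((ae_restrict_iff' measurableSet_Ioi).2 (.of_forall fun y hy => ?_))
  simp only
  rw [ENNReal.toReal_ofReal (mul_nonneg hc (Real.rpow_nonneg (mem_Ioi.1 hy).le _))]

lemma integral_nuStar (hc : 0 ≤ c) (F : ℝ → ℝ) :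
    ∫ y, F y ∂(nuStar α c) = ∫ y in Ioi 0, F y * (c * y ^ (-α - 2)) := by
  rw [nuStar, integral_withDensity_eq_integral_toReal_smul (by fun_prop)
    (.of_forall fun _ => ENNReal.ofReal_lt_top)]
  refine setIntegral_congr_fun measurableSet_Ioi fun y hy => ?_
  rw [ENNReal.toReal_ofReal (mul_nonneg hc (Real.rpow_nonneg (mem_Ioi.1 hy).le _)), smul_eq_mul,
    mul_comm]

lemma min_sq_mul_density_eqOn_Ioc {t : ℝ} :
    EqOn (fun y => (min y t) ^ 2 * (c * y ^ (-α - 2))) (fun y => c * y ^ (-α)) (Ioc 0 t) := by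
  intro y hy
  simp only
  rw [min_eq_left hy.2, show -α = (-α - 2) + (2 : ℕ) by push_cast; ring,
    Real.rpow_add_natCast hy.1.ne']
  push_cast
  ring_nf

lemma min_sq_mul_density_eqOn_Ioi {t : ℝ} :
    EqOn (fun y => (min y t) ^ 2 * (c * y ^ (-α - 2)))
      (fun y => t ^ 2 * c * y ^ (-α - 2)) (Ioi t) := by
  intro y hy
  simp only
  rw [min_eq_right (mem_Ioi.1 hy).le]
  ring

lemma integrableOn_min_sq_mul_density (hα : 0 < α) (hα1 : α < 1) {t : ℝ} (ht : 0 < t) :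
    IntegrableOn (fun y => (min y t) ^ 2 * (c * y ^ (-α - 2))) (Ioc 0 t) ∧
    IntegrableOn (fun y => (min y t) ^ 2 * (c * y ^ (-α - 2))) (Ioi t) := by
  constructor
  · rw [integrableOn_congr_fun min_sq_mul_density_eqOn_Ioc measurableSet_Ioc]
    have h := integrableOn_rpow_sub_one (x := 1 - α) (by linarith) ht.le
    rw [show 1 - α - 1 = -α by ring] at h
    exact h.const_mul c
  · rw [integrableOn_congr_fun min_sq_mul_density_eqOn_Ioi measurableSet_Ioi]
    exact (integrableOn_Ioi_rpow_of_lt (by linarith) ht).const_mul _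

lemma integrable_min_sq_nuStar (hα : 0 < α) (hα1 : α < 1) (hc : 0 ≤ c) {t : ℝ} (ht : 0 < t) :
    Integrable (fun y => (min y t) ^ 2) (nuStar α c) := by
  rw [integrable_nuStar_iff hc, ← Ioc_union_Ioi_eq_Ioi ht.le, integrableOn_union]
  exact integrableOn_min_sq_mul_density hα hα1 ht

/-- Near 0 the integrand is y^{-α}, integrable since α < 1; beyond t it is a multiple of y^{-α-2}.
The power t^{1-α} is what later cancels one of two factors t^{α-1}. -/
lemma integral_min_sq_nuStar (hα : 0 < α) (hα1 : α < 1) (hc : 0 ≤ c) {t : ℝ} (ht : 0 < t) :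
    ∫ y, (min y t) ^ 2 ∂(nuStar α c) = c * (1 / (1 - α) + 1 / (1 + α)) * t ^ (1 - α) := by
  obtain ⟨h1, h2⟩ := integrableOn_min_sq_mul_density (c := c) hα hα1 ht
  rw [integral_nuStar hc, ← Ioc_union_Ioi_eq_Ioi ht.le,
    setIntegral_union (Ioc_disjoint_Ioi le_rfl) measurableSet_Ioi h1 h2,
    setIntegral_congr_fun measurableSet_Ioc min_sq_mul_density_eqOn_Ioc,
    setIntegral_congr_fun measurableSet_Ioi min_sq_mul_density_eqOn_Ioi,
    integral_const_mul, integral_const_mul, ← intervalIntegral.integral_of_le ht.le,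
    integral_rpow (Or.inl (by linarith)), integral_Ioi_rpow_of_lt (by linarith) ht,
    Real.zero_rpow (by linarith)]
  have e1 : t ^ (-α - 2 + 1) * t ^ 2 = t ^ (1 - α) := by
    rw [← Real.rpow_natCast, ← Real.rpow_add ht]
    norm_num; ring_nf
  have e2 : t ^ (-α + 1) = t ^ (1 - α) := by ring_nf
  have n1 : 1 - α ≠ 0 := by linarith
  have n2 : 1 + α ≠ 0 := by linarith
  have e3 : -t ^ (-α - 2 + 1) / (-α - 2 + 1) = t ^ (-α - 2 + 1) / (1 + α) := by
    rw [show -α - 2 + 1 = -(1 + α) by ring, neg_div_neg_eq]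
  rw [e3, e2, ← e1, show -α + 1 = 1 - α by ring]
  ring

/-- `ψ` is measurable on `(0, T]` with `|ψ s| ≤ M s^{α-1}` for all `s ∈ (0, T]`. -/
structure WeightedBound (α M T : ℝ) (ψ : ℝ → ℝ) : Prop where
  meas : AEStronglyMeasurable ψ (volume.restrict (Ioc 0 T))
  bound : ∀ s ∈ Ioc 0 T, |ψ s| ≤ M * s ^ (α - 1)

variable {M D T Z : ℝ} {ψ ψ₁ ψ₂ : ℝ → ℝ}

/-! ### Window integrals and the size of 𝒱. -/

lemma WeightedBound.powBound (h : WeightedBound α M T ψ) : PowBound α T ψ :=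
  .of_forall h.meas h.bound

lemma WeightedBound.mono_time (h : WeightedBound α M T ψ) {t : ℝ} (ht : t ≤ T) :
    WeightedBound α M t ψ :=
  ⟨(h.powBound.mono_time ht).1, fun s hs => h.bound s ⟨hs.1, hs.2.trans ht⟩⟩

lemma WeightedBound.nonneg (h : WeightedBound α M T ψ) (hT : 0 < T) : 0 ≤ M := by
  have := (abs_nonneg _).trans (h.bound T ⟨hT, le_rfl⟩)
  exact nonneg_of_mul_nonneg_left this (Real.rpow_pos_of_pos hT _)

lemma WeightedBound.intervalIntegrable (h : WeightedBound α M T ψ) (hα : 0 < α) {r t : ℝ}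
    (hr : 0 ≤ r) (hrt : r ≤ t) (ht : t ≤ T) : IntervalIntegrable ψ volume r t :=
  (intervalIntegrable_iff_integrableOn_Ioc_of_le hrt).2
    ((h.powBound.integrableOn hα).mono_set (Ioc_subset_Ioc hr ht))

lemma abs_windowIntegral_le (hα : 0 < α) (hα1 : α < 1) (hZ : 0 ≤ Z) {t y : ℝ}
    (ht : 0 < t) (hy : 0 ≤ y) (hD : 0 ≤ D) (h : ∀ s ∈ Ioc 0 t, |ψ s| ≤ D * s ^ (α - 1)) :
    |windowIntegral Z ψ t y| ≤ Z * D / α * (min y t * t ^ (α - 1)) := by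
  have h0 : 0 ≤ max (t - y) 0 := le_max_right _ _
  have h1 : max (t - y) 0 ≤ t := max_le (by linarith) ht.le
  have h2 : ‖windowIntegral Z ψ t y‖ ≤ ∫ s in (max (t - y) 0)..t, Z * D * s ^ (α - 1) := by
    refine intervalIntegral.norm_integral_le_of_norm_le h1 (.of_forall fun s hs => ?_)
      ((intervalIntegral.intervalIntegrable_rpow' (by linarith)).const_mul _)
    rw [norm_mul, Real.norm_eq_abs, Real.norm_eq_abs, abs_of_nonneg hZ, mul_assoc]
    exact mul_le_mul_of_nonneg_left (h s ⟨h0.trans_lt hs.1, hs.2⟩) hZ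
  rw [← Real.norm_eq_abs]
  refine h2.trans ?_
  rw [intervalIntegral.integral_const_mul, integral_rpow (Or.inl (by linarith)), sub_add_cancel,
    mul_div_assoc', div_mul_eq_mul_div]
  exact div_le_div_of_nonneg_right (mul_le_mul_of_nonneg_left
    (rpow_sub_max_rpow_le hα hα1 ht hy) (mul_nonneg hZ hD)) hα.le

lemma min_mul_rpow_le (hα : 0 < α) {t y : ℝ} (ht : t ∈ Ioc 0 T) :
    min y t * t ^ (α - 1) ≤ T ^ α := by
  calc min y t * t ^ (α - 1) ≤ t * t ^ (α - 1) :=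
        mul_le_mul_of_nonneg_right (min_le_right _ _) (Real.rpow_nonneg ht.1.le _)
    _ = t ^ α := by rw [mul_comm, ← Real.rpow_add_one ht.1.ne', sub_add_cancel]
    _ ≤ T ^ α := Real.rpow_le_rpow ht.1.le ht.2 hα.le

/-- Expressing the window through a continuous primitive makes it continuous in both t and y. The
truncation to (0, T] is needed because ψ is controlled only there. -/
lemma windowIntegral_eq_primitive (Z : ℝ) (ψ : ℝ → ℝ) {t y : ℝ}
    (ht : t ∈ Ioc 0 T) (hy : 0 ≤ y) (hi : IntervalIntegrable (indicator (Ioc 0 T) ψ) volume 0 t) :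
    windowIntegral Z ψ t y = Z * ((∫ s in (0 : ℝ)..t, indicator (Ioc 0 T) ψ s)
      - ∫ s in (0 : ℝ)..(max (t - y) 0), indicator (Ioc 0 T) ψ s) := by
  have h0 : 0 ≤ max (t - y) 0 := le_max_right _ _
  have h1 : max (t - y) 0 ≤ t := max_le (by linarith) ht.1.le
  rw [windowIntegral, intervalIntegral.integral_const_mul,
    intervalIntegral.integral_interval_sub_left hi (hi.mono_set (by
      rw [uIcc_of_le h0, uIcc_of_le ht.1.le]; exact Icc_subset_Icc_right h1))]
  congr 1
  refine intervalIntegral.integral_congr_ae (.of_forall fun s hs => ?_)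
  rw [uIoc_of_le h1] at hs
  rw [indicator_of_mem (show s ∈ Ioc 0 T from ⟨h0.trans_lt hs.1, hs.2.trans ht.2⟩)]

lemma WeightedBound.continuous_primitive (h : WeightedBound α M T ψ) (hα : 0 < α) :
    Continuous fun t => ∫ s in (0 : ℝ)..t, indicator (Ioc 0 T) ψ s :=
  intervalIntegral.continuous_primitive
    (fun _ _ => (h.powBound.integrable_indicator hα).intervalIntegrable) 0

lemma WeightedBound.aestronglyMeasurable_windowIntegral (h : WeightedBound α M T ψ) (hα : 0 < α)
    {t : ℝ} (ht : t ∈ Ioc 0 T) (Z : ℝ) :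
    AEStronglyMeasurable (windowIntegral Z ψ t) (nuStar α c) := by
  have hX := h.continuous_primitive hα
  have hc : Continuous fun y => Z * ((∫ s in (0 : ℝ)..t, indicator (Ioc 0 T) ψ s)
      - ∫ s in (0 : ℝ)..(max (t - y) 0), indicator (Ioc 0 T) ψ s) :=
    continuous_const.mul (continuous_const.sub (hX.comp (by fun_prop)))
  refine hc.aestronglyMeasurable.congr ?_
  filter_upwards [ae_nuStar_pos α c] with y hy
  exact (windowIntegral_eq_primitive Z ψ ht hy.le
    (h.powBound.integrable_indicator hα).intervalIntegrable).symm

/-- The exponential factor in the local Lipschitz constant of `𝒱`. -/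
noncomputable def windowBound (α Z M T : ℝ) : ℝ := Real.exp (Z * M / α * T ^ α)

/-- Each window integral is O(min(y,t) t^{α-1}). One such factor comes from the Lipschitz constant
of `expRemainder`, the other from the difference of the windows; the product is ν_*-integrable. -/
lemma WeightedBound.abs_expRemainder_sub_le (h₁ : WeightedBound α M T ψ₁)
    (h₂ : WeightedBound α M T ψ₂) (hα : 0 < α) (hα1 : α < 1) (hZ : 0 ≤ Z) {t y : ℝ}
    (ht : t ∈ Ioc 0 T) (hy : 0 ≤ y) (hD : 0 ≤ D)
    (h : ∀ s ∈ Ioc 0 t, |ψ₁ s - ψ₂ s| ≤ D * s ^ (α - 1)) :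
    |expRemainder (windowIntegral Z ψ₁ t y) - expRemainder (windowIntegral Z ψ₂ t y)|
      ≤ windowBound α Z M T * (Z * M / α) * (Z * D / α) * (t ^ (α - 1)) ^ 2 * (min y t) ^ 2 := by
  have hM := h₁.nonneg (ht.1.trans_le ht.2)
  have e1 := abs_windowIntegral_le hα hα1 hZ ht.1 hy hM (h₁.mono_time ht.2).bound
  have e2 := abs_windowIntegral_le hα hα1 hZ ht.1 hy hM (h₂.mono_time ht.2).bound
  have e3 := abs_windowIntegral_le hα hα1 hZ ht.1 hy hD h
  have e4 : windowIntegral Z (fun s => ψ₁ s - ψ₂ s) t y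
      = windowIntegral Z ψ₁ t y - windowIntegral Z ψ₂ t y := by
    have h1 : max (t - y) 0 ≤ t := max_le (by linarith) ht.1.le
    simp only [windowIntegral, mul_sub]
    exact intervalIntegral.integral_sub
      ((h₁.intervalIntegrable hα (le_max_right _ _) h1 ht.2).const_mul Z)
      ((h₂.intervalIntegrable hα (le_max_right _ _) h1 ht.2).const_mul Z)
  rw [e4] at e3
  set w := min y t * t ^ (α - 1) with hw
  have hw0 : 0 ≤ w := mul_nonneg (le_min hy ht.1.le) (Real.rpow_nonneg ht.1.le _)
  have hwT : w ≤ T ^ α := min_mul_rpow_le hα ht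
  have hk : 0 ≤ Z * M / α := div_nonneg (mul_nonneg hZ hM) hα.le
  have hk' : 0 ≤ Z * D / α := div_nonneg (mul_nonneg hZ hD) hα.le
  calc _ ≤ (Z * M / α * w) * Real.exp (Z * M / α * w)
        * |windowIntegral Z ψ₁ t y - windowIntegral Z ψ₂ t y| :=
        _root_.abs_expRemainder_sub_le e1 e2
    _ ≤ (Z * M / α * w) * windowBound α Z M T * (Z * D / α * w) := by
        refine mul_le_mul (mul_le_mul_of_nonneg_left (Real.exp_le_exp.2
          (mul_le_mul_of_nonneg_left hwT hk)) (mul_nonneg hk hw0)) e3 (abs_nonneg _) ?_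
        exact mul_nonneg (mul_nonneg hk hw0) (Real.exp_pos _).le
    _ = _ := by rw [hw]; ring

lemma WeightedBound.zero (hM : 0 ≤ M) : WeightedBound α M T (fun _ => 0) :=
  ⟨aestronglyMeasurable_const, fun s hs => by
    rw [abs_zero]; exact mul_nonneg hM (Real.rpow_nonneg hs.1.le _)⟩

lemma windowIntegral_zero (Z t y : ℝ) : windowIntegral Z (fun _ => 0) t y = 0 := by
  simp [windowIntegral]

lemma WeightedBound.abs_expRemainder_le (h : WeightedBound α M T ψ) (hα : 0 < α) (hα1 : α < 1)
    (hZ : 0 ≤ Z) {t y : ℝ} (ht : t ∈ Ioc 0 T) (hy : 0 ≤ y) :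
    |expRemainder (windowIntegral Z ψ t y)|
      ≤ windowBound α Z M T * (Z * M / α) * (Z * M / α) * (t ^ (α - 1)) ^ 2 * (min y t) ^ 2 := by
  have hM := h.nonneg (ht.1.trans_le ht.2)
  have := h.abs_expRemainder_sub_le (.zero hM) hα hα1 hZ ht hy hM
    (fun s hs => by simpa using h.bound s ⟨hs.1, hs.2.trans ht.2⟩)
  simpa [windowIntegral_zero, expRemainder_zero] using this

lemma WeightedBound.integrable_expRemainder (h : WeightedBound α M T ψ) (hα : 0 < α)
    (hα1 : α < 1) (hc : 0 ≤ c) (hZ : 0 ≤ Z) {t : ℝ} (ht : t ∈ Ioc 0 T) :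
    Integrable (fun y => expRemainder (windowIntegral Z ψ t y)) (nuStar α c) := by
  refine ((integrable_min_sq_nuStar hα hα1 hc ht.1).const_mul
    (windowBound α Z M T * (Z * M / α) * (Z * M / α) * (t ^ (α - 1)) ^ 2)).mono'
    (continuous_expRemainder.comp_aestronglyMeasurable
      (h.aestronglyMeasurable_windowIntegral hα ht Z)) ?_
  filter_upwards [ae_nuStar_pos α c] with y hy
  exact h.abs_expRemainder_le hα hα1 hZ ht hy.le

variable {b ζl : ℝ}

/-- The local Lipschitz constant of `𝒱`. -/
noncomputable def jumpLipschitzConst (α c Z M T : ℝ) : ℝ :=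
  windowBound α Z M T * (Z * M / α) * (Z / α) * (c * (1 / (1 - α) + 1 / (1 + α)))

/-- After integration over ν_* the powers combine as (t^{α-1})² t^{1-α} = t^{α-1}, so 𝒱 is no more
singular at 0 than its argument. -/
theorem WeightedBound.abs_operatorV_sub_le (h₁ : WeightedBound α M T ψ₁)
    (h₂ : WeightedBound α M T ψ₂) (hα : 0 < α) (hα1 : α < 1) (hc : 0 ≤ c) (hZ : 0 ≤ ζl / b)
    {t : ℝ} (ht : t ∈ Ioc 0 T) (hD : 0 ≤ D)
    (h : ∀ s ∈ Ioc 0 t, |ψ₁ s - ψ₂ s| ≤ D * s ^ (α - 1)) :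
    |operatorV α c b ζl ψ₁ t - operatorV α c b ζl ψ₂ t|
      ≤ jumpLipschitzConst α c (ζl / b) M T * D * t ^ (α - 1) := by
  rw [operatorV_eq, operatorV_eq,
    ← integral_sub (h₁.integrable_expRemainder hα hα1 hc hZ ht)
      (h₂.integrable_expRemainder hα hα1 hc hZ ht), ← Real.norm_eq_abs]
  refine (norm_integral_le_of_norm_le ((integrable_min_sq_nuStar hα hα1 hc ht.1).const_mul
    (windowBound α (ζl / b) M T * (ζl / b * M / α) * (ζl / b * D / α) * (t ^ (α - 1)) ^ 2))
    ?_).trans (le_of_eq ?_)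
  · filter_upwards [ae_nuStar_pos α c] with y hy
    exact h₁.abs_expRemainder_sub_le h₂ hα hα1 hZ ht hy.le hD h
  · rw [integral_const_mul, integral_min_sq_nuStar hα hα1 hc ht.1, jumpLipschitzConst]
    have : t ^ (α - 1) * t ^ (1 - α) = 1 := by
      rw [← Real.rpow_add ht.1]; simp
    calc _ = windowBound α (ζl / b) M T * (ζl / b * M / α) * (ζl / b / α)
          * (c * (1 / (1 - α) + 1 / (1 + α))) * D * t ^ (α - 1)
          * (t ^ (α - 1) * t ^ (1 - α)) := by ring
      _ = _ := by rw [this, mul_one]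

lemma jumpLipschitzConst_nonneg (hα : 0 < α) (hα1 : α < 1) (hc : 0 ≤ c) (hZ : 0 ≤ Z)
    (hM : 0 ≤ M) : 0 ≤ jumpLipschitzConst α c Z M T := by
  have : 0 ≤ 1 - α := by linarith
  unfold jumpLipschitzConst windowBound
  positivity

theorem WeightedBound.continuousOn_operatorV (h : WeightedBound α M T ψ) (hα : 0 < α)
    (hα1 : α < 1) (hc : 0 ≤ c) (hZ : 0 ≤ ζl / b) :
    ContinuousOn (operatorV α c b ζl ψ) (Ioc 0 T) := by
  intro t ht
  have hT : 0 < T := ht.1.trans_le ht.2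
  have hM := h.nonneg hT
  have ht2 : 0 < t / 2 := by linarith [ht.1]
  have hk : 0 ≤ windowBound α (ζl / b) M T * (ζl / b * M / α) * (ζl / b * M / α) := by
    unfold windowBound; positivity
  refine continuousWithinAt_of_dominated (μ := nuStar α c)
    (F := fun s y => expRemainder (windowIntegral (ζl / b) ψ s y))
    (bound := fun y => windowBound α (ζl / b) M T * (ζl / b * M / α) * (ζl / b * M / α)
      * ((t / 2) ^ (α - 1)) ^ 2 * (min y T) ^ 2) ?_ ?_ ?_ ?_
  · filter_upwards [self_mem_nhdsWithin] with s hs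
    exact continuous_expRemainder.comp_aestronglyMeasurable
      (h.aestronglyMeasurable_windowIntegral hα hs _)
  · filter_upwards [self_mem_nhdsWithin, mem_nhdsWithin_of_mem_nhds
      (lt_mem_nhds (show t / 2 < t by linarith [ht.1]))] with s hs hst
    filter_upwards [ae_nuStar_pos α c] with y hy
    refine (h.abs_expRemainder_le hα hα1 hZ hs hy.le).trans ?_
    have h1 : s ^ (α - 1) ≤ (t / 2) ^ (α - 1) :=
      Real.rpow_le_rpow_of_nonpos ht2 (le_of_lt hst) (by linarith)
    have h2 : min y s ≤ min y T := min_le_min_left _ hs.2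
    have h3 : 0 ≤ min y s := le_min hy.le hs.1.le
    have h4 := Real.rpow_nonneg hs.1.le (α - 1)
    gcongr
  · exact (integrable_min_sq_nuStar hα hα1 hc hT).const_mul _
  · filter_upwards [ae_nuStar_pos α c] with y hy
    have hX := h.continuous_primitive hα
    have hcont : Continuous fun s => ζl / b * ((∫ r in (0 : ℝ)..s, indicator (Ioc 0 T) ψ r)
        - ∫ r in (0 : ℝ)..(max (s - y) 0), indicator (Ioc 0 T) ψ r) :=
      continuous_const.mul (hX.sub (hX.comp (by fun_prop)))
    have hc2 : ContinuousWithinAt (fun s => windowIntegral (ζl / b) ψ s y) (Ioc 0 T) t :=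
      (hcont.continuousOn.congr fun s hs => windowIntegral_eq_primitive _ ψ hs hy.le
        (h.powBound.integrable_indicator hα).intervalIntegrable) t ht
    exact continuous_expRemainder.continuousAt.comp_continuousWithinAt hc2

lemma operatorV_nonneg (α c b ζl : ℝ) (ψ : ℝ → ℝ) (t : ℝ) : 0 ≤ operatorV α c b ζl ψ t :=
  integral_nonneg fun _ => expRemainder_nonneg _

lemma operatorV_congr {t : ℝ} (ht : 0 ≤ t) (h : ∀ s ∈ Ioc 0 t, ψ₁ s = ψ₂ s) :
    operatorV α c b ζl ψ₁ t = operatorV α c b ζl ψ₂ t := by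
  rw [operatorV_eq, operatorV_eq]
  refine integral_congr_ae ?_
  filter_upwards [ae_nuStar_pos α c] with y hy
  congr 1
  refine intervalIntegral.integral_congr_ae (.of_forall fun s hs => ?_)
  rw [uIoc_of_le (max_le (by linarith) ht)] at hs
  rw [h s ⟨(le_max_right _ _).trans_lt hs.1, hs.2⟩]

end JumpOperator

section VolterraFixedPoint
open Filter Topology

/-! ### Volterra equations with a singular locally Lipschitz nonlinearity -/

/-- A causal operator on functions bounded by a multiple of `s^{α-1}`, Lipschitz on bounded sets
with values bounded by a multiple of `s^{2α-2}`. -/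
structure SingularLipschitz (α : ℝ) (N : (ℝ → ℝ) → ℝ → ℝ) : Prop where
  powBound : ∀ {M T : ℝ} {ψ : ℝ → ℝ}, 0 < T → WeightedBound α M T ψ →
    PowBound (2 * α - 1) T (N ψ)
  lipschitz : ∀ {M T : ℝ}, 0 < T → 0 ≤ M → ∃ C : ℝ, 0 ≤ C ∧ ∀ {ψ₁ ψ₂ : ℝ → ℝ},
    WeightedBound α M T ψ₁ → WeightedBound α M T ψ₂ → ∀ {t D : ℝ}, t ∈ Ioc 0 T → 0 ≤ D →
      (∀ s ∈ Ioc 0 t, |ψ₁ s - ψ₂ s| ≤ D * s ^ (α - 1)) →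
      |N ψ₁ t - N ψ₂ t| ≤ C * D * t ^ (2 * α - 1 - 1)

lemma rpow_mul_exp_neg_le_one {x ε : ℝ} (hx : 0 ≤ x) (hε : 0 ≤ ε) (hε1 : ε ≤ 1) :
    x ^ ε * Real.exp (-x) ≤ 1 := by
  have h1 : x ^ ε ≤ (x + 1) ^ (1 : ℝ) :=
    (Real.rpow_le_rpow hx (by linarith) hε).trans
      (Real.rpow_le_rpow_of_exponent_le (by linarith) hε1)
  rw [Real.rpow_one] at h1
  have h2 := h1.trans (Real.add_one_le_exp x)
  rw [Real.exp_neg, ← div_eq_mul_inv, div_le_one (Real.exp_pos x)]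
  exact h2

variable {α γ : ℝ} {N : (ℝ → ℝ) → ℝ → ℝ}

/-- The surplus α - 1/2 in the exponent is traded for a negative power of Λ; what remains, r^{-1/2},
is still integrable. -/
lemma rpow_mul_exp_neg_mul_le (hα : 1 / 2 < α) (hα1 : α < 1) {Λ r : ℝ} (hΛ : 0 < Λ)
    (hr : 0 < r) :
    r ^ (α - 1) * Real.exp (-(Λ * r)) ≤ Λ ^ (-(α - 1 / 2)) * r ^ ((1 / 2 : ℝ) - 1) := by
  have h := rpow_mul_exp_neg_le_one (mul_pos hΛ hr).le (ε := α - 1 / 2) (by linarith)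
    (by linarith)
  rw [Real.mul_rpow hΛ.le hr.le] at h
  rw [Real.rpow_neg hΛ.le, ← div_eq_inv_mul, le_div_iff₀ (Real.rpow_pos_of_pos hΛ _),
    show α - 1 = (α - 1 / 2) + ((1 / 2 : ℝ) - 1) by ring, Real.rpow_add hr]
  have h2 := mul_le_mul_of_nonneg_right h (Real.rpow_nonneg hr.le ((1 / 2 : ℝ) - 1))
  rw [one_mul] at h2
  refine le_trans (le_of_eq ?_) h2
  ring

/-- The weight e^{Λt} moves a factor e^{-Λ(t-s)} onto the kernel, which makes the Lipschitz constant
O(Λ^{-(α-1/2)}). -/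
theorem SingularLipschitz.exists_contraction (hN : SingularLipschitz α N) (hα : 1 / 2 < α)
    (hα1 : α < 1) (hγ : 0 < γ) {M T : ℝ} (hT : 0 < T) (hM : 0 ≤ M) :
    ∃ Λ : ℝ, 0 < Λ ∧ ∀ ψ₁ ψ₂ : ℝ → ℝ, WeightedBound α M T ψ₁ → WeightedBound α M T ψ₂ →
      ∀ D : ℝ, 0 ≤ D →
      (∀ s ∈ Ioc 0 T, |ψ₁ s - ψ₂ s| ≤ D * Real.exp (Λ * s) * s ^ (α - 1)) →
      ∀ t ∈ Ioc 0 T, |halfLineConv (N ψ₁) (mittagLefflerDensity α γ) t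
        - halfLineConv (N ψ₂) (mittagLefflerDensity α γ) t|
          ≤ D / 2 * Real.exp (Λ * t) * t ^ (α - 1) := by
  have hα0 : 0 < α := by linarith
  have hβ : 0 < 2 * α - 1 := by linarith
  obtain ⟨C, hC0, hC⟩ := hN.lipschitz hT hM
  set A := γ / Real.Gamma α with hA
  have hA0 : 0 < A := div_pos hγ (Real.Gamma_pos_of_pos hα0)
  set B := ProbabilityTheory.beta (2 * α - 1) (1 / 2) with hB
  have hB0 : 0 < B := ProbabilityTheory.beta_pos hβ (by norm_num)
  have hlim : Tendsto (fun Λ : ℝ => C * A * B * T ^ (α - 1 / 2) * Λ ^ (-(α - 1 / 2))) atTop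
      (𝓝 0) := by
    simpa using (tendsto_rpow_neg_atTop (show 0 < α - 1 / 2 by linarith)).const_mul
      (C * A * B * T ^ (α - 1 / 2))
  obtain ⟨Λ, hΛ1, hΛ⟩ := ((hlim.eventually (gt_mem_nhds (show (0 : ℝ) < 1 / 2 by norm_num))).and
    (eventually_gt_atTop 0)).exists
  refine ⟨Λ, hΛ, fun ψ₁ ψ₂ h₁ h₂ D hD hd t ht => ?_⟩
  have hdiff : ∀ s ∈ Ioc 0 T,
      |N ψ₁ s - N ψ₂ s| ≤ C * (D * Real.exp (Λ * s)) * s ^ (2 * α - 1 - 1) := by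
    intro s hs
    refine hC h₁ h₂ hs (mul_nonneg hD (Real.exp_pos _).le) fun r hr => ?_
    refine (hd r ⟨hr.1, hr.2.trans hs.2⟩).trans ?_
    refine mul_le_mul_of_nonneg_right (mul_le_mul_of_nonneg_left ?_ hD)
      (Real.rpow_nonneg hr.1.le _)
    exact Real.exp_le_exp.2 (mul_le_mul_of_nonneg_left hr.2 hΛ.le)
  have hP₁ := hN.powBound hT h₁
  have hP₂ := hN.powBound hT h₂
  have hf := powBound_mittagLefflerDensity (α := α) (γ := γ) hα0 hα1 hγ T
  rw [← halfLineConv_sub_left hP₁ hP₂ hf hβ hα0 ht]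
  have hint := (intervalIntegrable_rpow_mul_sub_rpow hβ (show (0 : ℝ) < 1 / 2 by norm_num)
    ht.1).const_mul (C * D * A * Λ ^ (-(α - 1 / 2)) * Real.exp (Λ * t))
  have hle : ‖halfLineConv (fun s => N ψ₁ s - N ψ₂ s) (mittagLefflerDensity α γ) t‖
      ≤ ∫ s in (0 : ℝ)..t, C * D * A * Λ ^ (-(α - 1 / 2)) * Real.exp (Λ * t)
        * (s ^ (2 * α - 1 - 1) * (t - s) ^ ((1 / 2 : ℝ) - 1)) := by
    refine intervalIntegral.norm_integral_le_of_norm_le ht.1.le ?_ hint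
    rw [← ae_restrict_iff' measurableSet_Ioc, ← restrict_Ioo_eq_restrict_Ioc,
      ae_restrict_iff' measurableSet_Ioo]
    refine .of_forall fun s hs => ?_
    have hts : 0 < t - s := by linarith [hs.2]
    have h1 := hdiff s ⟨hs.1, hs.2.le.trans ht.2⟩
    have h2 := mittagLefflerDensity_le hα0 hα1 hγ hts
    have h3 := rpow_mul_exp_neg_mul_le hα hα1 hΛ hts
    have hexp : Real.exp (Λ * s) = Real.exp (Λ * t) * Real.exp (-(Λ * (t - s))) := by
      rw [← Real.exp_add]; ring_nf
    have hs0 := Real.rpow_nonneg hs.1.le (2 * α - 1 - 1)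
    rw [norm_mul, Real.norm_eq_abs, Real.norm_eq_abs,
      abs_of_pos (mittagLefflerDensity_pos hα0 hα1 hγ hts)]
    calc _ ≤ (C * (D * Real.exp (Λ * s)) * s ^ (2 * α - 1 - 1)) * (A * (t - s) ^ (α - 1)) :=
          mul_le_mul h1 h2 (mittagLefflerDensity_pos hα0 hα1 hγ hts).le
            ((abs_nonneg _).trans h1)
      _ = C * D * A * Real.exp (Λ * t) * s ^ (2 * α - 1 - 1)
          * ((t - s) ^ (α - 1) * Real.exp (-(Λ * (t - s)))) := by rw [hexp]; ring
      _ ≤ C * D * A * Real.exp (Λ * t) * s ^ (2 * α - 1 - 1)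
          * (Λ ^ (-(α - 1 / 2)) * (t - s) ^ ((1 / 2 : ℝ) - 1)) :=
          mul_le_mul_of_nonneg_left h3 (mul_nonneg (by positivity) hs0)
      _ = _ := by ring
  rw [intervalIntegral.integral_const_mul,
    integral_rpow_mul_sub_rpow hβ (by norm_num) ht.1, Real.norm_eq_abs] at hle
  -- The convolution gains α - 1/2 over the weight t^{α-1}; the excess is absorbed into T^{α-1/2}.
  have e1 : t ^ (2 * α - 1 + 1 / 2 - 1) ≤ t ^ (α - 1) * T ^ (α - 1 / 2) := by
    rw [show 2 * α - 1 + 1 / 2 - 1 = (α - 1) + (α - 1 / 2) by ring, Real.rpow_add ht.1]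
    exact mul_le_mul_of_nonneg_left (Real.rpow_le_rpow ht.1.le ht.2 (by linarith))
      (Real.rpow_nonneg ht.1.le _)
  have hK0 : 0 ≤ C * D * A * Λ ^ (-(α - 1 / 2)) * Real.exp (Λ * t) := by positivity
  have ht0 := Real.rpow_nonneg ht.1.le (α - 1)
  calc _ ≤ _ := hle
    _ ≤ C * D * A * Λ ^ (-(α - 1 / 2)) * Real.exp (Λ * t)
        * ((t ^ (α - 1) * T ^ (α - 1 / 2)) * B) :=
        mul_le_mul_of_nonneg_left (mul_le_mul_of_nonneg_right e1 hB0.le) hK0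
    _ = (C * A * B * T ^ (α - 1 / 2) * Λ ^ (-(α - 1 / 2)))
        * (D * Real.exp (Λ * t) * t ^ (α - 1)) := by ring
    _ ≤ 1 / 2 * (D * Real.exp (Λ * t) * t ^ (α - 1)) :=
        mul_le_mul_of_nonneg_right hΛ1.le (by positivity)
    _ = _ := by ring

/-- Stability of the Volterra equation `φ = h - N(ψ) * f`, where `ψ` is a nonexpansive pointwise
transformation of `φ`. -/
theorem SingularLipschitz.exists_stability (hN : SingularLipschitz α N) (hα : 1 / 2 < α)
    (hα1 : α < 1) (hγ : 0 < γ) {M T : ℝ} (hT : 0 < T) (hM : 0 ≤ M) :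
    ∃ A : ℝ, 0 < A ∧ ∀ φ₁ φ₂ ψ₁ ψ₂ h₁ h₂ : ℝ → ℝ, ∀ η D₀ : ℝ,
      WeightedBound α M T ψ₁ → WeightedBound α M T ψ₂ →
      (∀ s ∈ Ioc 0 T, |ψ₁ s - ψ₂ s| ≤ |φ₁ s - φ₂ s|) →
      (∀ t ∈ Ioc 0 T, φ₁ t = h₁ t - halfLineConv (N ψ₁) (mittagLefflerDensity α γ) t) →
      (∀ t ∈ Ioc 0 T, φ₂ t = h₂ t - halfLineConv (N ψ₂) (mittagLefflerDensity α γ) t) →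
      (∀ t ∈ Ioc 0 T, |φ₁ t - φ₂ t| ≤ D₀ * t ^ (α - 1)) →
      (∀ t ∈ Ioc 0 T, |h₁ t - h₂ t| ≤ η * t ^ (α - 1)) →
      ∀ t ∈ Ioc 0 T, |φ₁ t - φ₂ t| ≤ A * η * t ^ (α - 1) := by
  obtain ⟨Λ, hΛ, hcontr⟩ := hN.exists_contraction hα hα1 hγ hT hM
  refine ⟨2 * Real.exp (Λ * T), by positivity,
    fun φ₁ φ₂ ψ₁ ψ₂ h₁ h₂ η D₀ w₁ w₂ hψ e₁ e₂ hD₀ hη => ?_⟩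
  have hTp := Real.rpow_pos_of_pos hT (α - 1)
  have hη0 : 0 ≤ η :=
    nonneg_of_mul_nonneg_left ((abs_nonneg _).trans (hη T ⟨hT, le_rfl⟩)) hTp
  have hD0 : 0 ≤ D₀ :=
    nonneg_of_mul_nonneg_left ((abs_nonneg _).trans (hD₀ T ⟨hT, le_rfl⟩)) hTp
  -- The contraction is iterated from the a priori bound D₀, whose contribution halves each time.
  -- The constant 2η is the fixed point of x ↦ η + x/2.
  have key : ∀ k : ℕ, ∀ t ∈ Ioc 0 T,
      |φ₁ t - φ₂ t| ≤ (2 * η + D₀ * (1 / 2) ^ k) * Real.exp (Λ * t) * t ^ (α - 1) := by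
    intro k
    induction k with
    | zero =>
      intro t ht
      refine (hD₀ t ht).trans (mul_le_mul_of_nonneg_right ?_ (Real.rpow_nonneg ht.1.le _))
      rw [pow_zero, mul_one]
      have h1 : 1 ≤ Real.exp (Λ * t) := Real.one_le_exp (mul_nonneg hΛ.le ht.1.le)
      calc D₀ ≤ (2 * η + D₀) * 1 := by linarith
        _ ≤ _ := mul_le_mul_of_nonneg_left h1 (by positivity)
    | succ k ih =>
      intro t ht
      have h1 := hcontr ψ₁ ψ₂ w₁ w₂ (2 * η + D₀ * (1 / 2) ^ k) (by positivity)
        (fun s hs => (hψ s hs).trans (ih s hs)) t ht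
      have h2 := hη t ht
      have h3 : η * t ^ (α - 1) ≤ η * Real.exp (Λ * t) * t ^ (α - 1) := by
        refine mul_le_mul_of_nonneg_right ?_ (Real.rpow_nonneg ht.1.le _)
        exact le_mul_of_one_le_right hη0 (Real.one_le_exp (mul_nonneg hΛ.le ht.1.le))
      rw [e₁ t ht, e₂ t ht]
      have h4 := abs_sub (h₁ t - h₂ t) (halfLineConv (N ψ₁) (mittagLefflerDensity α γ) t
        - halfLineConv (N ψ₂) (mittagLefflerDensity α γ) t)
      rw [show h₁ t - halfLineConv (N ψ₁) (mittagLefflerDensity α γ) t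
        - (h₂ t - halfLineConv (N ψ₂) (mittagLefflerDensity α γ) t)
        = (h₁ t - h₂ t) - (halfLineConv (N ψ₁) (mittagLefflerDensity α γ) t
        - halfLineConv (N ψ₂) (mittagLefflerDensity α γ) t) by ring]
      calc _ ≤ _ := h4
        _ ≤ η * Real.exp (Λ * t) * t ^ (α - 1)
            + (2 * η + D₀ * (1 / 2) ^ k) / 2 * Real.exp (Λ * t) * t ^ (α - 1) :=
            add_le_add (h2.trans h3) h1
        _ = _ := by rw [pow_succ]; ring
  intro t ht
  have hlim : Tendsto (fun k : ℕ => (2 * η + D₀ * (1 / 2) ^ k) * Real.exp (Λ * t) * t ^ (α - 1))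
      atTop (𝓝 (2 * η * Real.exp (Λ * t) * t ^ (α - 1))) := by
    have h1 := (tendsto_pow_atTop_nhds_zero_of_lt_one (r := (1 / 2 : ℝ)) (by norm_num)
      (by norm_num)).const_mul D₀
    rw [mul_zero] at h1
    simpa using ((h1.const_add (2 * η)).mul_const (Real.exp (Λ * t))).mul_const (t ^ (α - 1))
  refine (ge_of_tendsto' hlim fun k => key k t ht).trans ?_
  refine mul_le_mul_of_nonneg_right ?_ (Real.rpow_nonneg ht.1.le _)
  rw [mul_right_comm]
  refine mul_le_mul_of_nonneg_right (mul_le_mul_of_nonneg_left ?_ zero_le_two) hη0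
  exact Real.exp_le_exp.2 (mul_le_mul_of_nonneg_left ht.2 hΛ.le)

lemma SingularLipschitz.exists_conv_bound (hN : SingularLipschitz α N) (hα : 1 / 2 < α)
    (hα1 : α < 1) (hγ : 0 < γ) {M T : ℝ} {ψ : ℝ → ℝ} (hT : 0 < T) (hψ : WeightedBound α M T ψ) :
    ∃ D : ℝ, 0 ≤ D ∧ ∀ t ∈ Ioc 0 T,
      |halfLineConv (N ψ) (mittagLefflerDensity α γ) t| ≤ D * t ^ (3 * α - 1 - 1) := by
  obtain ⟨C, hC0, hC⟩ := (hN.powBound hT hψ).exists_nonneg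
  obtain ⟨C', hC0', hC'⟩ := (powBound_mittagLefflerDensity (α := α) (γ := γ) (by linarith) hα1 hγ
    T).exists_nonneg
  refine ⟨C * C' * ProbabilityTheory.beta (2 * α - 1) α, ?_, fun t ht => ?_⟩
  · exact mul_nonneg (mul_nonneg hC0 hC0')
      (ProbabilityTheory.beta_pos (by linarith) (by linarith)).le
  · have := abs_halfLineConv_le (show 0 < 2 * α - 1 by linarith) (show 0 < α by linarith) hC0 hC hC'
      ht
    rwa [show 2 * α - 1 + α - 1 = 3 * α - 1 - 1 by ring] at this

/-- Picard iterates of `ψ = h - N(P ψ) * f`. -/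
noncomputable def picardIterate (α γ : ℝ) (N P : (ℝ → ℝ) → ℝ → ℝ) (h : ℝ → ℝ) : ℕ → ℝ → ℝ
  | 0 => h
  | k + 1 => fun t => h t
      - halfLineConv (N (P (picardIterate α γ N P h k))) (mittagLefflerDensity α γ) t

/-- Since P sends every measurable function into a fixed ball on each (0, T] and is nonexpansive, N
∘ P is Lipschitz there without any a priori bound. The Picard iterates live on the whole half line
and converge geometrically on every (0, T], so no local solutions are glued. -/
theorem SingularLipschitz.exists_solution (hN : SingularLipschitz α N) (hα : 1 / 2 < α)
    (hα1 : α < 1) (hγ : 0 < γ) {P : (ℝ → ℝ) → ℝ → ℝ} {h : ℝ → ℝ} {M : ℝ → ℝ}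
    (hM : ∀ T, 0 < T → 0 ≤ M T)
    (hP : ∀ T, 0 < T → ∀ ψ, AEStronglyMeasurable ψ (volume.restrict (Ioc 0 T)) →
      WeightedBound α (M T) T (P ψ))
    (hPL : ∀ ψ₁ ψ₂ : ℝ → ℝ, ∀ s, |P ψ₁ s - P ψ₂ s| ≤ |ψ₁ s - ψ₂ s|)
    (hh : ∀ T, 0 < T → AEStronglyMeasurable h (volume.restrict (Ioc 0 T))) :
    ∃ ψ : ℝ → ℝ, (∀ T, 0 < T → AEStronglyMeasurable ψ (volume.restrict (Ioc 0 T))) ∧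
      ∀ t, 0 < t → ψ t = h t - halfLineConv (N (P ψ)) (mittagLefflerDensity α γ) t := by
  have hα0 : 0 < α := by linarith
  set u := picardIterate α γ N P h with hu
  have hum : ∀ k T, 0 < T → AEStronglyMeasurable (u k) (volume.restrict (Ioc 0 T)) := by
    intro k
    induction k with
    | zero => exact hh
    | succ k ih =>
      intro T hT
      exact (hh T hT).sub (((hN.powBound hT (hP T hT _ (ih T hT))).conv
        (powBound_mittagLefflerDensity hα0 hα1 hγ T) (by linarith) hα0).1)
  have hcauchy : ∀ T, 0 < T → ∃ Λ D : ℝ, 0 ≤ D ∧ (∀ ψ₁ ψ₂ : ℝ → ℝ, WeightedBound α (M T) T ψ₁ →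
      WeightedBound α (M T) T ψ₂ → ∀ D : ℝ, 0 ≤ D →
      (∀ s ∈ Ioc 0 T, |ψ₁ s - ψ₂ s| ≤ D * Real.exp (Λ * s) * s ^ (α - 1)) →
      ∀ t ∈ Ioc 0 T, |halfLineConv (N ψ₁) (mittagLefflerDensity α γ) t
        - halfLineConv (N ψ₂) (mittagLefflerDensity α γ) t|
          ≤ D / 2 * Real.exp (Λ * t) * t ^ (α - 1)) ∧
      ∀ k : ℕ, ∀ t ∈ Ioc 0 T,
        |u k t - u (k + 1) t| ≤ D * (1 / 2) ^ k * Real.exp (Λ * t) * t ^ (α - 1) := by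
    intro T hT
    obtain ⟨Λ, hΛ, hcontr⟩ := hN.exists_contraction hα hα1 hγ hT (hM T hT)
    obtain ⟨D, hD0, hD⟩ := hN.exists_conv_bound hα hα1 hγ hT (hP T hT h (hh T hT))
    refine ⟨Λ, D * T ^ (2 * α - 1), mul_nonneg hD0 (Real.rpow_nonneg hT.le _), hcontr,
      fun k => ?_⟩
    induction k with
    | zero =>
      intro t ht
      have h1 : u 0 t - u (0 + 1) t
          = halfLineConv (N (P h)) (mittagLefflerDensity α γ) t := by
        simp [hu, picardIterate]
      rw [h1, pow_zero, mul_one]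
      refine (hD t ht).trans ?_
      rw [show 3 * α - 1 - 1 = (2 * α - 1) + (α - 1) by ring, Real.rpow_add ht.1, ← mul_assoc]
      refine mul_le_mul_of_nonneg_right ?_ (Real.rpow_nonneg ht.1.le _)
      have h2 : D * t ^ (2 * α - 1) ≤ D * T ^ (2 * α - 1) :=
        mul_le_mul_of_nonneg_left (Real.rpow_le_rpow ht.1.le ht.2 (by linarith)) hD0
      exact h2.trans (le_mul_of_one_le_right (mul_nonneg hD0 (Real.rpow_nonneg hT.le _))
        (Real.one_le_exp (mul_nonneg hΛ.le ht.1.le)))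
    | succ k ih =>
      intro t ht
      have h1 := hcontr (P (u k)) (P (u (k + 1))) (hP T hT _ (hum k T hT))
        (hP T hT _ (hum (k + 1) T hT)) (D * T ^ (2 * α - 1) * (1 / 2) ^ k)
        (mul_nonneg (mul_nonneg hD0 (Real.rpow_nonneg hT.le _)) (by positivity))
        (fun s hs => (hPL _ _ s).trans (ih s hs)) t ht
      have h2 : u (k + 1) t - u (k + 1 + 1) t
          = -(halfLineConv (N (P (u k))) (mittagLefflerDensity α γ) t
            - halfLineConv (N (P (u (k + 1)))) (mittagLefflerDensity α γ) t) := by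
        simp only [hu, picardIterate]; ring
      rw [h2, abs_neg, pow_succ]
      refine h1.trans (le_of_eq ?_)
      ring
  have hconv : ∀ t, ∃ l, 0 < t → Tendsto (fun k => u k t) atTop (𝓝 l) := by
    intro t
    by_cases ht : 0 < t
    · obtain ⟨Λ, D, hD, -, hc⟩ := hcauchy t ht
      have : CauchySeq fun k => u k t := by
        refine cauchySeq_of_le_geometric (1 / 2) (D * Real.exp (Λ * t) * t ^ (α - 1))
          (by norm_num) fun k => ?_
        rw [Real.dist_eq]
        refine (hc k t ⟨ht, le_rfl⟩).trans (le_of_eq ?_)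
        ring
      obtain ⟨l, hl⟩ := cauchySeq_tendsto_of_complete this
      exact ⟨l, fun _ => hl⟩
    · exact ⟨0, fun h => absurd h ht⟩
  choose ψ hψ using hconv
  have hψm : ∀ T, 0 < T → AEStronglyMeasurable ψ (volume.restrict (Ioc 0 T)) := fun T hT =>
    aestronglyMeasurable_of_tendsto_ae atTop (fun k => hum k T hT)
      ((ae_restrict_iff' measurableSet_Ioc).2 (.of_forall fun t ht => hψ t ht.1))
  refine ⟨ψ, hψm, fun t ht => ?_⟩
  obtain ⟨Λ, D, hD, hcontr, hc⟩ := hcauchy t ht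
  have hrate : ∀ k : ℕ, ∀ s ∈ Ioc 0 t,
      |u k s - ψ s| ≤ 2 * D * (1 / 2) ^ k * Real.exp (Λ * s) * s ^ (α - 1) := by
    intro k s hs
    have h1 := dist_le_of_le_geometric_of_tendsto (1 / 2) (D * Real.exp (Λ * s) * s ^ (α - 1))
      (by norm_num) (fun n => by
        rw [Real.dist_eq]
        exact (hc n s hs).trans (le_of_eq (by ring))) (hψ s hs.1) k
    rw [Real.dist_eq] at h1
    refine h1.trans (le_of_eq ?_)
    ring
  have hlim : Tendsto (fun k => halfLineConv (N (P (u k))) (mittagLefflerDensity α γ) t) atTop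
      (𝓝 (halfLineConv (N (P ψ)) (mittagLefflerDensity α γ) t)) := by
    rw [tendsto_iff_dist_tendsto_zero]
    have h0 : Tendsto (fun k : ℕ => 2 * D * (1 / 2 : ℝ) ^ k / 2 * Real.exp (Λ * t) * t ^ (α - 1))
        atTop (𝓝 0) := by
      have h1 := (tendsto_pow_atTop_nhds_zero_of_lt_one (r := (1 / 2 : ℝ)) (by norm_num)
        (by norm_num)).const_mul (2 * D)
      simpa using ((h1.div_const 2).mul_const (Real.exp (Λ * t))).mul_const (t ^ (α - 1))
    refine squeeze_zero (fun _ => dist_nonneg) (fun k => ?_) h0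
    rw [Real.dist_eq]
    exact hcontr _ _ (hP t ht _ (hum k t ht)) (hP t ht _ (hψm t ht)) _ (by positivity)
      (fun s hs => (hPL _ _ s).trans (hrate k s hs)) t ⟨ht, le_rfl⟩
  exact tendsto_nhds_unique ((tendsto_add_atTop_iff_nat 1).2 (hψ t ht)) (hlim.const_sub (h t))

end VolterraFixedPoint

section Comparison
open Filter Topology

/-! ### Comparison of the jump operator with the fractional derivative -/

variable {α γ c Z M t : ℝ} {u v : ℝ → ℝ}

lemma sFinite_nuStar (α c : ℝ) : SFinite (nuStar α c) := by
  unfold nuStar; infer_instance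

lemma nuStar_Ioi (hα : 0 < α) (hc : 0 ≤ c) {a : ℝ} (ha : 0 < a) :
    nuStar α c (Ioi a) = ENNReal.ofReal (c / (α + 1) * a ^ (-α - 1)) := by
  rw [nuStar, withDensity_apply _ measurableSet_Ioi, Measure.restrict_restrict measurableSet_Ioi,
    inter_eq_self_of_subset_left (Ioi_subset_Ioi ha.le),
    ← ofReal_integral_eq_lintegral_ofReal]
  · congr 1
    rw [integral_const_mul, integral_Ioi_rpow_of_lt (by linarith) ha,
      show -α - 2 + 1 = -α - 1 by ring, show -α - 1 = -(α + 1) by ring, neg_div_neg_eq]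
    ring
  · exact (integrableOn_Ioi_rpow_of_lt (by linarith) ha).const_mul c
  · refine (ae_restrict_iff' measurableSet_Ioi).2 (.of_forall fun y hy => ?_)
    exact mul_nonneg hc (Real.rpow_nonneg (ha.trans hy).le _)

/-- Monotone convergence along the cut-offs 1/(n+1) ↓ 0. -/
lemma lintegral_mul_levyDensity_le {x V : ℝ} (hα : 0 < α) (hα1 : α < 1) (hγ : 0 < γ)
    (ht : 0 < t) (hx : 0 < x) (hum : PowBound x t u) (hu : ∀ s ∈ Ioo 0 t, 0 ≤ u s)
    (hV : ∀ ε, 0 < ε → halfLineConv u (cutLevyDensity α γ ε) t ≤ V) :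
    ∫⁻ s in Ioo 0 t, ENNReal.ofReal (u s * levyDensity α γ (t - s)) ≤ ENNReal.ofReal V := by
  have hε : ∀ n : ℕ, (0 : ℝ) < 1 / (n + 1) := fun n => Nat.one_div_pos_of_nat
  have hlim := lintegral_tendsto_of_tendsto_of_monotone (μ := volume.restrict (Ioo 0 t))
    (f := fun (n : ℕ) s => ENNReal.ofReal (u s * cutLevyDensity α γ (1 / ((n : ℝ) + 1)) (t - s)))
    (F := fun s => ENNReal.ofReal (u s * levyDensity α γ (t - s)))
    (fun n => (hum.aestronglyMeasurable_conv (powBound_cutLevyDensity hα hα1 hγ (hε n) t)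
      le_rfl).aemeasurable.ennreal_ofReal)
    ?_ ?_
  · refine le_of_tendsto' hlim fun n => ?_
    have hi := hum.intervalIntegrable_conv (powBound_cutLevyDensity hα hα1 hγ (hε n) t) hx one_pos
      ⟨ht, le_rfl⟩
    rw [← ofReal_integral_eq_lintegral_ofReal
      ((intervalIntegrable_iff_integrableOn_Ioo_of_le ht.le).1 hi)]
    · refine ENNReal.ofReal_le_ofReal ?_
      have := hV _ (hε n)
      rwa [halfLineConv, intervalIntegral.integral_of_le ht.le,
        integral_Ioc_eq_integral_Ioo] at this
    · exact (ae_restrict_iff' measurableSet_Ioo).2 (.of_forall fun s hs =>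
        mul_nonneg (hu s hs) (cutLevyDensity_nonneg hα hα1 hγ (hε n) _))
  · refine (ae_restrict_iff' measurableSet_Ioo).2 (.of_forall fun s hs m n hmn => ?_)
    refine ENNReal.ofReal_le_ofReal (mul_le_mul_of_nonneg_left ?_ (hu s hs))
    have hle : (1 : ℝ) / (n + 1) ≤ 1 / (m + 1) := Nat.one_div_le_one_div hmn
    by_cases h : t - s ∈ Ici ((1 : ℝ) / (m + 1))
    · rw [cutLevyDensity, cutLevyDensity, indicator_of_mem h,
        indicator_of_mem (Ici_subset_Ici.2 hle h)]
    · rw [cutLevyDensity, indicator_of_notMem h]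
      exact cutLevyDensity_nonneg hα hα1 hγ (hε n) _
  · refine (ae_restrict_iff' measurableSet_Ioo).2 (.of_forall fun s hs => ?_)
    refine tendsto_const_nhds.congr' ?_
    have h0 : (0 : ℝ) < t - s := by linarith [hs.2]
    filter_upwards [(tendsto_one_div_add_atTop_nhds_zero_nat (𝕜 := ℝ)).eventually
      (gt_mem_nhds h0)] with n hn
    rw [cutLevyDensity, indicator_of_mem (mem_Ici.2 hn.le)]

lemma ofReal_windowIntegral (hα : 0 < α) (hv : WeightedBound α M t v) (hZ : 0 ≤ Z)
    (ht : 0 < t) (hv0 : ∀ s ∈ Ioc 0 t, 0 ≤ v s) {y : ℝ} (hy : 0 ≤ y) :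
    ENNReal.ofReal (windowIntegral Z v t y)
      = ∫⁻ s in Ioo 0 t, indicator {p : ℝ × ℝ | t - p.2 < p.1}
        (fun p => ENNReal.ofReal (Z * v p.2)) (y, s) := by
  have h1 : max (t - y) 0 ≤ t := max_le (by linarith) ht.le
  have hi := (hv.intervalIntegrable hα (le_max_right _ _) h1 le_rfl).const_mul Z
  rw [intervalIntegrable_iff_integrableOn_Ioo_of_le h1] at hi
  rw [windowIntegral, intervalIntegral.integral_of_le h1, integral_Ioc_eq_integral_Ioo,
    ofReal_integral_eq_lintegral_ofReal hi, ← lintegral_indicator measurableSet_Ioo,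
    ← lintegral_indicator measurableSet_Ioo]
  · congr 1; ext s
    simp only [indicator_apply, mem_Ioo, mem_ofPred_eq, max_lt_iff]
    by_cases h2 : s < t <;> by_cases h3 : 0 < s <;> by_cases h4 : t - y < s
    all_goals simp [h2, h3, h4, show t - s < y ↔ t - y < s from sub_lt_comm]
  · refine (ae_restrict_iff' measurableSet_Ioo).2 (.of_forall fun s hs => ?_)
    exact mul_nonneg hZ (hv0 s ⟨(le_max_right _ _).trans_lt hs.1, hs.2.le⟩)

/-- By Tonelli the left side is ∫ Z v(s) ν_*((t-s, ∞)) ds, and the compatibility condition bounds Z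
ν_*((t-s, ∞)) by -L_K'(t-s). Extended nonnegative integrals are used because finiteness of either
side is not known beforehand. -/
lemma lintegral_windowIntegral_le (hα : 0 < α) (hα1 : α < 1) (hγ : 0 < γ) (hc : 0 ≤ c)
    (hZ : 0 ≤ Z) (hcompat : Z * (c / (α + 1)) ≤ α / (γ * Real.Gamma (1 - α)))
    (hv : WeightedBound α M t v) (ht : 0 < t) (hv0 : ∀ s ∈ Ioc 0 t, 0 ≤ v s)
    (hvu : ∀ s ∈ Ioo 0 t, v s ≤ u s) :
    ∫⁻ y, ENNReal.ofReal (windowIntegral Z v t y) ∂(nuStar α c)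
      ≤ ∫⁻ s in Ioo 0 t, ENNReal.ofReal (u s * levyDensity α γ (t - s)) := by
  have := sFinite_nuStar α c
  have hmeas : MeasurableSet {p : ℝ × ℝ | t - p.2 < p.1} :=
    measurableSet_lt (by fun_prop) (by fun_prop)
  have hvm : AEMeasurable (fun s => ENNReal.ofReal (Z * v s)) (volume.restrict (Ioo 0 t)) := by
    rw [restrict_Ioo_eq_restrict_Ioc]
    exact (hv.meas.aemeasurable.const_mul Z).ennreal_ofReal
  calc ∫⁻ y, ENNReal.ofReal (windowIntegral Z v t y) ∂(nuStar α c)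
      = ∫⁻ y, (∫⁻ s in Ioo 0 t, indicator {p : ℝ × ℝ | t - p.2 < p.1}
        (fun p => ENNReal.ofReal (Z * v p.2)) (y, s)) ∂(nuStar α c) := by
        refine lintegral_congr_ae ?_
        filter_upwards [ae_nuStar_pos α c] with y hy
        exact ofReal_windowIntegral hα hv hZ ht hv0 hy.le
    _ = ∫⁻ s in Ioo 0 t, ∫⁻ y, indicator {p : ℝ × ℝ | t - p.2 < p.1}
        (fun p => ENNReal.ofReal (Z * v p.2)) (y, s) ∂(nuStar α c) :=
        lintegral_lintegral_swap (f := fun y s => indicator {p : ℝ × ℝ | t - p.2 < p.1}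
          (fun p => ENNReal.ofReal (Z * v p.2)) (y, s)) (hvm.comp_snd.indicator hmeas)
    _ ≤ _ := by
        refine setLIntegral_mono_ae' measurableSet_Ioo (.of_forall fun s hs => ?_)
        have hts : 0 < t - s := by linarith [hs.2]
        have h1 : (fun y => indicator {p : ℝ × ℝ | t - p.2 < p.1}
            (fun p => ENNReal.ofReal (Z * v p.2)) (y, s))
            = indicator (Ioi (t - s)) (fun _ => ENNReal.ofReal (Z * v s)) := by
          ext y
          simp only [indicator_apply, mem_ofPred_eq, mem_Ioi]
        have hv0s := hv0 s ⟨hs.1, hs.2.le⟩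
        rw [h1, lintegral_indicator_const measurableSet_Ioi, nuStar_Ioi hα hc hts,
          ← ENNReal.ofReal_mul (mul_nonneg hZ hv0s)]
        refine ENNReal.ofReal_le_ofReal ?_
        have hr := Real.rpow_nonneg hts.le (-α - 1)
        calc Z * v s * (c / (α + 1) * (t - s) ^ (-α - 1))
            = (Z * (c / (α + 1))) * (t - s) ^ (-α - 1) * v s := by ring
          _ ≤ α / (γ * Real.Gamma (1 - α)) * (t - s) ^ (-α - 1) * v s :=
            mul_le_mul_of_nonneg_right (mul_le_mul_of_nonneg_right hcompat hr) hv0s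
          _ = levyDensity α γ (t - s) * v s := by rw [levyDensity]; ring
          _ ≤ levyDensity α γ (t - s) * u s :=
            mul_le_mul_of_nonneg_left (hvu s hs) (levyDensity_nonneg hα hα1 hγ hts.le)
          _ = _ := mul_comm _ _

lemma windowIntegral_nonneg (hZ : 0 ≤ Z) (ht : 0 ≤ t) (hv0 : ∀ s ∈ Ioc 0 t, 0 ≤ v s) {y : ℝ}
    (hy : 0 ≤ y) : 0 ≤ windowIntegral Z v t y := by
  have h1 : max (t - y) 0 ≤ t := max_le (by linarith) ht
  rw [windowIntegral, intervalIntegral.integral_of_le h1]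
  exact setIntegral_nonneg measurableSet_Ioc fun s hs =>
    mul_nonneg hZ (hv0 s ⟨(le_max_right _ _).trans_lt hs.1, hs.2⟩)

/-- Under the compatibility condition, `∫ u(t - y) (-L_K'(y)) dy` exceeds `𝒱 ∘ v (t)` whenever
`0 ≤ v ≤ u` and `u > 0` on `(0, t)`. -/
theorem exists_operatorV_lt {x b ζl : ℝ} (hα : 0 < α) (hα1 : α < 1) (hγ : 0 < γ) (hc : 0 ≤ c)
    (hZ : 0 ≤ ζl / b) (hcompat : ζl / b * (c / (α + 1)) ≤ α / (γ * Real.Gamma (1 - α)))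
    (hx : 0 < x) (hum : PowBound x t u)
    (hv : WeightedBound α M t v) (ht : 0 < t) (hv0 : ∀ s ∈ Ioc 0 t, 0 ≤ v s)
    (hvu : ∀ s ∈ Ioo 0 t, v s ≤ u s) (hu : ∀ s ∈ Ioo 0 t, 0 < u s) :
    ∃ ε, 0 < ε ∧ operatorV α c b ζl v t < halfLineConv u (cutLevyDensity α γ ε) t := by
  by_contra! hV
  have htT : t ∈ Ioc 0 t := ⟨ht, le_rfl⟩
  have hJ := lintegral_mul_levyDensity_le hα hα1 hγ ht hx hum (fun s hs => (hu s hs).le) hV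
  have hX := lintegral_windowIntegral_le hα hα1 hγ hc hZ hcompat hv ht hv0 hvu
  have hVint : ENNReal.ofReal (operatorV α c b ζl v t)
      = ∫⁻ y, ENNReal.ofReal (expRemainder (windowIntegral (ζl / b) v t y)) ∂(nuStar α c) := by
    rw [operatorV_eq]
    exact ofReal_integral_eq_lintegral_ofReal (hv.integrable_expRemainder hα hα1 hc hZ htT)
      (.of_forall fun _ => expRemainder_nonneg _)
  have hwm := hv.aestronglyMeasurable_windowIntegral (c := c) hα htT (ζl / b)
  have hEm : AEMeasurable
      (fun y => ENNReal.ofReal (1 - Real.exp (-windowIntegral (ζl / b) v t y))) (nuStar α c) :=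
    (hwm.aemeasurable.neg.exp.const_sub 1).ennreal_ofReal
  -- With w the window integral, w = (e^{-w} - 1 + w) + (1 - e^{-w}). Hence ∫ w dν_* equals 𝒱∘v(t)
  -- plus a nonnegative term, while the negated claim and the comparison give ∫ w dν_* ≤ 𝒱∘v(t) < ∞.
  -- So 1 - e^{-w} vanishes almost everywhere.
  have hsplit : ∫⁻ y, ENNReal.ofReal (windowIntegral (ζl / b) v t y) ∂(nuStar α c)
      = (∫⁻ y, ENNReal.ofReal (expRemainder (windowIntegral (ζl / b) v t y)) ∂(nuStar α c))
        + ∫⁻ y, ENNReal.ofReal (1 - Real.exp (-windowIntegral (ζl / b) v t y)) ∂(nuStar α c) := by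
    rw [← lintegral_add_right' _ hEm]
    refine lintegral_congr_ae ?_
    filter_upwards [ae_nuStar_pos α c] with y hy
    have h0 := windowIntegral_nonneg hZ ht.le hv0 hy.le
    rw [← ENNReal.ofReal_add (expRemainder_nonneg _)
      (sub_nonneg.2 (Real.exp_le_one_iff.2 (by linarith))), expRemainder]
    congr 1; ring
  rw [hsplit, ← hVint] at hX
  have hE : ∫⁻ y, ENNReal.ofReal (1 - Real.exp (-windowIntegral (ζl / b) v t y)) ∂(nuStar α c)
      = 0 := by
    have h := hX.trans hJ
    by_contra hne
    exact absurd h (not_le.2 (ENNReal.lt_add_right ENNReal.ofReal_ne_top hne))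
  rw [lintegral_eq_zero_iff' hEm] at hE
  -- Equality forces the window to vanish ν_*-almost everywhere, and then 𝒱∘v(t) = 0, against the
  -- strict positivity of the cut-off integral of u.
  have hzero : operatorV α c b ζl v t = 0 := by
    rw [operatorV_eq]
    refine integral_eq_zero_of_ae ?_
    filter_upwards [hE, ae_nuStar_pos α c] with y hy hy0
    have h0 := windowIntegral_nonneg hZ ht.le hv0 hy0.le
    have h1 : 1 - Real.exp (-windowIntegral (ζl / b) v t y) ≤ 0 := by simpa using hy
    have h2 : -windowIntegral (ζl / b) v t y ≥ 0 := by
      rw [ge_iff_le, ← Real.one_le_exp_iff]; linarith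
    have h3 : windowIntegral (ζl / b) v t y = 0 := by linarith
    simp only [h3, expRemainder_zero, Pi.zero_apply]
  have h1 := hV (t / 2) (by linarith)
  have h2 := halfLineConv_cutLevyDensity_pos hα hα1 hγ (by linarith) (by linarith : t / 2 < t) hx
    hum hu
  linarith

end Comparison

section Riccati
open Filter Topology

/-! ### The generalized Volterra-Riccati equation -/

/-- The nonlinearity `½ (ζm √λm / b)² |ψ|² + 𝒱 ∘ ψ`. -/
noncomputable def riccatiNonlinearity (α c b ζm lamm ζl : ℝ) (ψ : ℝ → ℝ) (s : ℝ) : ℝ :=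
  1 / 2 * (ζm * √lamm / b) ^ 2 * |ψ s| ^ 2 + operatorV α c b ζl ψ s

/-- The forcing term `λ f^{α,γ} + g * f^{α,γ}`. -/
noncomputable def forcingTerm (α γ lam : ℝ) (g : ℝ → ℝ) (t : ℝ) : ℝ :=
  lam * mittagLefflerDensity α γ t + halfLineConv g (mittagLefflerDensity α γ) t

/-- The truncation of `ψ` to the interval `[0, U]`. -/
noncomputable def truncateTo (U ψ : ℝ → ℝ) (s : ℝ) : ℝ := max 0 (min (ψ s) (U s))

/-- The barrier `A t^{α-1} + B t^α`. -/
noncomputable def powerBarrier (α A B t : ℝ) : ℝ := A * t ^ (α - 1) + B * t ^ α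

variable {α γ b ζm lamm ζl c lam M T : ℝ} {g ψ : ℝ → ℝ}

lemma riccatiNonlinearity_nonneg (s : ℝ) : 0 ≤ riccatiNonlinearity α c b ζm lamm ζl ψ s := by
  have := operatorV_nonneg α c b ζl ψ s
  unfold riccatiNonlinearity
  positivity

lemma rpow_sub_one_sq {s : ℝ} (hs : 0 < s) :
    (s ^ (α - 1)) ^ 2 = s ^ (2 * α - 1 - 1) := by
  rw [← Real.rpow_natCast, ← Real.rpow_mul hs.le]
  congr 1; push_cast; ring

lemma WeightedBound.powBound_sq (h : WeightedBound α M T ψ) :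
    PowBound (2 * α - 1) T (fun s => |ψ s| ^ 2) := by
  refine .of_forall (C := M ^ 2) (h.meas.norm.pow 2) fun s hs => ?_
  rw [abs_pow, abs_abs, ← rpow_sub_one_sq hs.1, ← mul_pow]
  exact pow_le_pow_left₀ (abs_nonneg _) (h.bound s hs) 2

lemma operatorV_zero (t : ℝ) : operatorV α c b ζl (fun _ => 0) t = 0 := by
  simp [operatorV]

lemma WeightedBound.powBound_operatorV (h : WeightedBound α M T ψ) (hα : 0 < α) (hα1 : α < 1)
    (hc : 0 ≤ c) (hZ : 0 ≤ ζl / b) (hT : 0 < T) : PowBound α T (operatorV α c b ζl ψ) := by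
  have hM := h.nonneg hT
  refine .of_forall (C := jumpLipschitzConst α c (ζl / b) M T * M)
    ((h.continuousOn_operatorV hα hα1 hc hZ).aestronglyMeasurable measurableSet_Ioc)
    fun s hs => ?_
  have := h.abs_operatorV_sub_le (.zero hM) (c := c) (b := b) (ζl := ζl) hα hα1 hc hZ hs hM
    (fun r hr => by simpa using h.bound r ⟨hr.1, hr.2.trans hs.2⟩)
  rwa [operatorV_zero, sub_zero] at this

lemma WeightedBound.powBound_riccatiNonlinearity (h : WeightedBound α M T ψ) (hα : 0 < α)
    (hα1 : α < 1) (hc : 0 ≤ c) (hZ : 0 ≤ ζl / b) (hT : 0 < T) :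
    PowBound (2 * α - 1) T (riccatiNonlinearity α c b ζm lamm ζl ψ) :=
  (h.powBound_sq.const_mul _).add
    ((h.powBound_operatorV hα hα1 hc hZ hT).mono_exponent (by linarith))

/-- The square contributes (ψ₁ + ψ₂)(ψ₁ - ψ₂), of order t^{2α-2}; the milder t^{α-1} from 𝒱 is
absorbed at the cost of T^{1-α}. -/
theorem singularLipschitz_riccatiNonlinearity (hα : 0 < α) (hα1 : α < 1) (hc : 0 ≤ c)
    (hZ : 0 ≤ ζl / b) : SingularLipschitz α (riccatiNonlinearity α c b ζm lamm ζl) := by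
  refine ⟨fun hT h => h.powBound_riccatiNonlinearity hα hα1 hc hZ hT, fun {M T} hT hM => ?_⟩
  have hL := jumpLipschitzConst_nonneg (T := T) hα hα1 hc hZ hM
  refine ⟨1 / 2 * (ζm * √lamm / b) ^ 2 * (2 * M)
    + jumpLipschitzConst α c (ζl / b) M T * T ^ (1 - α), by positivity,
    fun {ψ₁ ψ₂} h₁ h₂ {t D} ht hD hd => ?_⟩
  have e1 : |(|ψ₁ t| ^ 2 - |ψ₂ t| ^ 2)| ≤ 2 * M * D * t ^ (2 * α - 1 - 1) := by
    have h3 := hd t ⟨ht.1, le_rfl⟩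
    have h4 : |ψ₁ t + ψ₂ t| ≤ 2 * M * t ^ (α - 1) := by
      refine (abs_add_le _ _).trans ?_
      linarith [h₁.bound t ht, h₂.bound t ht]
    rw [sq_abs, sq_abs, sq_sub_sq, abs_mul, ← rpow_sub_one_sq ht.1]
    calc _ ≤ (2 * M * t ^ (α - 1)) * (D * t ^ (α - 1)) :=
          mul_le_mul h4 h3 (abs_nonneg _) ((abs_nonneg _).trans h4)
      _ = _ := by ring
  have e2 := h₁.abs_operatorV_sub_le h₂ (c := c) (b := b) (ζl := ζl) hα hα1 hc hZ ht hD hd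
  have e3 : t ^ (α - 1) ≤ T ^ (1 - α) * t ^ (2 * α - 1 - 1) := by
    rw [show α - 1 = (1 - α) + (2 * α - 1 - 1) by ring, Real.rpow_add ht.1]
    exact mul_le_mul_of_nonneg_right (Real.rpow_le_rpow ht.1.le ht.2 (by linarith))
      (Real.rpow_nonneg ht.1.le _)
  have e4 : |riccatiNonlinearity α c b ζm lamm ζl ψ₁ t
      - riccatiNonlinearity α c b ζm lamm ζl ψ₂ t|
      ≤ 1 / 2 * (ζm * √lamm / b) ^ 2 * |(|ψ₁ t| ^ 2 - |ψ₂ t| ^ 2)|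
        + |operatorV α c b ζl ψ₁ t - operatorV α c b ζl ψ₂ t| := by
    rw [riccatiNonlinearity, riccatiNonlinearity,
      show ∀ q a₁ a₂ v₁ v₂ : ℝ, q * a₁ + v₁ - (q * a₂ + v₂) = q * (a₁ - a₂) + (v₁ - v₂) by
        intros; ring]
    refine (abs_add_le _ _).trans (add_le_add_left (le_of_eq ?_) _)
    rw [abs_mul, abs_of_nonneg (by positivity)]
  calc _ ≤ _ := e4
    _ ≤ 1 / 2 * (ζm * √lamm / b) ^ 2 * (2 * M * D * t ^ (2 * α - 1 - 1))
        + jumpLipschitzConst α c (ζl / b) M T * D * (T ^ (1 - α) * t ^ (2 * α - 1 - 1)) :=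
        add_le_add (mul_le_mul_of_nonneg_left e1 (by positivity))
          (e2.trans (mul_le_mul_of_nonneg_left e3 (by positivity)))
    _ = _ := by ring

lemma riccatiRHS_eq (hα : 1 / 2 < α) (hα1 : α < 1) (hγ : 0 < γ) (hc : 0 ≤ c)
    (hZ : 0 ≤ ζl / b) (h : WeightedBound α M T ψ) {t : ℝ} (ht : t ∈ Ioc 0 T) :
    riccatiRHS α γ b ζm lamm ζl c lam g ψ t = forcingTerm α γ lam g t
      - halfLineConv (riccatiNonlinearity α c b ζm lamm ζl ψ) (mittagLefflerDensity α γ) t := by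
  have hα0 : 0 < α := by linarith
  have hV := (h.powBound_operatorV (c := c) (b := b) (ζl := ζl) hα0 hα1 hc hZ
    (ht.1.trans_le ht.2)).mono_exponent (y := 2 * α - 1) (by linarith)
  have hadd := halfLineConv_add_left (h.powBound_sq.const_mul (1 / 2 * (ζm * √lamm / b) ^ 2)) hV
    (powBound_mittagLefflerDensity (γ := γ) hα0 hα1 hγ T) (by linarith) hα0 ht
  rw [halfLineConv_const_mul_left] at hadd
  unfold riccatiNonlinearity
  rw [hadd, riccatiRHS, forcingTerm]
  ring

/-! #### The forcing term -/

lemma exists_powBound_of_memLp (hg : MemLp g ⊤ (volume.restrict (Ioi (0 : ℝ)))) :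
    ∃ B : ℝ, 0 ≤ B ∧ ∀ T : ℝ, AEStronglyMeasurable g (volume.restrict (Ioc 0 T)) ∧
      ∀ᵐ s ∂(volume.restrict (Ioc 0 T)), |g s| ≤ B * s ^ ((1 : ℝ) - 1) := by
  have hne : eLpNormEssSup g (volume.restrict (Ioi (0 : ℝ))) ≠ ⊤ := by
    rw [← eLpNorm_exponent_top]; exact hg.2.ne
  refine ⟨(eLpNormEssSup g (volume.restrict (Ioi (0 : ℝ)))).toReal, ENNReal.toReal_nonneg,
    fun T => ?_⟩
  have hle : volume.restrict (Ioc 0 T) ≤ volume.restrict (Ioi (0 : ℝ)) :=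
    Measure.restrict_mono Ioc_subset_Ioi_self le_rfl
  refine ⟨hg.1.mono_measure hle, ae_mono hle ?_⟩
  filter_upwards [ae_le_eLpNormEssSup (f := g) (μ := volume.restrict (Ioi (0 : ℝ)))] with s hs
  have h := ENNReal.toReal_mono hne hs
  simpa using h

lemma halfLineConv_nonneg_of_ae (hα : 0 < α) (hα1 : α < 1) (hγ : 0 < γ) {t : ℝ} (ht : 0 < t)
    (hg0 : ∀ᵐ s ∂(volume.restrict (Ioc 0 t)), 0 ≤ g s) :
    0 ≤ halfLineConv g (mittagLefflerDensity α γ) t := by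
  rw [halfLineConv, intervalIntegral.integral_of_le ht.le, integral_Ioc_eq_integral_Ioo]
  refine integral_nonneg_of_ae ?_
  rw [← restrict_Ioo_eq_restrict_Ioc] at hg0
  filter_upwards [hg0, ae_restrict_mem measurableSet_Ioo] with s hs1 hs2
  exact mul_nonneg hs1 (mittagLefflerDensity_pos hα hα1 hγ (by linarith [hs2.2])).le

/-- From f ≤ γK at all times and the essential bound on g. The constant B depends neither on time
nor on λ, so one barrier serves the whole half line and all perturbations of λ. -/
lemma exists_forcingTerm_le (hα : 0 < α) (hα1 : α < 1) (hγ : 0 < γ)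
    (hg : MemLp g ⊤ (volume.restrict (Ioi (0 : ℝ)))) :
    ∃ B : ℝ, 0 ≤ B ∧ ∀ lam, 0 ≤ lam → ∀ t, 0 < t →
      |forcingTerm α γ lam g t| ≤ powerBarrier α (lam * (γ / Real.Gamma α)) B t := by
  obtain ⟨B, hB0, hB⟩ := exists_powBound_of_memLp hg
  have hA0 : 0 < γ / Real.Gamma α := div_pos hγ (Real.Gamma_pos_of_pos hα)
  refine ⟨B * (γ / Real.Gamma α) * ProbabilityTheory.beta 1 α,
    mul_nonneg (mul_nonneg hB0 hA0.le) (ProbabilityTheory.beta_pos one_pos hα).le,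
    fun lam hlam t ht => ?_⟩
  have hf : ∀ s ∈ Ioc 0 t, |mittagLefflerDensity α γ s| ≤ γ / Real.Gamma α * s ^ (α - 1) :=
    fun s hs => by
      rw [abs_of_pos (mittagLefflerDensity_pos hα hα1 hγ hs.1)]
      exact mittagLefflerDensity_le hα hα1 hγ hs.1
  have h1 := abs_halfLineConv_le one_pos hα hB0 (hB t).2
    ((ae_restrict_iff' measurableSet_Ioc).2 (.of_forall hf)) (t := t) ⟨ht, le_rfl⟩
  rw [show 1 + α - 1 = α by ring] at h1
  rw [forcingTerm, powerBarrier]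
  refine (abs_add_le _ _).trans (add_le_add ?_ h1)
  rw [abs_mul, abs_of_nonneg hlam, mul_assoc]
  exact mul_le_mul_of_nonneg_left (hf t ⟨ht, le_rfl⟩) hlam

lemma powerBarrier_le {A B : ℝ} (hB : 0 ≤ B) {t : ℝ} (ht : t ∈ Ioc 0 T) :
    powerBarrier α A B t ≤ (A + B * T) * t ^ (α - 1) := by
  have h1 : t ^ α = t * t ^ (α - 1) := by
    rw [mul_comm, ← Real.rpow_add_one ht.1.ne', sub_add_cancel]
  rw [powerBarrier, h1, add_mul, mul_assoc B]
  exact add_le_add_right (mul_le_mul_of_nonneg_left (mul_le_mul_of_nonneg_right ht.2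
    (Real.rpow_nonneg ht.1.le _)) hB) _

lemma continuousOn_powerBarrier (α A B : ℝ) : ContinuousOn (powerBarrier α A B) (Ioi 0) := by
  have h1 : ∀ p : ℝ, ContinuousOn (fun t : ℝ => t ^ p) (Ioi 0) := fun p =>
    continuousOn_id.rpow_const fun t ht => Or.inl (ne_of_gt ht)
  exact ((h1 _).const_mul A).add ((h1 _).const_mul B)

lemma powerBarrier_nonneg {A B t : ℝ} (hA : 0 ≤ A) (hB : 0 ≤ B) (ht : 0 ≤ t) :
    0 ≤ powerBarrier α A B t :=
  add_nonneg (mul_nonneg hA (Real.rpow_nonneg ht _)) (mul_nonneg hB (Real.rpow_nonneg ht _))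

lemma PowBound.continuousOn_conv_mittagLefflerDensity {x : ℝ} {G : ℝ → ℝ} (hα : 0 < α)
    (hα1 : α < 1) (hγ : 0 < γ) (hx : 0 < x) (hG : ∀ T, 0 < T → PowBound x T G) :
    ContinuousOn (halfLineConv G (mittagLefflerDensity α γ)) (Ioi 0) := by
  intro t ht
  have ht0 : 0 < t := ht
  have h := continuousOn_halfLineConv (T := t + 1) (hG (t + 1) (by linarith)) hx hα hα1.le
    ((continuousOn_mittagLefflerDensity hα hα1).mono Ioc_subset_Ioi_self)
    fun r hr => abs_mittagLefflerDensity_le hα hα1 hγ hr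
  exact (h.continuousAt (Ioc_mem_nhds ht0 (by linarith))).continuousWithinAt

lemma continuousOn_forcingTerm (hα : 0 < α) (hα1 : α < 1) (hγ : 0 < γ)
    (hg : MemLp g ⊤ (volume.restrict (Ioi (0 : ℝ)))) :
    ContinuousOn (forcingTerm α γ lam g) (Ioi 0) := by
  obtain ⟨B, -, hB⟩ := exists_powBound_of_memLp hg
  exact ((continuousOn_mittagLefflerDensity hα hα1).const_mul lam).add
    (PowBound.continuousOn_conv_mittagLefflerDensity hα hα1 hγ one_pos
      fun T _ => ⟨(hB T).1, B, (hB T).2⟩)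

/-! #### Truncation -/

lemma abs_truncateTo_sub_le (U ψ₁ ψ₂ : ℝ → ℝ) (s : ℝ) :
    |truncateTo U ψ₁ s - truncateTo U ψ₂ s| ≤ |ψ₁ s - ψ₂ s| := by
  rw [truncateTo, truncateTo]
  refine (abs_max_sub_max_le_max _ _ _ _).trans ?_
  rw [sub_self, abs_zero, max_eq_right (abs_nonneg _)]
  refine (abs_min_sub_min_le_max _ _ _ _).trans ?_
  rw [sub_self, abs_zero, max_eq_left (abs_nonneg _)]

lemma truncateTo_nonneg (U ψ : ℝ → ℝ) (s : ℝ) : 0 ≤ truncateTo U ψ s := le_max_left _ _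

lemma weightedBound_truncateTo {A B : ℝ} (hA : 0 ≤ A) (hB : 0 ≤ B)
    (hψ : AEStronglyMeasurable ψ (volume.restrict (Ioc 0 T))) :
    WeightedBound α (A + B * T) T (truncateTo (powerBarrier α A B) ψ) := by
  constructor
  · have hU : Measurable (powerBarrier α A B) := by unfold powerBarrier; fun_prop
    exact (aemeasurable_const.max (hψ.aemeasurable.min hU.aemeasurable)).aestronglyMeasurable
  · intro s hs
    rw [abs_of_nonneg (truncateTo_nonneg _ _ _)]
    refine le_trans (max_le (powerBarrier_nonneg hA hB hs.1.le) (min_le_right _ _))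
      (powerBarrier_le hB hs)

/-! #### Positivity of solutions -/

/-- Convolve the equation with K and use f + γ f * K = γK twice. This moves the equation from the
kernel f to γK, to which the maximum principle applies. -/
lemma resolvent_form {x t : ℝ} {G : ℝ → ℝ} (hα : 0 < α) (hα1 : α < 1) (hγ : 0 < γ) (hx : 0 < x)
    (hxα : x ≤ α) (hG : PowBound x t G) (hψm : PowBound α t ψ)
    (hψ : ∀ s ∈ Ioc 0 t, ψ s = lam * mittagLefflerDensity α γ s
      + halfLineConv G (mittagLefflerDensity α γ) s) :
    ∀ s ∈ Ioc 0 t, ψ s = lam * (γ * fracKernel α s)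
      + γ * halfLineConv (fun r => G r - ψ r) (fracKernel α) s := by
  intro s hs
  have hf := powBound_mittagLefflerDensity (γ := γ) hα hα1 hγ t
  have hK := powBound_fracKernel α t
  have h1 : halfLineConv ψ (fracKernel α) s
      = lam * halfLineConv (mittagLefflerDensity α γ) (fracKernel α) s
        + halfLineConv G (halfLineConv (mittagLefflerDensity α γ) (fracKernel α)) s := by
    rw [halfLineConv_congr hs.1.le (fun r hr => hψ r ⟨hr.1, hr.2.le.trans hs.2⟩) (fun _ _ => rfl),
      halfLineConv_add_left (hf.const_mul lam) ((hG.conv hf hx hα).mono_exponent (by linarith)) hK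
        hα hα hs, halfLineConv_const_mul_left, halfLineConv_assoc hG hf hK hx hα hα hs]
  have h2 : halfLineConv G (mittagLefflerDensity α γ) s
      + γ * halfLineConv G (halfLineConv (mittagLefflerDensity α γ) (fracKernel α)) s
      = γ * halfLineConv G (fracKernel α) s := by
    rw [← halfLineConv_const_mul_right, ← halfLineConv_const_mul_right,
      ← halfLineConv_add_right hf
        (((hf.conv hK hα hα).mono_exponent (by linarith)).const_mul γ) hG hα hx hs]
    exact halfLineConv_congr hs.1.le (fun _ _ => rfl)
      fun r hr => mittagLefflerDensity_add_conv_fracKernel hα hα1 hγ hr.1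
  have h3 := mittagLefflerDensity_add_conv_fracKernel hα hα1 hγ hs.1
  rw [halfLineConv_sub_left hG (hψm.mono_exponent hxα) hK hx hα hs, h1, hψ s hs]
  linear_combination lam * h3 + h2

/-- Solutions of the truncated equation with `λ > 0` are positive. -/
theorem pos_of_truncated_equation {A B : ℝ} (hα : 1 / 2 < α) (hα1 : α < 1) (hγ : 0 < γ)
    (hc : 0 ≤ c) (hZ : 0 ≤ ζl / b)
    (hcompat : ζl / b * (c / (α + 1)) ≤ α / (γ * Real.Gamma (1 - α)))
    (hg : MemLp g ⊤ (volume.restrict (Ioi (0 : ℝ))))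
    (hg0 : ∀ᵐ t ∂(volume.restrict (Ioi (0 : ℝ))), 0 ≤ g t) (hlam : 0 < lam)
    (hA : 0 ≤ A) (hB : 0 ≤ B)
    (hψm : ∀ T, 0 < T → AEStronglyMeasurable ψ (volume.restrict (Ioc 0 T)))
    (hψ : ∀ t, 0 < t → ψ t = forcingTerm α γ lam g t
      - halfLineConv (riccatiNonlinearity α c b ζm lamm ζl (truncateTo (powerBarrier α A B) ψ))
        (mittagLefflerDensity α γ) t) {t : ℝ} (ht : 0 < t) : 0 < ψ t := by
  have hα0 : 0 < α := by linarith
  have hβ : 0 < 2 * α - 1 := by linarith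
  have hN := singularLipschitz_riccatiNonlinearity (ζm := ζm) (lamm := lamm) hα0 hα1 hc hZ
  set v := truncateTo (powerBarrier α A B) ψ with hv
  have hw : ∀ T, 0 < T → WeightedBound α (A + B * T) T v := fun T hT =>
    weightedBound_truncateTo hA hB (hψm T hT)
  have hNP : ∀ T, 0 < T → PowBound (2 * α - 1) T (riccatiNonlinearity α c b ζm lamm ζl v) :=
    fun T hT => hN.powBound hT (hw T hT)
  obtain ⟨Bg, -, hBg⟩ := exists_powBound_of_memLp hg
  have hgP : ∀ T, PowBound 1 T g := fun T => ⟨(hBg T).1, Bg, (hBg T).2⟩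
  have hg0' : ∀ T, ∀ᵐ s ∂(volume.restrict (Ioc 0 T)), 0 ≤ g s := fun T =>
    ae_mono (Measure.restrict_mono Ioc_subset_Ioi_self le_rfl) hg0
  have hcont : ContinuousOn ψ (Ioi 0) :=
    ((continuousOn_forcingTerm hα0 hα1 hγ hg).sub
      (PowBound.continuousOn_conv_mittagLefflerDensity hα0 hα1 hγ hβ hNP)).congr
      fun s hs => hψ s hs
  -- λf is of exact order t^{α-1}, the nonlinear term is O(t^{3α-2}), and 3α - 1 > α since α > 1/2.
  obtain ⟨τ, hτ, hτpos⟩ : ∃ τ > 0, ∀ t ∈ Ioo 0 τ, 0 < ψ t := by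
    obtain ⟨C, hC0, hC⟩ := exists_le_mittagLefflerDensity (γ := γ) hα0 hα1 hγ
    obtain ⟨D, hD0, hD⟩ := hN.exists_conv_bound hα hα1 hγ one_pos (hw 1 one_pos)
    refine exists_pos_near_zero (α := α) (β := 3 * α - 1) (a := lam * (γ / Real.Gamma α))
      (C := lam * C + D) (by linarith)
      (mul_pos hlam (div_pos hγ (Real.Gamma_pos_of_pos hα0))) one_pos fun s hs => ?_
    have h1 := mul_le_mul_of_nonneg_left (hC s hs) hlam.le
    have h2 := (le_abs_self _).trans (hD s hs)
    have h3 := halfLineConv_nonneg_of_ae hα0 hα1 hγ hs.1 (hg0' s)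
    have h4 : s ^ (α + α - 1) ≤ s ^ (3 * α - 1 - 1) :=
      Real.rpow_le_rpow_of_exponent_ge hs.1 hs.2 (by linarith)
    have h5 := mul_le_mul_of_nonneg_left h4 (mul_nonneg hlam.le hC0)
    rw [hψ s hs.1, forcingTerm]
    linarith
  refine pos_of_forall_ne_zero hcont hτ hτpos (fun r hr hpos hzero => ?_) ht
  have hU0 : ∀ s, 0 < s → 0 ≤ powerBarrier α A B s := fun s hs =>
    powerBarrier_nonneg hA hB hs.le
  have hvr : v r = 0 := by
    rw [hv, truncateTo, hzero, min_eq_left (hU0 r hr), max_self]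
  have hψP : PowBound α r ψ := by
    obtain ⟨D, hD0, hD⟩ := hN.exists_conv_bound hα hα1 hγ hr (hw r hr)
    have h1 : PowBound α r (halfLineConv (riccatiNonlinearity α c b ζm lamm ζl v)
        (mittagLefflerDensity α γ)) :=
      ((hNP r hr).conv (powBound_mittagLefflerDensity hα0 hα1 hγ r) hβ hα0).mono_exponent
        (by linarith)
    have hf := powBound_mittagLefflerDensity (γ := γ) hα0 hα1 hγ r
    exact (((hf.const_mul lam).add (((hgP r).conv hf one_pos hα0).mono_exponent
      (by linarith))).sub h1).congr fun s hs => (hψ s hs.1).symm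
  have hgP' := (hgP r).mono_exponent (y := 2 * α - 1) (by linarith)
  have hform := resolvent_form hα0 hα1 hγ hβ (by linarith) (hgP'.sub (hNP r hr)) hψP
    (lam := lam) fun s hs => by
      rw [hψ s hs.1, forcingTerm, halfLineConv_sub_left hgP' (hNP r hr)
        (powBound_mittagLefflerDensity hα0 hα1 hγ r) hβ hα0 hs]
      ring
  have hvcont : ContinuousOn v (Ioi 0) :=
    continuousOn_const.sup (hcont.inf (continuousOn_powerBarrier α A B))
  have hWc : ContinuousWithinAt (fun s => riccatiNonlinearity α c b ζm lamm ζl v s + ψ s)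
      (Iio r) r := by
    have h1 := (hw (r + 1) (by linarith)).continuousOn_operatorV (c := c) (b := b) (ζl := ζl)
      hα0 hα1 hc hZ
    have h2 := h1.continuousAt (Ioc_mem_nhds hr (by linarith))
    have h3 := hvcont.continuousAt (Ioi_mem_nhds hr)
    have h4 := hcont.continuousAt (Ioi_mem_nhds hr)
    exact (((h3.abs.pow 2).const_mul (1 / 2 * (ζm * √lamm / b) ^ 2)).add h2).add
      h4 |>.continuousWithinAt
  -- At the first zero the truncation vanishes too, so the quadratic term drops out and only the
  -- jump term is left.
  have hWr : riccatiNonlinearity α c b ζm lamm ζl v r + ψ r = operatorV α c b ζl v r := by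
    rw [riccatiNonlinearity, hvr, hzero]; simp
  obtain ⟨ε, hε, hlt⟩ := exists_operatorV_lt hα0 hα1 hγ hc hZ hcompat hα0 hψP (hw r hr) hr
    (fun s _ => truncateTo_nonneg _ _ s)
    (fun s hs => max_le (hpos s hs).le (min_le_left _ _)) hpos
  have hle := halfLineConv_cutLevyDensity_le hα0 hα1 hγ hε hβ hr hlam.le hgP'
    ((hNP r hr).add (hψP.mono_exponent (by linarith))) (hψP.mono_exponent (y := 2 * α - 1)
      (by linarith)) (hg0' r) (by rw [hWr]; exact operatorV_nonneg _ _ _ _ _ _) hWc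
    (fun s hs => (hpos s hs).le) hzero fun s hs => by
      rw [hform s hs]
      congr 4
      ext r
      ring
  rw [hWr] at hle
  exact absurd hlt (not_lt.2 hle)

end Riccati

section GlobalSolution
open Filter Topology

/-! ### Global existence and uniqueness -/

variable {α γ b ζm lamm ζl c lam M T : ℝ} {g ψ φ : ℝ → ℝ}

lemma riccatiNonlinearity_congr {ψ₁ ψ₂ : ℝ → ℝ} (h : ∀ s, 0 < s → ψ₁ s = ψ₂ s) {s : ℝ}
    (hs : 0 < s) : riccatiNonlinearity α c b ζm lamm ζl ψ₁ s
      = riccatiNonlinearity α c b ζm lamm ζl ψ₂ s := by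
  rw [riccatiNonlinearity, riccatiNonlinearity, h s hs, operatorV_congr hs.le fun r hr => h r hr.1]

/-- There is a nonnegative solution of the equation lying below the forcing term. -/
theorem exists_nonneg_solution (hα : 1 / 2 < α) (hα1 : α < 1) (hγ : 0 < γ)
    (hc : 0 ≤ c) (hZ : 0 ≤ ζl / b)
    (hcompat : ζl / b * (c / (α + 1)) ≤ α / (γ * Real.Gamma (1 - α)))
    (hg : MemLp g ⊤ (volume.restrict (Ioi (0 : ℝ))))
    (hg0 : ∀ᵐ t ∂(volume.restrict (Ioi (0 : ℝ))), 0 ≤ g t) (hlam : 0 ≤ lam) :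
    ∃ ψ : ℝ → ℝ, (∀ T, 0 < T → AEStronglyMeasurable ψ (volume.restrict (Ioc 0 T))) ∧
      ∀ t, 0 < t → 0 ≤ ψ t ∧ ψ t ≤ forcingTerm α γ lam g t ∧
        ψ t = forcingTerm α γ lam g t
          - halfLineConv (riccatiNonlinearity α c b ζm lamm ζl ψ)
            (mittagLefflerDensity α γ) t := by
  have hα0 : 0 < α := by linarith
  have hN := singularLipschitz_riccatiNonlinearity (ζm := ζm) (lamm := lamm) hα0 hα1 hc hZ
  have hA0 : 0 < γ / Real.Gamma α := div_pos hγ (Real.Gamma_pos_of_pos hα0)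
  obtain ⟨B, hB, hforce⟩ := exists_forcingTerm_le hα0 hα1 hγ hg
  -- The extra 1 makes the same barrier dominate the forcing for every parameter in [0, λ + 1], as
  -- the perturbation λ + 1/(k+1) below requires.
  set A := (lam + 1) * (γ / Real.Gamma α) with hAdef
  have hA : 0 ≤ A := by positivity
  set U := powerBarrier α A B with hU
  have hhm : ∀ l T, AEStronglyMeasurable (forcingTerm α γ l g) (volume.restrict (Ioc 0 T)) :=
    fun l T => ((continuousOn_forcingTerm hα0 hα1 hγ hg).mono
      Ioc_subset_Ioi_self).aestronglyMeasurable measurableSet_Ioc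
  have hhU : ∀ l, 0 ≤ l → l ≤ lam + 1 → ∀ t, 0 < t → |forcingTerm α γ l g t| ≤ U t := by
    intro l hl hl1 t ht
    refine (hforce l hl t ht).trans (add_le_add_left (mul_le_mul_of_nonneg_right
      (mul_le_mul_of_nonneg_right hl1 hA0.le) (Real.rpow_nonneg ht.le _)) _)
  have hM : ∀ T, 0 < T → 0 ≤ A + B * T := fun T hT => by positivity
  have hP : ∀ T, 0 < T → ∀ ψ, AEStronglyMeasurable ψ (volume.restrict (Ioc 0 T)) →
      WeightedBound α (A + B * T) T (truncateTo U ψ) := fun T _ ψ hψ =>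
    weightedBound_truncateTo hA hB hψ
  have hsol : ∀ l : ℝ, ∃ ψ : ℝ → ℝ,
      (∀ T, 0 < T → AEStronglyMeasurable ψ (volume.restrict (Ioc 0 T))) ∧
      ∀ t, 0 < t → ψ t = forcingTerm α γ l g t
        - halfLineConv (riccatiNonlinearity α c b ζm lamm ζl (truncateTo U ψ))
          (mittagLefflerDensity α γ) t := fun l =>
    hN.exists_solution hα hα1 hγ hM hP (abs_truncateTo_sub_le U) fun T _ => hhm l T
  have hbound : ∀ l, 0 ≤ l → l ≤ lam + 1 → ∀ ψ : ℝ → ℝ,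
      (∀ T, 0 < T → AEStronglyMeasurable ψ (volume.restrict (Ioc 0 T))) →
      (∀ t, 0 < t → ψ t = forcingTerm α γ l g t
        - halfLineConv (riccatiNonlinearity α c b ζm lamm ζl (truncateTo U ψ))
          (mittagLefflerDensity α γ) t) →
      ∀ T, 0 < T → ∃ D, ∀ t ∈ Ioc 0 T, |ψ t| ≤ D * t ^ (α - 1) := by
    intro l hl hl1 ψ hψm hψ T hT
    obtain ⟨D, hD0, hD⟩ := hN.exists_conv_bound hα hα1 hγ hT (hP T hT ψ (hψm T hT))
    refine ⟨A + B * T + D * T ^ (2 * α - 1), fun t ht => ?_⟩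
    rw [hψ t ht.1, add_mul]
    refine (abs_sub _ _).trans (add_le_add ((hhU l hl hl1 t ht.1).trans (powerBarrier_le hB ht))
      ((hD t ht).trans ?_))
    rw [show 3 * α - 1 - 1 = (2 * α - 1) + (α - 1) by ring, Real.rpow_add ht.1, ← mul_assoc]
    exact mul_le_mul_of_nonneg_right (mul_le_mul_of_nonneg_left
      (Real.rpow_le_rpow ht.1.le ht.2 (by linarith)) hD0) (Real.rpow_nonneg ht.1.le _)
  obtain ⟨ψ, hψm, hψ⟩ := hsol lam
  have hnonneg : ∀ t, 0 < t → 0 ≤ ψ t := by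
    intro t ht
    obtain ⟨A', hA'0, hstab⟩ := hN.exists_stability hα hα1 hγ ht (hM t ht)
    -- Strict positivity is available only for a positive parameter, so λ is raised by 1/(k+1).
    -- Stability makes the error O(1/(k+1)), and the limit gives ψ ≥ 0 also when λ = 0.
    have hk : ∀ k : ℕ, -(A' * (1 / ((k : ℝ) + 1) * (γ / Real.Gamma α)) * t ^ (α - 1)) ≤ ψ t := by
      intro k
      have hk0 : (0 : ℝ) < 1 / ((k : ℝ) + 1) := Nat.one_div_pos_of_nat
      have hk1 : 1 / ((k : ℝ) + 1) ≤ 1 := by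
        rw [div_le_one (by positivity)]
        linarith [(Nat.cast_nonneg k : (0 : ℝ) ≤ k)]
      obtain ⟨ψk, hψkm, hψk⟩ := hsol (lam + 1 / ((k : ℝ) + 1))
      have hpos := pos_of_truncated_equation hα hα1 hγ hc hZ hcompat hg hg0
        (show 0 < lam + 1 / ((k : ℝ) + 1) by linarith) hA hB hψkm hψk ht
      obtain ⟨D₁, hD₁⟩ := hbound lam hlam (by linarith) ψ hψm hψ t ht
      obtain ⟨D₂, hD₂⟩ := hbound (lam + 1 / ((k : ℝ) + 1)) (by linarith) (by linarith) ψk hψkm hψk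
        t ht
      have h := hstab ψk ψ (truncateTo U ψk) (truncateTo U ψ)
        (forcingTerm α γ (lam + 1 / ((k : ℝ) + 1)) g) (forcingTerm α γ lam g)
        (1 / ((k : ℝ) + 1) * (γ / Real.Gamma α)) (D₂ + D₁) (hP t ht _ (hψkm t ht))
        (hP t ht _ (hψm t ht)) (fun s _ => abs_truncateTo_sub_le U ψk ψ s)
        (fun s hs => hψk s hs.1) (fun s hs => hψ s hs.1)
        (fun s hs => by
          rw [add_mul]
          exact (abs_sub _ _).trans (add_le_add (hD₂ s hs) (hD₁ s hs)))
        (fun s hs => by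
          have hf := mittagLefflerDensity_pos hα0 hα1 hγ hs.1
          have e : forcingTerm α γ (lam + 1 / ((k : ℝ) + 1)) g s - forcingTerm α γ lam g s
              = 1 / ((k : ℝ) + 1) * mittagLefflerDensity α γ s := by
            rw [forcingTerm, forcingTerm]; ring
          rw [e, abs_of_pos (mul_pos hk0 hf), mul_assoc]
          exact mul_le_mul_of_nonneg_left (mittagLefflerDensity_le hα0 hα1 hγ hs.1) hk0.le)
        t ⟨ht, le_rfl⟩
      have := (le_abs_self _).trans h
      linarith
    have hlim : Tendsto (fun k : ℕ =>
        -(A' * (1 / ((k : ℝ) + 1) * (γ / Real.Gamma α)) * t ^ (α - 1))) atTop (𝓝 0) := by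
      have h1 := ((((tendsto_one_div_add_atTop_nhds_zero_nat (𝕜 := ℝ)).mul_const
        (γ / Real.Gamma α)).const_mul A').mul_const (t ^ (α - 1))).neg
      simpa using h1
    exact le_of_tendsto' hlim hk
  have hle : ∀ t, 0 < t → ψ t ≤ forcingTerm α γ lam g t := by
    intro t ht
    have := halfLineConv_nonneg_of_ae hα0 hα1 hγ ht (.of_forall fun s =>
      riccatiNonlinearity_nonneg (α := α) (c := c) (b := b) (ζm := ζm) (lamm := lamm) (ζl := ζl)
        (ψ := truncateTo U ψ) s)
    rw [hψ t ht]
    linarith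
  -- Now 0 ≤ ψ ≤ U, so the truncation is inactive and ψ solves the original equation.
  have htrunc : ∀ s, 0 < s → truncateTo U ψ s = ψ s := by
    intro s hs
    have h1 : ψ s ≤ U s := (hle s hs).trans ((le_abs_self _).trans
      (hhU lam hlam (by linarith) s hs))
    rw [truncateTo, min_eq_left h1, max_eq_right (hnonneg s hs)]
  refine ⟨ψ, hψm, fun t ht => ⟨hnonneg t ht, hle t ht, ?_⟩⟩
  rw [hψ t ht]
  congr 1
  exact halfLineConv_congr ht.le (fun s hs => riccatiNonlinearity_congr htrunc hs.1)
    fun _ _ => rfl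

/-- A bounded function on (0, T] also obeys the weighted bound, because T^{1-α} s^{α-1} ≥ 1 there.
Uniqueness can thus treat λ = 0 and λ > 0 together. -/
lemma MemSolutionSpace.exists_weightedBound (hα1 : α < 1) (hlam : 0 ≤ lam) (hT : 0 < T)
    (h : MemSolutionSpace α lam T φ) : ∃ M, WeightedBound α M T φ := by
  obtain ⟨hi, h1, h2⟩ := h
  rcases hlam.eq_or_lt with h0 | h0
  · obtain ⟨B, hB⟩ := h2 h0.symm
    have hB' : ∀ s ∈ Ioc 0 T, |φ s| ≤ B := fun s hs => hB ⟨s, hs, rfl⟩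
    have hB0 : 0 ≤ B := (abs_nonneg _).trans (hB' T ⟨hT, le_rfl⟩)
    refine ⟨B * T ^ (1 - α), hi.1, fun s hs => (hB' s hs).trans ?_⟩
    have h3 : (1 : ℝ) ≤ T ^ (1 - α) * s ^ (α - 1) := by
      calc (1 : ℝ) = s ^ (1 - α) * s ^ (α - 1) := by rw [← Real.rpow_add hs.1]; simp
        _ ≤ _ := mul_le_mul_of_nonneg_right (Real.rpow_le_rpow hs.1.le hs.2 (by linarith))
          (Real.rpow_nonneg hs.1.le _)
    rw [mul_assoc]
    exact le_mul_of_one_le_right hB0 h3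
  · obtain ⟨B, hB⟩ := h1 h0
    refine ⟨B, hi.1, fun s hs => ?_⟩
    have h3 : s ^ (1 - α) * |φ s| ≤ B := hB ⟨s, hs, rfl⟩
    have h4 := mul_le_mul_of_nonneg_right h3 (Real.rpow_nonneg hs.1.le (α - 1))
    have h5 : s ^ (1 - α) * s ^ (α - 1) = 1 := by rw [← Real.rpow_add hs.1]; simp
    calc |φ s| = s ^ (1 - α) * |φ s| * s ^ (α - 1) := by
          rw [mul_right_comm, h5, one_mul]
      _ ≤ _ := h4

/-- Stability with no truncation and zero forcing error, on a ball of radius M₁ + M₂ that contains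
both solutions. -/
lemma eqOn_of_isGlobalSolution (hα : 1 / 2 < α) (hα1 : α < 1) (hγ : 0 < γ) (hc : 0 ≤ c)
    (hZ : 0 ≤ ζl / b) (hlam : 0 ≤ lam)
    (hφ : IsGlobalSolution α γ b ζm lamm ζl c lam g φ)
    (hψ : IsGlobalSolution α γ b ζm lamm ζl c lam g ψ) : EqOn φ ψ (Ioi 0) := by
  intro t ht
  have ht0 : 0 < t := ht
  have hα0 : 0 < α := by linarith
  have hN := singularLipschitz_riccatiNonlinearity (ζm := ζm) (lamm := lamm) hα0 hα1 hc hZ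
  obtain ⟨hφm, hφe⟩ := hφ t ht0
  obtain ⟨hψm, hψe⟩ := hψ t ht0
  obtain ⟨M₁, w₁⟩ := hφm.exists_weightedBound hα1 hlam ht0
  obtain ⟨M₂, w₂⟩ := hψm.exists_weightedBound hα1 hlam ht0
  have hM₁ := w₁.nonneg ht0
  have hM₂ := w₂.nonneg ht0
  have w₁' : WeightedBound α (M₁ + M₂) t φ := ⟨w₁.meas, fun s hs => (w₁.bound s hs).trans
    (mul_le_mul_of_nonneg_right (by linarith) (Real.rpow_nonneg hs.1.le _))⟩
  have w₂' : WeightedBound α (M₁ + M₂) t ψ := ⟨w₂.meas, fun s hs => (w₂.bound s hs).trans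
    (mul_le_mul_of_nonneg_right (by linarith) (Real.rpow_nonneg hs.1.le _))⟩
  obtain ⟨A, hA, hstab⟩ := hN.exists_stability hα hα1 hγ ht0 (add_nonneg hM₁ hM₂)
  have h := hstab φ ψ φ ψ (forcingTerm α γ lam g) (forcingTerm α γ lam g) 0 (M₁ + M₂) w₁' w₂'
    (fun s _ => le_rfl)
    (fun s hs => by rw [hφe s hs, riccatiRHS_eq hα hα1 hγ hc hZ w₁ hs])
    (fun s hs => by rw [hψe s hs, riccatiRHS_eq hα hα1 hγ hc hZ w₂ hs])
    (fun s hs => by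
      rw [add_mul]
      exact (abs_sub _ _).trans (add_le_add (w₁.bound s hs) (w₂.bound s hs)))
    (fun s _ => by simp) t ⟨ht0, le_rfl⟩
  rw [mul_zero, zero_mul] at h
  exact sub_eq_zero.1 (abs_eq_zero.1 (le_antisymm h (abs_nonneg _)))

end GlobalSolution

theorem mainTheorem2 (α γ b ζm lamm ζl c : ℝ)
    (hα : 1 / 2 < α) (hα1 : α < 1) (hγ : 0 < γ) (hb : 0 < b)
    (hζm : 0 ≤ ζm) (hlamm : 0 ≤ lamm) (hζl : 0 ≤ ζl) (hc : 0 ≤ c)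
    -- `(ζl/b) ν_*([t,∞)) ≤ -L_K'(t)` for `t > 0`, where `L_K(t) = t^{-α} / (γ Γ(1-α))`
    (hcompat : ζl / b * (c / (α + 1)) ≤ α / (γ * Real.Gamma (1 - α)))
    (lam : ℝ) (hlam : 0 ≤ lam)
    (g : ℝ → ℝ) (hg : MemLp g ⊤ (volume.restrict (Ioi (0 : ℝ))))
    (hg0 : ∀ᵐ t ∂(volume.restrict (Ioi (0 : ℝ))), 0 ≤ g t) :
    ∃ ψ : ℝ → ℝ,
      IsGlobalSolution α γ b ζm lamm ζl c lam g ψ ∧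
      (∀ φ : ℝ → ℝ, IsGlobalSolution α γ b ζm lamm ζl c lam g φ → EqOn φ ψ (Ioi 0)) ∧
      ContinuousOn ψ (Ioi 0) ∧
      ∀ T : ℝ, 0 < T → ∃ C : ℝ, 0 < C ∧
        ∀ t ∈ Ioc 0 T, 0 ≤ ψ t ∧ ψ t ≤ C * (1 + t ^ (α - 1)) := by
  have hα0 : 0 < α := by linarith
  have hZ : 0 ≤ ζl / b := div_nonneg hζl hb.le
  have hA0 : 0 < γ / Real.Gamma α := div_pos hγ (Real.Gamma_pos_of_pos hα0)
  obtain ⟨B, hB, hforce⟩ := exists_forcingTerm_le hα0 hα1 hγ hg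
  obtain ⟨ψ, hψm, hψ⟩ := exists_nonneg_solution (ζm := ζm) (lamm := lamm) hα hα1 hγ hc hZ hcompat
    hg hg0 hlam
  have hle : ∀ t, 0 < t → ψ t ≤ powerBarrier α (lam * (γ / Real.Gamma α)) B t := fun t ht =>
    (hψ t ht).2.1.trans ((le_abs_self _).trans (hforce lam hlam t ht))
  have hw : ∀ T, 0 < T → WeightedBound α (lam * (γ / Real.Gamma α) + B * T) T ψ := fun T hT =>
    ⟨hψm T hT, fun t ht => by
      rw [abs_of_nonneg (hψ t ht.1).1]
      exact (hle t ht.1).trans (powerBarrier_le hB ht)⟩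
  have hsol : IsGlobalSolution α γ b ζm lamm ζl c lam g ψ := by
    refine fun T hT => ⟨⟨(hw T hT).powBound.integrableOn hα0, fun _ => ?_, fun h0 => ?_⟩,
      fun t ht => ?_⟩
    · refine ⟨lam * (γ / Real.Gamma α) + B * T, ?_⟩
      rintro _ ⟨t, ht, rfl⟩
      have h1 := mul_le_mul_of_nonneg_left ((hw T hT).bound t ht)
        (Real.rpow_nonneg ht.1.le (1 - α))
      have h2 : t ^ (1 - α) * t ^ (α - 1) = 1 := by rw [← Real.rpow_add ht.1]; simp
      rwa [mul_left_comm, h2, mul_one] at h1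
    -- For λ = 0 the bound on the forcing reduces to B t^α, which is bounded on (0, T].
    · refine ⟨B * T ^ α, ?_⟩
      rintro _ ⟨t, ht, rfl⟩
      have h1 := hle t ht.1
      rw [h0, powerBarrier, zero_mul, zero_mul, zero_add] at h1
      simp only [abs_of_nonneg (hψ t ht.1).1]
      exact h1.trans (mul_le_mul_of_nonneg_left (Real.rpow_le_rpow ht.1.le ht.2 hα0.le) hB)
    · rw [riccatiRHS_eq hα hα1 hγ hc hZ (hw T hT) ht]
      exact (hψ t ht.1).2.2
  refine ⟨ψ, hsol, fun φ hφ => eqOn_of_isGlobalSolution hα hα1 hγ hc hZ hlam hφ hsol, ?_,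
    fun T hT => ?_⟩
  · exact ((continuousOn_forcingTerm hα0 hα1 hγ hg).sub
      (PowBound.continuousOn_conv_mittagLefflerDensity hα0 hα1 hγ (by linarith) fun T hT =>
        (hw T hT).powBound_riccatiNonlinearity hα0 hα1 hc hZ hT)).congr
      fun t ht => (hψ t ht).2.2
  · have hBT : 0 ≤ B * T ^ α := mul_nonneg hB (Real.rpow_nonneg hT.le _)
    have hl : 0 ≤ lam * (γ / Real.Gamma α) := mul_nonneg hlam hA0.le
    refine ⟨lam * (γ / Real.Gamma α) + B * T ^ α + 1, by linarith, fun t ht =>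
      ⟨(hψ t ht.1).1, (hle t ht.1).trans ?_⟩⟩
    have h1 : B * t ^ α ≤ B * T ^ α :=
      mul_le_mul_of_nonneg_left (Real.rpow_le_rpow ht.1.le ht.2 hα0.le) hB
    have h2 := Real.rpow_nonneg ht.1.le (α - 1)
    have h3 := mul_nonneg hBT h2
    rw [powerBarrier]
    linarith
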